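/- Let $m\ge 0$, $\hbar>0$, $J=\begin{bmatrix}0&-I\\ I&0\end{bmatrix}$, and write $\pmb u=(\tilde{\pmb u},\tilde{\pmb v})\in\mathbb C^m\times\mathbb C^m$, $\langle\cdot,\cdot\rangle$ for the canonical complex bilinear form (no conjugation) and vectors as rows. For a complex symmetric $2m\times 2m$ matrix $K$ and $\Lambda=K+J$, let $$f*_Kg=\sum_{k\ge0}\frac{(i\hbar)^k}{k!\,2^k}\sum\Lambda_{i_1j_1}\cdots\Lambda_{i_kj_k}\,\partial_{u_{i_1}}\!\cdots\partial_{u_{i_k}}f\;\partial_{u_{j_1}}\!\cdots\partial_{u_{j_k}}g,\qquad {:}e_*^{\frac1{i\hbar}\langle a,\pmb u\rangle}{:}_K=e^{\frac1{4i\hbar}\langle aK,a\rangle+\frac1{i\hbar}\langle a,\pmb u\rangle}.$$ *Real forms and $V$-classes.* $V\subset\mathbb C^{2m}$ denotes a real subspace spanned over $\mathbb R$ by $2m$ vectors $b_i$ with $\langle b_i,b_j\rangle=\varepsilon\delta_{ij}$ for some $\varepsilon\in\{1,-1\}$, such that $VJ=V$, $\mathbb C^{2m}=V\oplus iV$ and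 $V=V_{\tilde u}\oplus V_{\tilde v}$, where $V_{\tilde u}=V\cap(\mathbb C^m\times0)$ and $V_{\tilde v}=V\cap(0\times\mathbb C^m)$. The $V$-class $\mathfrak H_+(V)$ is the set of complex symmetric $K$ for which there is $c>0$ with $\frac1\hbar\langle\pi_{re}(\xi(iK)),\xi\rangle\ge c|\xi|^2$ for all $\xi\in V$, $\pi_{re}$ being the projection to $V$ along $iV$. *Delta functions.* Let $d\!\!\!^-$ be the standard volume element $\sqrt{|\det(\text{Gram matrix of }\langle\cdot,\cdot\rangle)|}\,dx$ of $V_{\tilde u}$ (resp. $V_{\tilde v}$) divided by $(2\pi\hbar)^{m/2}$, and $$\delta_*(\tilde{\pmb u})=\int_{V_{\tilde u}}e_*^{\frac1{i\hbar}\langle\xi,\pmb u\rangle}\,d\!\!\!^-\xi,\qquad \delta_*(\tilde{\pmb v})=\int_{V_{\tilde v}}e_*^{\frac1{i\hbar}\langle\eta,\pmb u\rangle}\,d\!\!\!^-\eta .$$ Products are taken under the integral signs: ${:}\delta_*(\tilde{\pmb v})*\delta_*(\tilde{\pmb u}){:}_K=\int_{V_{\tilde v}}\!\int_{V_{\tilde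 u}}{:}e_*^{\frac1{i\hbar}\langle\eta,\pmb u\rangle}{:}_K*_K{:}e_*^{\frac1{i\hbar}\langle\xi,\pmb u\rangle}{:}_K\,d\!\!\!^-\xi\,d\!\!\!^-\eta$, and likewise in the other order. *Vacuums.* Let $a\circ b=\frac12(a*b+b*a)$ and $H_*=\sum_{k=1}^m\frac1{i\hbar}\tilde u_k\circ\tilde v_k$. The star-exponential ${:}e_*^{tH_*}{:}_K$, $t\in\mathbb R$, is the family $f_t$ of entire functions on $\mathbb C^{2m}$, real analytic in $(t,\pmb u)$, with $\frac{d}{dt}f_t={:}H_*{:}_K*_Kf_t$ and $f_0=1$. We say that the vacuum (resp. bar-vacuum) is defined for $K$ if this family exists and is unique and the limit $${:}\widetilde\varpi(L){:}_K=\lim_{t\to-\infty}e^{-\frac m2t}\,{:}e_*^{tH_*}{:}_K\qquad\Big(\text{resp. } {:}\widetilde\varpi(\overline L){:}_K=\lim_{t\to+\infty}e^{\frac m2t}\,{:}e_*^{tH_*}{:}_K\Big)$$ exists uniformly on compact subsets of $\mathbb C^{2m}$. **Proposition.** (1) For every such $V$ and every $K\in\mathfrak H_+(V)$, the integrals defining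 ${:}\delta_*(\tilde{\pmb u}){:}_K$, ${:}\delta_*(\tilde{\pmb v}){:}_K$, and (as integrals over the product space) ${:}\delta_*(\tilde{\pmb v})*\delta_*(\tilde{\pmb u}){:}_K$ and ${:}\delta_*(\tilde{\pmb u})*\delta_*(\tilde{\pmb v}){:}_K$ converge absolutely at every $\pmb u\in\mathbb C^{2m}$, the vacuum and the bar-vacuum are defined for $K$, and $${:}\delta_*(\tilde{\pmb v})*\delta_*(\tilde{\pmb u}){:}_K={:}\widetilde\varpi(L){:}_K,\qquad {:}\delta_*(\tilde{\pmb u})*\delta_*(\tilde{\pmb v}){:}_K={:}\widetilde\varpi(\overline L){:}_K .$$ (2) The vacuum and the bar-vacuum are defined for generic $K$, that is, for all $K$ in some open dense subset of the space of complex symmetric $2m\times2m$ matrices. -/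

import Mathlib

open Complex MeasureTheory Filter Topology

noncomputable section

namespace StarVac

/-- Indices of the `2m` coordinates `u = (ũ, ṽ)`; `Sum.inl k` is `ũ_k`, `Sum.inr k` is `ṽ_k`. -/
abbrev Idx (m : ℕ) : Type := Fin m ⊕ Fin m

/-- Complex `2m`-space. The canonical complex bilinear form on it is `x ⬝ᵥ y` (no conjugation). -/
abbrev Sp (m : ℕ) : Type := Idx m → ℂ

/-- The `K`-ordered star product: with `Λ = K + J`, `J = [[0, -I], [I, 0]]`,
`f *_K g = ∑ₖ (iħ)ᵏ / (k! 2ᵏ) ∑ Λ_{i₁j₁} ⋯ Λ_{iₖjₖ} (∂_{i₁} ⋯ ∂_{iₖ} f) (∂_{j₁} ⋯ ∂_{jₖ} g)`. -/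
def starMul {m : ℕ} (ħ : ℝ) (K : Matrix (Idx m) (Idx m) ℂ) (f g : Sp m → ℂ) (u : Sp m) : ℂ :=
  ∑' k : ℕ, (I * (ħ : ℂ)) ^ k / ((k.factorial : ℂ) * 2 ^ k) *
    ∑ i : Fin k → Idx m, ∑ j : Fin k → Idx m,
      (∏ l, (K + Matrix.J (Fin m) ℂ) (i l) (j l)) *
        iteratedFDeriv ℂ k f u (fun l => Pi.single (i l) 1) *
        iteratedFDeriv ℂ k g u (fun l => Pi.single (j l) 1)

/-- `:e_*^{(1/iħ)⟨a, u⟩}:_K = exp ((1/4iħ)⟨aK, a⟩ + (1/iħ)⟨a, u⟩)`. -/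
def starExpLin {m : ℕ} (ħ : ℝ) (K : Matrix (Idx m) (Idx m) ℂ) (a u : Sp m) : ℂ :=
  Complex.exp (1 / (4 * I * (ħ : ℂ)) * (Matrix.vecMul a K ⬝ᵥ a) + 1 / (I * (ħ : ℂ)) * (a ⬝ᵥ u))

/-- `:∫ e_*^{(1/iħ)⟨ξ, u⟩} dμ(ξ):_K`. -/
def superpos {m : ℕ} (ħ : ℝ) (K : Matrix (Idx m) (Idx m) ℂ) (μ : Measure (Sp m)) (u : Sp m) : ℂ :=
  ∫ ξ, starExpLin ħ K ξ u ∂μ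

/-- The `K`-ordered expression of the `*`-product of two superpositions of star-exponentials of
linear forms:
`∫∫ :e_*^{(1/iħ)⟨ξ, u⟩} * e_*^{(1/iħ)⟨η, u⟩}:_K dν(η) dμ(ξ)`. -/
def superposMul {m : ℕ} (ħ : ℝ) (K : Matrix (Idx m) (Idx m) ℂ) (μ ν : Measure (Sp m))
    (u : Sp m) : ℂ :=
  ∫ ξ, ∫ η, starMul ħ K (starExpLin ħ K ξ) (starExpLin ħ K η) u ∂ν ∂μ

/-- The vectors whose `ṽ`-components vanish. -/
def coordU (m : ℕ) : Submodule ℝ (Sp m) where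
  carrier := {x | ∀ k, x (Sum.inr k) = 0}
  add_mem' := by
    intro a b ha hb k
    simp [ha k, hb k]
  zero_mem' := by
    intro k
    rfl
  smul_mem' := by
    intro c x hx k
    simp [hx k]

/-- The vectors whose `ũ`-components vanish. -/
def coordV (m : ℕ) : Submodule ℝ (Sp m) where
  carrier := {x | ∀ k, x (Sum.inl k) = 0}
  add_mem' := by
    intro a b ha hb k
    simp [ha k, hb k]
  zero_mem' := by
    intro k
    rfl
  smul_mem' := by
    intro c x hx k
    simp [hx k]

/-- The admissible real forms `V` of complex `2m`-space: spanned over `ℝ` by a frame that is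
orthonormal for the canonical bilinear form up to a common sign (`ε = 1`: an `O(2m)`-frame, as for
`ℝ²ᵐ`; `ε = -1`: `i` times such a frame, as for `(iℝ)²ᵐ`), with `JV = V`, `ℂ²ᵐ = V ⊕ iV`, and
compatible with the splitting into `ũ`- and `ṽ`-coordinates. -/
structure IsRealForm {m : ℕ} (V : Submodule ℝ (Sp m)) : Prop where
  frame : ∃ (ε : ℂ) (b : Idx m → Sp m), (ε = 1 ∨ ε = -1) ∧
    (∀ i j, b i ⬝ᵥ b j = if i = j then ε else 0) ∧ Submodule.span ℝ (Set.range b) = V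
  map_J : (fun x : Sp m => Matrix.vecMul x (Matrix.J (Fin m) ℂ)) '' (V : Set (Sp m)) = V
  add_I : ∀ z : Sp m, ∃! p : V × V, z = (p.1 : Sp m) + I • (p.2 : Sp m)
  split : V = (V ⊓ coordU m) ⊔ (V ⊓ coordV m)

/-- The `V`-class of expression parameters: complex symmetric `K` such that the `V`-real part of
`iK` is positive definite on `V`. Here `v` is the projection of `ξ(iK)` to `V` along `iV`. -/
def VClass {m : ℕ} (ħ : ℝ) (V : Submodule ℝ (Sp m)) : Set (Matrix (Idx m) (Idx m) ℂ) :=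
  {K | K.IsSymm ∧ ∃ c : ℝ, 0 < c ∧ ∀ ξ ∈ V, ∀ v ∈ V, ∀ w ∈ V,
    Matrix.vecMul ξ (I • K) = v + I • w → c * ∑ i, ‖ξ i‖ ^ 2 ≤ 1 / ħ * (v ⬝ᵥ ξ).re}

/-- The standard volume element `√|det g| dx` of a real subspace, `g` being the Gram matrix of the
canonical bilinear form in a basis (the result does not depend on the basis; in an orthonormal
basis it is Lebesgue measure). -/
def stdVolume {m : ℕ} (U : Submodule ℝ (Sp m)) : Measure (Sp m) :=
  ENNReal.ofReal (Real.sqrt ‖(Matrix.of fun i j : Fin (Module.finrank ℝ U) =>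
      ((Module.finBasis ℝ U i : U) : Sp m) ⬝ᵥ ((Module.finBasis ℝ U j : U) : Sp m)).det‖) •
    Measure.map (fun c : Fin (Module.finrank ℝ U) → ℝ =>
      ((∑ i, c i • Module.finBasis ℝ U i : U) : Sp m)) volume

/-- The standard volume element of an `m`-dimensional real subspace divided by `(2πħ)^{m/2}`. -/
def dbar {m : ℕ} (ħ : ℝ) (U : Submodule ℝ (Sp m)) : Measure (Sp m) :=
  ENNReal.ofReal ((Real.sqrt (2 * Real.pi * ħ))⁻¹ ^ m) • stdVolume U

/-- The half-variable delta function `δ_*(ũ) = ∫ e_*^{(1/iħ)⟨ξ̃, ũ⟩} đξ̃` as a superposition: its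
`K`-ordered expression is `superpos ħ K (deltaU ħ V)`. -/
def deltaU {m : ℕ} (ħ : ℝ) (V : Submodule ℝ (Sp m)) : Measure (Sp m) :=
  dbar ħ (V ⊓ coordU m)

/-- The half-variable delta function `δ_*(ṽ) = ∫ e_*^{(1/iħ)⟨η̃, ṽ⟩} đη̃` as a superposition: its
`K`-ordered expression is `superpos ħ K (deltaV ħ V)`. -/
def deltaV {m : ℕ} (ħ : ℝ) (V : Submodule ℝ (Sp m)) : Measure (Sp m) :=
  dbar ħ (V ⊓ coordV m)

/-- `:H_*:_K` for `H_* = ∑ₖ (1/iħ) ũₖ ∘ ṽₖ`, where `a ∘ b = (a * b + b * a) / 2`. -/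
def hamiltonian {m : ℕ} (ħ : ℝ) (K : Matrix (Idx m) (Idx m) ℂ) (u : Sp m) : ℂ :=
  ∑ k : Fin m, 1 / (I * (ħ : ℂ)) *
    ((starMul ħ K (fun x => x (Sum.inl k)) (fun x => x (Sum.inr k)) u +
      starMul ħ K (fun x => x (Sum.inr k)) (fun x => x (Sum.inl k)) u) / 2)

/-- `f t` is a star-exponential `:e_*^{tH_*}:_K`, `t ∈ ℝ`: a real analytic family of entire
functions with `d/dt f_t = :H_*:_K *_K f_t` and `f_0 = 1`. -/
structure IsStarExp {m : ℕ} (ħ : ℝ) (K : Matrix (Idx m) (Idx m) ℂ) (f : ℝ → Sp m → ℂ) : Prop where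
  analytic : AnalyticOnNhd ℝ (fun p : ℝ × Sp m => f p.1 p.2) Set.univ
  entire : ∀ t, Differentiable ℂ (f t)
  init : ∀ u, f 0 u = 1
  evolution : ∀ t u, HasDerivAt (fun s => f s u) (starMul ħ K (hamiltonian ħ K) (f t) u) t

/-- `ϖ` is the `K`-ordered expression of the total vacuum: the star-exponential of `H_*` exists on
the whole real line, is unique, and `e^{-mt/2} e_*^{tH_*} → ϖ` as `t → -∞`, uniformly on compact
sets. -/
def IsVacuum {m : ℕ} (ħ : ℝ) (K : Matrix (Idx m) (Idx m) ℂ) (ϖ : Sp m → ℂ) : Prop :=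
  ∃ f, IsStarExp ħ K f ∧ (∀ g, IsStarExp ħ K g → g = f) ∧
    TendstoLocallyUniformly
      (fun (t : ℝ) (u : Sp m) => (Real.exp (-((m : ℝ) / 2 * t)) : ℂ) * f t u) ϖ atBot

/-- `ϖ` is the `K`-ordered expression of the total bar-vacuum: `e^{mt/2} e_*^{tH_*} → ϖ` as
`t → +∞`, uniformly on compact sets. -/
def IsBarVacuum {m : ℕ} (ħ : ℝ) (K : Matrix (Idx m) (Idx m) ℂ) (ϖ : Sp m → ℂ) : Prop :=
  ∃ f, IsStarExp ħ K f ∧ (∀ g, IsStarExp ħ K g → g = f) ∧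
    TendstoLocallyUniformly
      (fun (t : ℝ) (u : Sp m) => (Real.exp ((m : ℝ) / 2 * t) : ℂ) * f t u) ϖ atTop

end StarVac

end

open Complex MeasureTheory Filter Topology

noncomputable section

namespace StarVac

open Matrix

/-! Write P for the coordinate swap `swapMat`, so that ⟨u, Pu⟩ is twice the sum of the products of
conjugate coordinates. Left `*`-multiplication by the Hamiltonian is a second-order differential
operator that preserves Gaussians. With R(τ) = (P − τK)⁻¹ and τ = tanh(t/2), its flow from the
constant 1 is cosh(t/2)⁻ᵐ det(1 − τKP)^(−1/2) exp((1/iħ)⟨u, τR(τ)u⟩), provided P − τK is invertible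
for all |τ| ≤ 1 (`IsRegular`). That this solves the evolution equation comes down to
`trace_resolvent_identity` and `dotProduct_resolvent_identity`, consequences of PJ = −JP, P² = 1 and
J² = −1. Uniqueness holds because the coefficients do not depend on time: all time derivatives of a
difference of two solutions vanish at t = 0, and the family is analytic. As t → ±∞, τ → ±1 and the
rescaled hyperbolic factor tends to 2ᵐ, so the vacuums are 2ᵐ times the Gaussians at τ = ∓1
(`IsRegular.isVacuum`, `IsRegular.isBarVacuum`).

For the delta functions, two linear exponentials multiply with a twist governed by ⟨a, Jb⟩
(`starMul_starExpLin`). If a and b lie in opposite halves, this twist is a multiple of the quadratic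
form of P at a + b, so the product is the exponential of a + b with K replaced by K ± P. The double
integral is therefore a Gaussian integral over V. In a split frame P becomes a real matrix, so
adding a real multiple of P to K does not change the real part of the form of iK. This one
observation gives absolute convergence and also the invertibility of P − τK for every real τ, hence
regularity.

The exponents agree by inverting K ± P. The prefactors have equal squares, and the sign is settled
by continuity (`frameConst_eq`): K is deformed linearly to −iε, then the coefficient of P is shrunk
to 0, where the integral is a real positive Gaussian.

Regular parameters are open by compactness of [−1, 1]. They are dense since K + isP is regular for
all small s > 0. -/

variable {m : ℕ}

/-! ### Star products of exponentials of linear forms. -/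

/-- The linear form `u ↦ a ⬝ᵥ u` as a continuous linear map. -/
def dotCLM (a : Sp m) : Sp m →L[ℂ] ℂ :=
  ∑ i, a i • ContinuousLinearMap.proj (R := ℂ) (φ := fun _ : Idx m => ℂ) i

lemma dotCLM_apply (a u : Sp m) : dotCLM a u = a ⬝ᵥ u := by
  simp [dotCLM, dotProduct]

lemma iteratedFDeriv_cexp_clm {E : Type*} [NormedAddCommGroup E] [NormedSpace ℂ E]
    (L : E →L[ℂ] ℂ) (c : ℂ) (k : ℕ) (u : E) (v : Fin k → E) :
    iteratedFDeriv ℂ k (fun u => cexp (c + L u)) u v = (∏ l, L (v l)) * cexp (c + L u) := by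
  have h1 : (fun u => cexp (c + L u)) = cexp c • (cexp ∘ L) := by
    ext u
    simp [Complex.exp_add]
  have h2 : ContDiff ℂ k cexp := Complex.contDiff_exp
  rw [h1, iteratedFDeriv_const_smul_apply (by fun_prop),
    L.iteratedFDeriv_comp_right h2 u le_rfl]
  simp only [_root_.smul_apply,
    ContinuousMultilinearMap.compContinuousLinearMap_apply,
    iteratedFDeriv_apply_eq_iteratedDeriv_mul_prod, iteratedDeriv_eq_iterate, iter_deriv_exp,
    smul_eq_mul, Complex.exp_add]
  ring

lemma iteratedFDeriv_starExpLin (ħ : ℝ) (K : Matrix (Idx m) (Idx m) ℂ) (a u : Sp m) (k : ℕ)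
    (i : Fin k → Idx m) :
    iteratedFDeriv ℂ k (starExpLin ħ K a) u (fun l => Pi.single (i l) 1) =
      (∏ l, (1 / (I * (ħ : ℂ)) * a (i l))) * starExpLin ħ K a u := by
  have h := iteratedFDeriv_cexp_clm ((1 / (I * (ħ : ℂ))) • dotCLM a)
    (1 / (4 * I * (ħ : ℂ)) * (Matrix.vecMul a K ⬝ᵥ a)) k u (fun l => Pi.single (i l) 1)
  have e : starExpLin ħ K a = fun u => cexp (1 / (4 * I * (ħ : ℂ)) * (Matrix.vecMul a K ⬝ᵥ a) +
      ((1 / (I * (ħ : ℂ))) • dotCLM a) u) := by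
    funext u
    simp [starExpLin, dotCLM_apply]
  rw [e, h]
  simp [dotCLM_apply]

/-- Each derivative of a linear exponential multiplies it by a component of its covector over iħ.
The order-k term is thus the k-th power of one bilinear expression, and the series is an exponential
series. The constant 1/(2iħ) is (iħ/2)·(1/(iħ))². -/
theorem starMul_starExpLin {ħ : ℝ} (hħ : ħ ≠ 0) (K : Matrix (Idx m) (Idx m) ℂ) (a b u : Sp m) :
    starMul ħ K (starExpLin ħ K a) (starExpLin ħ K b) u =
      starExpLin ħ K a u * starExpLin ħ K b u *
        cexp (1 / (2 * I * (ħ : ℂ)) * (a ⬝ᵥ (K + Matrix.J (Fin m) ℂ) *ᵥ b)) := by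
  unfold starMul
  have hc : (ħ : ℂ) ≠ 0 := by exact_mod_cast hħ
  set Λ := K + Matrix.J (Fin m) ℂ
  have hterm : ∀ k : ℕ, ∑ i : Fin k → Idx m, ∑ j : Fin k → Idx m,
      (∏ l, Λ (i l) (j l)) *
        iteratedFDeriv ℂ k (starExpLin ħ K a) u (fun l => Pi.single (i l) 1) *
        iteratedFDeriv ℂ k (starExpLin ħ K b) u (fun l => Pi.single (j l) 1) =
      starExpLin ħ K a u * starExpLin ħ K b u *
        ((1 / (I * (ħ : ℂ))) ^ 2 * (a ⬝ᵥ Λ *ᵥ b)) ^ k := by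
    intro k
    have h1 : (1 / (I * (ħ : ℂ))) ^ 2 * (a ⬝ᵥ Λ *ᵥ b) = ∑ i, ∑ j,
        Λ i j * (1 / (I * (ħ : ℂ)) * a i) * (1 / (I * (ħ : ℂ)) * b j) := by
      simp only [dotProduct, mulVec, Finset.mul_sum]
      exact Finset.sum_congr rfl fun i _ => Finset.sum_congr rfl fun j _ => by ring
    -- Expanding the k-th power of a double sum produces exactly the sums over the index tuples i
    -- and j.
    rw [h1, Fintype.sum_pow, Finset.mul_sum]
    refine Finset.sum_congr rfl fun i _ => ?_
    rw [Finset.prod_univ_sum, Finset.mul_sum, Fintype.piFinset_univ]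
    refine Finset.sum_congr rfl fun j _ => ?_
    rw [iteratedFDeriv_starExpLin, iteratedFDeriv_starExpLin, Finset.prod_mul_distrib (s := .univ)
      (f := fun l => Λ (i l) (j l) * (1 / (I * (ħ : ℂ)) * a (i l))),
      Finset.prod_mul_distrib (s := .univ) (f := fun l => Λ (i l) (j l))]
    ring
  simp_rw [hterm]
  have hs := (NormedSpace.expSeries_div_hasSum_exp
    (1 / (2 * I * (ħ : ℂ)) * (a ⬝ᵥ Λ *ᵥ b))).mul_left (starExpLin ħ K a u * starExpLin ħ K b u)
  rw [← Complex.exp_eq_exp_ℂ] at hs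
  rw [← hs.tsum_eq]
  refine tsum_congr fun k => ?_
  have : 1 / (2 * I * (ħ : ℂ)) * (a ⬝ᵥ Λ *ᵥ b) =
      (I * ħ) / 2 * ((1 / (I * (ħ : ℂ))) ^ 2 * (a ⬝ᵥ Λ *ᵥ b)) := by
    field_simp
  rw [this, mul_pow ((I * ħ) / 2), div_pow (I * (ħ : ℂ))]
  ring

/-! ### Star products with a quadratic left factor, and their action on Gaussians. -/

lemma iteratedFDeriv_eq_zero_of_fderiv_fderiv_const {E F : Type*} [NormedAddCommGroup E]
    [NormedSpace ℂ E] [NormedAddCommGroup F] [NormedSpace ℂ F] {f : E → F}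
    {c : E →L[ℂ] E →L[ℂ] F} (h : ∀ u, fderiv ℂ (fderiv ℂ f) u = c) {k : ℕ} (hk : 3 ≤ k) (u : E) :
    iteratedFDeriv ℂ k f u = 0 := by
  obtain ⟨k, rfl⟩ := Nat.exists_eq_add_of_le hk
  rw [show 3 + k = k + 1 + 1 + 1 by ring]
  ext v
  rw [iteratedFDeriv_succ_apply_right, iteratedFDeriv_succ_apply_right]
  have : (fun y => fderiv ℂ (fun y => fderiv ℂ f y) y) = fun _ => c := funext h
  rw [this, iteratedFDeriv_const_of_ne (Nat.succ_ne_zero k)]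
  simp

/-- The star product with a factor whose second derivative is constant. -/
lemma starMul_of_fderiv_fderiv_const (ħ : ℝ) (K : Matrix (Idx m) (Idx m) ℂ) {p : Sp m → ℂ}
    {c : Sp m →L[ℂ] Sp m →L[ℂ] ℂ} (h : ∀ u, fderiv ℂ (fderiv ℂ p) u = c) (f : Sp m → ℂ)
    (u : Sp m) :
    starMul ħ K p f u = p u * f u + I * ħ / 2 * ∑ i, ∑ j, (K + Matrix.J (Fin m) ℂ) i j *
        fderiv ℂ p u (Pi.single i 1) * fderiv ℂ f u (Pi.single j 1) +
      (I * ħ) ^ 2 / 8 * ∑ i, ∑ i', ∑ j, ∑ j', (K + Matrix.J (Fin m) ℂ) i j *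
        (K + Matrix.J (Fin m) ℂ) i' j' * c (Pi.single i 1) (Pi.single i' 1) *
        fderiv ℂ (fderiv ℂ f) u (Pi.single j 1) (Pi.single j' 1) := by
  unfold starMul
  -- A factor with constant second derivative kills all orders from 3 on, so no convergence question
  -- arises.
  rw [tsum_eq_sum (s := Finset.range 3)]
  · simp only [Finset.sum_range_succ, Finset.sum_range_zero, zero_add]
    congr 1
    · congr 1
      · simp
      · rw [(Equiv.funUnique (Fin 1) (Idx m)).symm.sum_comp
          (fun i => ∑ j : Fin 1 → Idx m, _) |>.symm]
        simp only [(Equiv.funUnique (Fin 1) (Idx m)).symm.sum_comp _ |>.symm]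
        simp [iteratedFDeriv_one_apply]
    · have e : ∀ F : (Fin 2 → Idx m) → ℂ, ∑ i, F i = ∑ i, ∑ i', F ![i, i'] := by
        intro F
        rw [← (finTwoArrowEquiv (Idx m)).symm.sum_comp, Fintype.sum_prod_type]
        rfl
      simp only [e, iteratedFDeriv_two_apply, h, Fin.prod_univ_two]
      simp
      left
      norm_num
  · intro k hk
    have hk : 3 ≤ k := by simpa using hk
    simp [iteratedFDeriv_eq_zero_of_fderiv_fderiv_const h hk]

/-- The matrix exchanging the `ũ`- and `ṽ`-coordinates. -/
def swapMat (m : ℕ) : Matrix (Idx m) (Idx m) ℂ := fromBlocks 0 1 1 0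

/-- The bilinear form `(w, v) ↦ ⟨A w, v⟩`. -/
def bilinCLM (A : Matrix (Idx m) (Idx m) ℂ) : Sp m →L[ℂ] Sp m →L[ℂ] ℂ :=
  ∑ i, (dotCLM (A i)).smulRight (ContinuousLinearMap.proj (R := ℂ) (φ := fun _ : Idx m => ℂ) i)

lemma bilinCLM_apply (A : Matrix (Idx m) (Idx m) ℂ) (w v : Sp m) :
    bilinCLM A w v = (A *ᵥ w) ⬝ᵥ v := by
  simp [bilinCLM, dotCLM_apply, dotProduct, mulVec, _root_.sum_apply]

lemma mulVec_dotProduct_comm {A : Matrix (Idx m) (Idx m) ℂ} (hA : A.IsSymm) (w v : Sp m) :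
    (A *ᵥ w) ⬝ᵥ v = (A *ᵥ v) ⬝ᵥ w := by
  rw [dotProduct_comm, dotProduct_mulVec, ← mulVec_transpose, hA.eq]

lemma hasFDerivAt_quad {A : Matrix (Idx m) (Idx m) ℂ} (hA : A.IsSymm) (u : Sp m) :
    HasFDerivAt (fun u : Sp m => u ⬝ᵥ A *ᵥ u) ((2 : ℂ) • bilinCLM A u) u := by
  have h := (bilinCLM A).hasFDerivAt (x := u) |>.clm_apply (hasFDerivAt_id u)
  have e : (fun u : Sp m => u ⬝ᵥ A *ᵥ u) = fun u => bilinCLM A u (id u) := by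
    funext u
    rw [bilinCLM_apply, dotProduct_comm, id]
  rw [e]
  refine h.congr_fderiv ?_
  ext v
  simp [bilinCLM_apply, mulVec_dotProduct_comm hA _ u]
  ring

lemma fderiv_mul_cexp_quad {A : Matrix (Idx m) (Idx m) ℂ} (hA : A.IsSymm) (φ β : ℂ) (u : Sp m) :
    HasFDerivAt (fun u : Sp m => φ * cexp (β * (u ⬝ᵥ A *ᵥ u)))
      ((2 * β * (φ * cexp (β * (u ⬝ᵥ A *ᵥ u)))) • bilinCLM A u) u := by
  refine ((((hasFDerivAt_quad hA u).const_mul β).cexp).const_mul φ).congr_fderiv ?_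
  ext v
  simp
  ring

lemma fderiv_fderiv_mul_cexp_quad {A : Matrix (Idx m) (Idx m) ℂ} (hA : A.IsSymm) (φ β : ℂ)
    (u w v : Sp m) :
    fderiv ℂ (fderiv ℂ (fun u : Sp m => φ * cexp (β * (u ⬝ᵥ A *ᵥ u)))) u w v =
      (φ * cexp (β * (u ⬝ᵥ A *ᵥ u))) *
        (2 * β * ((A *ᵥ w) ⬝ᵥ v) + 4 * β ^ 2 * (((A *ᵥ u) ⬝ᵥ w) * ((A *ᵥ u) ⬝ᵥ v))) := by
  have e : fderiv ℂ (fun u : Sp m => φ * cexp (β * (u ⬝ᵥ A *ᵥ u))) = fun u =>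
      (2 * β * (φ * cexp (β * (u ⬝ᵥ A *ᵥ u)))) • bilinCLM A u :=
    funext fun u => (fderiv_mul_cexp_quad hA φ β u).fderiv
  rw [e]
  have h := ((fderiv_mul_cexp_quad hA φ β u).const_mul (2 * β)).fun_smul
    (bilinCLM A).hasFDerivAt
  rw [h.fderiv]
  simp [bilinCLM_apply]
  ring

lemma swapMat_isSymm : (swapMat m).IsSymm := by
  simp [Matrix.IsSymm, swapMat, fromBlocks_transpose]

lemma dotProduct_swapMat (u : Sp m) :
    u ⬝ᵥ swapMat m *ᵥ u = 2 * ∑ k, u (Sum.inl k) * u (Sum.inr k) := by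
  rw [swapMat, fromBlocks_mulVec]
  simp [dotProduct, Fintype.sum_sum_type, Finset.mul_sum, ← Finset.sum_add_distrib]
  exact Finset.sum_congr rfl fun k _ => by ring

lemma starMul_coord (ħ : ℝ) (K : Matrix (Idx m) (Idx m) ℂ) (a b : Idx m) (u : Sp m) :
    starMul ħ K (fun x => x a) (fun x => x b) u =
      u a * u b + I * ħ / 2 * (K + Matrix.J (Fin m) ℂ) a b := by
  have hd : ∀ a : Idx m, fderiv ℂ (fun x : Sp m => x a) = fun _ =>
      ContinuousLinearMap.proj (R := ℂ) (φ := fun _ : Idx m => ℂ) a := fun a => funext fun u =>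
    (ContinuousLinearMap.proj (R := ℂ) (φ := fun _ : Idx m => ℂ) a).hasFDerivAt.fderiv
  have hdd : ∀ a : Idx m, ∀ u, fderiv ℂ (fderiv ℂ (fun x : Sp m => x a)) u = 0 := by
    intro a u
    rw [hd]
    simp
  rw [starMul_of_fderiv_fderiv_const ħ K (hdd a)]
  simp only [hd]
  simp [Pi.single_apply]

lemma trace_mul_swapMat {K : Matrix (Idx m) (Idx m) ℂ} (hK : K.IsSymm) :
    (K * swapMat m).trace = 2 * ∑ k, K (Sum.inl k) (Sum.inr k) := by
  have h : ∀ k, K (Sum.inr k) (Sum.inl k) = K (Sum.inl k) (Sum.inr k) := fun k => hK.apply _ _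
  simp [Matrix.trace, swapMat, Matrix.mul_apply, Fintype.sum_sum_type, Matrix.one_apply, h]
  ring

/-- Symmetrising the product cancels the entries of J, which have opposite signs; only the entries
of K survive, and they add up to the trace. -/
lemma hamiltonian_eq {ħ : ℝ} (hħ : ħ ≠ 0) {K : Matrix (Idx m) (Idx m) ℂ} (hK : K.IsSymm) :
    hamiltonian ħ K = fun u => 1 / (2 * I * ħ) * (u ⬝ᵥ swapMat m *ᵥ u) +
      1 / 4 * (K * swapMat m).trace := by
  funext u
  have hc : (ħ : ℂ) ≠ 0 := by exact_mod_cast hħ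
  rw [dotProduct_swapMat, trace_mul_swapMat hK, hamiltonian]
  simp only [Finset.mul_sum, ← Finset.sum_add_distrib]
  refine Finset.sum_congr rfl fun k _ => ?_
  have h : K (Sum.inr k) (Sum.inl k) = K (Sum.inl k) (Sum.inr k) := hK.apply _ _
  have h1 : Matrix.J (Fin m) ℂ (Sum.inr k) (Sum.inl k) = 1 := by simp [Matrix.J]
  have h2 : Matrix.J (Fin m) ℂ (Sum.inl k) (Sum.inr k) = -1 := by simp [Matrix.J]
  simp only [starMul_coord, Matrix.add_apply, h, h1, h2]
  field_simp
  ring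

lemma fderiv_hamiltonian {ħ : ℝ} (hħ : ħ ≠ 0) {K : Matrix (Idx m) (Idx m) ℂ} (hK : K.IsSymm) :
    fderiv ℂ (hamiltonian ħ K) = fun u => (1 / (I * (ħ : ℂ))) • bilinCLM (swapMat m) u := by
  funext u
  have h := ((hasFDerivAt_quad (swapMat_isSymm (m := m)) u).const_mul (1 / (2 * I * (ħ : ℂ)))).add_const
    (1 / 4 * (K * swapMat m).trace)
  rw [hamiltonian_eq hħ hK, h.fderiv, smul_smul]
  congr 1
  have hc : (ħ : ℂ) ≠ 0 := by exact_mod_cast hħ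
  field_simp

lemma fderiv_fderiv_hamiltonian {ħ : ℝ} (hħ : ħ ≠ 0) {K : Matrix (Idx m) (Idx m) ℂ}
    (hK : K.IsSymm) (u : Sp m) :
    fderiv ℂ (fderiv ℂ (hamiltonian ħ K)) u = (1 / (I * (ħ : ℂ))) • bilinCLM (swapMat m) := by
  rw [fderiv_hamiltonian hħ hK]
  exact ((bilinCLM (swapMat m)).hasFDerivAt (x := u) |>.const_smul (1 / (I * (ħ : ℂ)))).fderiv

/-- Written as an explicit second-order operator because it is used twice: on Gaussians for
existence, and on arbitrary families for uniqueness. -/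
lemma starMul_hamiltonian {ħ : ℝ} (hħ : ħ ≠ 0) {K : Matrix (Idx m) (Idx m) ℂ} (hK : K.IsSymm)
    (f : Sp m → ℂ) (u : Sp m) :
    starMul ħ K (hamiltonian ħ K) f u = hamiltonian ħ K u * f u +
      ∑ j, (1 / 2 * ∑ i, (K + Matrix.J (Fin m) ℂ) i j * (swapMat m *ᵥ u) i) *
        fderiv ℂ f u (Pi.single j 1) +
      ∑ j, ∑ j', (I * ħ / 8 * ((K + Matrix.J (Fin m) ℂ)ᵀ * swapMat m * (K + Matrix.J (Fin m) ℂ)) j j') *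
        fderiv ℂ (fderiv ℂ f) u (Pi.single j 1) (Pi.single j' 1) := by
  have hc : (ħ : ℂ) ≠ 0 := by exact_mod_cast hħ
  rw [starMul_of_fderiv_fderiv_const ħ K (fderiv_fderiv_hamiltonian hħ hK),
    fderiv_hamiltonian hħ hK]
  congr 1
  · congr 1
    rw [Finset.sum_comm, Finset.mul_sum]
    refine Finset.sum_congr rfl fun j _ => ?_
    simp only [Finset.mul_sum, Finset.sum_mul]
    refine Finset.sum_congr rfl fun i _ => ?_
    simp [bilinCLM_apply]
    field_simp
    rw [I_sq]
    ring
  · have h : ∀ F : Idx m → Idx m → Idx m → Idx m → ℂ, ∑ i, ∑ i', ∑ j, ∑ j', F i i' j j' =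
        ∑ j, ∑ j', ∑ i', ∑ i, F i i' j j' := by
      intro F
      calc _ = ∑ i, ∑ j, ∑ j', ∑ i', F i i' j j' := by
            refine Finset.sum_congr rfl fun i _ => ?_
            rw [Finset.sum_comm]
            exact Finset.sum_congr rfl fun j _ => Finset.sum_comm
        _ = _ := by
            rw [Finset.sum_comm]
            refine Finset.sum_congr rfl fun j _ => ?_
            rw [Finset.sum_comm]
            exact Finset.sum_congr rfl fun j' _ => Finset.sum_comm
    rw [h, Finset.mul_sum]
    refine Finset.sum_congr rfl fun j _ => ?_
    rw [Finset.mul_sum]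
    refine Finset.sum_congr rfl fun j' _ => ?_
    simp only [Matrix.mul_apply, Finset.mul_sum, Finset.sum_mul]
    refine Finset.sum_congr rfl fun i' _ => Finset.sum_congr rfl fun i _ => ?_
    have h1 : swapMat m i' i = swapMat m i i' := swapMat_isSymm.apply _ _
    simp [bilinCLM_apply, h1]
    field_simp
    rw [I_sq]
    ring

lemma sum_sum_mul_trace (A Q : Matrix (Idx m) (Idx m) ℂ) (hQ : Q.IsSymm) :
    ∑ j, ∑ j', A j j' * Q j j' = (A * Q).trace := by
  simp only [Matrix.trace, Matrix.diag, Matrix.mul_apply]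
  exact Finset.sum_congr rfl fun j _ => Finset.sum_congr rfl fun j' _ => by rw [hQ.apply]

lemma sum_sum_mul_dotProduct (A : Matrix (Idx m) (Idx m) ℂ) (x : Sp m) :
    ∑ j, ∑ j', A j j' * (x j * x j') = x ⬝ᵥ A *ᵥ x := by
  simp only [dotProduct, mulVec, Finset.mul_sum]
  exact Finset.sum_congr rfl fun j _ => Finset.sum_congr rfl fun j' _ => by ring

/-- The `*`-product of the Hamiltonian with a Gaussian. -/
lemma starMul_hamiltonian_gaussian {ħ : ℝ} (hħ : ħ ≠ 0) {K Q : Matrix (Idx m) (Idx m) ℂ}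
    (hK : K.IsSymm) (hQ : Q.IsSymm) (φ : ℂ) (u : Sp m) :
    starMul ħ K (hamiltonian ħ K) (fun u => φ * cexp (1 / (I * ħ) * (u ⬝ᵥ Q *ᵥ u))) u =
      φ * cexp (1 / (I * ħ) * (u ⬝ᵥ Q *ᵥ u)) *
        (1 / (2 * I * ħ) * ((u + (K + Matrix.J (Fin m) ℂ) *ᵥ Q *ᵥ u) ⬝ᵥ
            swapMat m *ᵥ (u + (K + Matrix.J (Fin m) ℂ) *ᵥ Q *ᵥ u)) +
          1 / 4 * ((K * swapMat m).trace + ((K + Matrix.J (Fin m) ℂ)ᵀ * swapMat m *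
            (K + Matrix.J (Fin m) ℂ) * Q).trace)) := by
  have hc : (ħ : ℂ) ≠ 0 := by exact_mod_cast hħ
  rw [starMul_hamiltonian hħ hK, hamiltonian_eq hħ hK]
  set Λ := K + Matrix.J (Fin m) ℂ
  set E := φ * cexp (1 / (I * ħ) * (u ⬝ᵥ Q *ᵥ u))
  have h1 : ∑ j, (1 / 2 * ∑ i, Λ i j * (swapMat m *ᵥ u) i) *
      fderiv ℂ (fun u => φ * cexp (1 / (I * ħ) * (u ⬝ᵥ Q *ᵥ u))) u (Pi.single j 1) =
      E * (1 / (I * ħ)) * (u ⬝ᵥ swapMat m *ᵥ Λ *ᵥ Q *ᵥ u) := by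
    have : u ⬝ᵥ swapMat m *ᵥ Λ *ᵥ Q *ᵥ u = ∑ j, (∑ i, Λ i j * (swapMat m *ᵥ u) i) * (Q *ᵥ u) j := by
      rw [dotProduct_comm, mulVec_dotProduct_comm swapMat_isSymm, dotProduct_mulVec]
      simp [dotProduct, vecMul, mul_comm]
    rw [this, Finset.mul_sum]
    refine Finset.sum_congr rfl fun j _ => ?_
    rw [(fderiv_mul_cexp_quad hQ φ (1 / (I * ħ)) u).fderiv]
    simp only [_root_.smul_apply, bilinCLM_apply, dotProduct_single, mul_one, smul_eq_mul]
    ring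
  have h2 : ∑ j, ∑ j', (I * ħ / 8 * (Λᵀ * swapMat m * Λ) j j') *
      fderiv ℂ (fderiv ℂ (fun u => φ * cexp (1 / (I * ħ) * (u ⬝ᵥ Q *ᵥ u)))) u (Pi.single j 1)
        (Pi.single j' 1) = E * (1 / 4 * (Λᵀ * swapMat m * Λ * Q).trace +
          1 / (2 * I * ħ) * ((Λ *ᵥ Q *ᵥ u) ⬝ᵥ swapMat m *ᵥ Λ *ᵥ Q *ᵥ u)) := by
    have : (Λ *ᵥ Q *ᵥ u) ⬝ᵥ swapMat m *ᵥ Λ *ᵥ Q *ᵥ u =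
        (Q *ᵥ u) ⬝ᵥ (Λᵀ * swapMat m * Λ) *ᵥ (Q *ᵥ u) := by
      simp only [← mulVec_mulVec, dotProduct_mulVec (Q *ᵥ u) Λᵀ, vecMul_transpose]
    rw [this, ← sum_sum_mul_trace _ _ hQ, ← sum_sum_mul_dotProduct]
    simp only [Finset.mul_sum, ← Finset.sum_add_distrib]
    refine Finset.sum_congr rfl fun j _ => Finset.sum_congr rfl fun j' _ => ?_
    rw [fderiv_fderiv_mul_cexp_quad hQ]
    simp only [dotProduct_single, mul_one, mulVec_single, MulOpposite.op_one, one_smul,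
      Matrix.col_apply, hQ.apply]
    change _ * (E * _) = _
    field_simp
    ring
  rw [h1, h2]
  -- The orders 0, 1 and 2 supply the square, cross and square terms of the form of P at u + ΛQu;
  -- symmetry of P identifies the two cross terms.
  have h3 : (Λ *ᵥ Q *ᵥ u) ⬝ᵥ swapMat m *ᵥ u = u ⬝ᵥ swapMat m *ᵥ Λ *ᵥ Q *ᵥ u := by
    rw [dotProduct_comm, mulVec_dotProduct_comm swapMat_isSymm, dotProduct_comm]
  simp only [mulVec_add, add_dotProduct, dotProduct_add, h3]
  change _ * E + _ + _ = _
  field_simp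
  ring

/-! ### Algebraic identities for P, J and the resolvent. -/

lemma swapMat_mul_self : swapMat m * swapMat m = 1 := by
  simp [swapMat, fromBlocks_multiply]

lemma swapMat_mul_J : swapMat m * Matrix.J (Fin m) ℂ = -(Matrix.J (Fin m) ℂ * swapMat m) := by
  simp [swapMat, Matrix.J, fromBlocks_multiply, fromBlocks_neg]

/-- An antisymmetric matrix is trace-orthogonal to a symmetric one. -/
lemma trace_J_mul {R : Matrix (Idx m) (Idx m) ℂ} (hR : R.IsSymm) :
    (Matrix.J (Fin m) ℂ * R).trace = 0 := by
  have h : (Matrix.J (Fin m) ℂ * R).trace = -(Matrix.J (Fin m) ℂ * R).trace := by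
    conv_lhs => rw [← trace_transpose, transpose_mul, J_transpose, hR.eq, Matrix.mul_neg, trace_neg,
      trace_mul_comm]
  exact self_eq_neg.mp h

lemma det_swapMat_ne_zero : (swapMat m).det ≠ 0 := by
  have h := congrArg Matrix.det (swapMat_mul_self (m := m))
  rw [det_mul, det_one] at h
  exact left_ne_zero_of_mul_eq_one h

lemma one_add_mul_resolvent {K R : Matrix (Idx m) (Idx m) ℂ} {τ : ℂ}
    (hXR : (swapMat m - τ • K) * R = 1) :
    1 + (K + Matrix.J (Fin m) ℂ) * (τ • R) = (swapMat m + τ • Matrix.J (Fin m) ℂ) * R := by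
  rw [← hXR]
  simp only [sub_mul, add_mul, Matrix.smul_mul, Matrix.mul_smul]
  abel

/-- The resolvent equation gives (K + J)τR = (P + τJ)R − 1. After expansion, anticommutation and JPJ
= P leave tr(KR) and −τ tr(PR), plus terms of trace zero; then PR = 1 + τKR turns the second into
−τ·card − τ² tr(KR). -/
lemma trace_resolvent_identity_aux {n : Type*} [Fintype n] [DecidableEq n]
    {K R P J : Matrix n n ℂ} {τ : ℂ} (hPJ : P * J = -(J * P)) (hPP : P * P = 1) (hJJ : J * J = -1)
    (hJR : (J * R).trace = 0) (hJP : (J * P).trace = 0) (hXR : (P - τ • K) * R = 1) :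
    (K * P).trace + ((K - J) * P * (K + J) * (τ • R)).trace =
      (1 - τ ^ 2) * (K * R).trace - Fintype.card n * τ := by
  have hRX : R * (P - τ • K) = 1 := mul_eq_one_comm.mp hXR
  have h1 : (K + J) * (τ • R) = (P + τ • J) * R - 1 := by
    rw [← hXR]
    simp only [sub_mul, add_mul, Matrix.smul_mul, Matrix.mul_smul]
    abel
  have e1 : J * (P * J) = P := by
    rw [hPJ, Matrix.mul_neg, ← Matrix.mul_assoc, hJJ]; simp
  have h2 : (K - J) * P * ((P + τ • J) * R - 1) =
      K * R - J * R + τ • (K * (P * J) * R) - τ • (P * R) - K * P + J * P := by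
    calc _ = (K - J) * ((P * P) * R + τ • (P * J) * R - P) := by
          simp only [Matrix.mul_sub, Matrix.add_mul, Matrix.mul_add, Matrix.sub_mul,
            Matrix.smul_mul, Matrix.mul_smul, Matrix.mul_assoc, Matrix.mul_one]
      _ = K * R - J * R + τ • (K * (P * J) * R) - τ • (J * (P * J) * R) - K * P + J * P := by
          rw [hPP]
          simp only [Matrix.mul_sub, Matrix.mul_add, Matrix.sub_mul,
            Matrix.smul_mul, Matrix.mul_smul, Matrix.mul_assoc, Matrix.one_mul]
          module
      _ = _ := by rw [e1]
  -- Replace τK by P minus the pencil. The P part gives tr(JR) = 0, and cyclicity cancels the pencil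
  -- against R, leaving tr(PJ) = 0.
  have h3 : τ * (K * (P * J) * R).trace = 0 := by
    have e : τ • (K * (P * J) * R) = J * R - (P - τ • K) * ((P * J) * R) := by
      have : P * (P * J * R) = J * R := by
        rw [← Matrix.mul_assoc, ← Matrix.mul_assoc, hPP, Matrix.one_mul]
      rw [Matrix.sub_mul, this, Matrix.smul_mul]
      simp only [Matrix.mul_assoc]
      abel
    have e2 := congrArg Matrix.trace e
    rw [trace_smul, trace_sub, hJR, trace_mul_comm (P - τ • K), Matrix.mul_assoc (P * J), hRX,
      Matrix.mul_one, hPJ, trace_neg, hJP, ← hPJ] at e2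
    simpa using e2
  have h4 : (P * R).trace = Fintype.card n + τ * (K * R).trace := by
    have e : P * R = 1 + τ • (K * R) := by
      rw [← hXR, Matrix.sub_mul, Matrix.smul_mul]; abel
    rw [e, trace_add, trace_smul, trace_one, smul_eq_mul]
  rw [Matrix.mul_assoc _ _ (τ • R), h1, h2]
  simp only [trace_add, trace_sub, trace_smul, smul_eq_mul, h3, h4, hJR, hJP]
  ring

lemma trace_resolvent_identity {K R : Matrix (Idx m) (Idx m) ℂ} {τ : ℂ} (hK : K.IsSymm)
    (hR : R.IsSymm) (hXR : (swapMat m - τ • K) * R = 1) :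
    (K * swapMat m).trace + ((K + Matrix.J (Fin m) ℂ)ᵀ * swapMat m *
      (K + Matrix.J (Fin m) ℂ) * (τ • R)).trace = (1 - τ ^ 2) * (K * R).trace - 2 * m * τ := by
  have hJt : (K + Matrix.J (Fin m) ℂ)ᵀ = K - Matrix.J (Fin m) ℂ := by
    rw [transpose_add, hK.eq, J_transpose, sub_eq_add_neg]
  rw [hJt, trace_resolvent_identity_aux swapMat_mul_J swapMat_mul_self (J_squared _ _)
    (trace_J_mul hR) (trace_J_mul swapMat_isSymm) hXR]
  have hcard : (Fintype.card (Idx m) : ℂ) = 2 * m := by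
    simp
    ring
  rw [hcard]

/-- By `one_add_mul_resolvent` the vector is (P + τJ)Ru, and (P + τJ)ᵀP(P + τJ) = (1 − τ²)P because
J is antisymmetric and anticommutes with P. The factor 1 − τ² is what makes tanh the right time
change. -/
lemma dotProduct_resolvent_identity {K R : Matrix (Idx m) (Idx m) ℂ} {τ : ℂ}
    (hR : R.IsSymm) (hXR : (swapMat m - τ • K) * R = 1) (u : Sp m) :
    (u + (K + Matrix.J (Fin m) ℂ) *ᵥ (τ • R) *ᵥ u) ⬝ᵥ
        swapMat m *ᵥ (u + (K + Matrix.J (Fin m) ℂ) *ᵥ (τ • R) *ᵥ u) =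
      (1 - τ ^ 2) * (u ⬝ᵥ (R * swapMat m * R) *ᵥ u) := by
  set P := swapMat m
  set J := Matrix.J (Fin m) ℂ
  have h1 : u + (K + J) *ᵥ (τ • R) *ᵥ u = ((P + τ • J) * R) *ᵥ u := by
    rw [← one_add_mul_resolvent hXR, add_mulVec 1, one_mulVec, mulVec_mulVec]
  have hPt : Pᵀ = P := swapMat_isSymm
  have hPJ : P * J = -(J * P) := swapMat_mul_J
  have hPP : P * P = 1 := swapMat_mul_self
  have hJJ : J * J = -1 := J_squared _ _
  have hJt : Jᵀ = -J := J_transpose _ _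
  have h2 : ((P + τ • J) * R)ᵀ * (P * ((P + τ • J) * R)) = (1 - τ ^ 2) • (R * P * R) := by
    rw [transpose_mul, transpose_add, transpose_smul, hPt, hJt, hR.eq]
    have e : (P + τ • -J) * (P * (P + τ • J)) = (1 - τ ^ 2) • P := by
      have e1 : J * (P * J) = P := by
        rw [hPJ, Matrix.mul_neg, ← Matrix.mul_assoc, hJJ]; simp
      have e2 : P * (P * J) = J := by rw [← Matrix.mul_assoc, hPP, Matrix.one_mul]
      simp only [Matrix.mul_add, Matrix.add_mul, hPP, Matrix.mul_smul, Matrix.smul_mul, e1, e2,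
        Matrix.mul_one, Matrix.neg_mul, smul_neg]
      module
    calc _ = R * ((P + τ • -J) * (P * (P + τ • J))) * R := by simp only [Matrix.mul_assoc]
      _ = _ := by rw [e]; simp
  rw [h1, mulVec_mulVec, dotProduct_mulVec, ← vecMul_transpose, vecMul_vecMul, ← dotProduct_mulVec,
    h2, smul_mulVec, dotProduct_smul, smul_eq_mul]

/-! ### The pencil, its determinant and the continuous branch of the inverse square root. -/

/-- The pencil `P - τ K`. -/
def pencil (K : Matrix (Idx m) (Idx m) ℂ) (τ : ℝ) : Matrix (Idx m) (Idx m) ℂ :=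
  swapMat m - (τ : ℂ) • K

/-- The inverse of the pencil `P - τ K`. -/
def resolv (K : Matrix (Idx m) (Idx m) ℂ) (τ : ℝ) : Matrix (Idx m) (Idx m) ℂ := (pencil K τ)⁻¹

lemma continuous_pencil : Continuous fun p : Matrix (Idx m) (Idx m) ℂ × ℝ => pencil p.1 p.2 := by
  unfold pencil
  fun_prop

lemma pencil_mul_resolv {K : Matrix (Idx m) (Idx m) ℂ} {τ : ℝ} (h : (pencil K τ).det ≠ 0) :
    pencil K τ * resolv K τ = 1 := mul_nonsing_inv _ h.isUnit

lemma resolv_mul_pencil {K : Matrix (Idx m) (Idx m) ℂ} {τ : ℝ} (h : (pencil K τ).det ≠ 0) :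
    resolv K τ * pencil K τ = 1 := nonsing_inv_mul _ h.isUnit

lemma resolv_isSymm {K : Matrix (Idx m) (Idx m) ℂ} (hK : K.IsSymm) (τ : ℝ) :
    (resolv K τ).IsSymm := by
  have h1 : (pencil K τ).IsSymm := swapMat_isSymm.sub (hK.smul _)
  rw [Matrix.IsSymm, resolv, transpose_nonsing_inv, h1.eq]

lemma continuousAt_resolv {K : Matrix (Idx m) (Idx m) ℂ} {τ : ℝ} (h : (pencil K τ).det ≠ 0) :
    ContinuousAt (fun p : Matrix (Idx m) (Idx m) ℂ × ℝ => resolv p.1 p.2) (K, τ) := by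
  have h1 : ContinuousAt Inv.inv (pencil K τ) := by
    refine continuousAt_matrix_inv _ ?_
    rw [Ring.inverse_eq_inv']
    exact continuousAt_inv₀ h
  exact ContinuousAt.comp (f := fun p : Matrix (Idx m) (Idx m) ℂ × ℝ => pencil p.1 p.2)
    (x := (K, τ)) h1 continuous_pencil.continuousAt

lemma continuousAt_resolv_right {K : Matrix (Idx m) (Idx m) ℂ} {τ : ℝ}
    (h : (pencil K τ).det ≠ 0) : ContinuousAt (resolv K) τ :=
  ContinuousAt.comp (f := fun s => (K, s)) (x := τ) (continuousAt_resolv h) (by fun_prop)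

lemma isOpen_det_pencil (K : Matrix (Idx m) (Idx m) ℂ) : IsOpen {τ | (pencil K τ).det ≠ 0} := by
  have : Continuous fun τ => (pencil K τ).det :=
    (continuous_pencil.comp (Continuous.prodMk_right K)).matrix_det
  exact isOpen_ne_fun this continuous_const

lemma resolv_sub {K : Matrix (Idx m) (Idx m) ℂ} {τ s : ℝ} (h : (pencil K τ).det ≠ 0)
    (h' : (pencil K s).det ≠ 0) :
    resolv K s - resolv K τ = (s - τ : ℂ) • (resolv K s * K * resolv K τ) := by
  have e : pencil K τ - pencil K s = (s - τ : ℂ) • K := by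
    unfold pencil; module
  calc resolv K s - resolv K τ = resolv K s * (pencil K τ - pencil K s) * resolv K τ := by
        rw [mul_sub, sub_mul, Matrix.mul_assoc, pencil_mul_resolv h, resolv_mul_pencil h',
          Matrix.mul_one, Matrix.one_mul]
    _ = _ := by rw [e]; simp

lemma hasDerivAt_resolv_quad {K : Matrix (Idx m) (Idx m) ℂ} {τ : ℝ}
    (h : (pencil K τ).det ≠ 0) (u : Sp m) :
    HasDerivAt (fun s => u ⬝ᵥ resolv K s *ᵥ u) (u ⬝ᵥ (resolv K τ * K * resolv K τ) *ᵥ u) τ := by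
  rw [hasDerivAt_iff_tendsto_slope]
  have hc : ContinuousAt (fun s => u ⬝ᵥ (resolv K s * K * resolv K τ) *ᵥ u) τ := by
    have h1 : ContinuousAt (resolv K) τ := continuousAt_resolv_right h
    have h2 : Continuous fun A : Matrix (Idx m) (Idx m) ℂ => u ⬝ᵥ (A * K * resolv K τ) *ᵥ u := by
      exact continuous_const.dotProduct
        (((continuous_id.matrix_mul continuous_const).matrix_mul continuous_const).matrix_mulVec
          continuous_const)
    exact ContinuousAt.comp (g := fun A : Matrix (Idx m) (Idx m) ℂ => u ⬝ᵥ (A * K * resolv K τ) *ᵥ u)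
      (f := resolv K) (x := τ) h2.continuousAt h1
  refine (hc.tendsto.mono_left nhdsWithin_le_nhds).congr' ?_
  have h1 : ∀ᶠ s in 𝓝[≠] τ, (pencil K s).det ≠ 0 :=
    nhdsWithin_le_nhds ((isOpen_det_pencil K).mem_nhds h)
  filter_upwards [h1, self_mem_nhdsWithin] with s hs hne
  have hne' : (s - τ : ℂ) ≠ 0 := by
    rw [← ofReal_sub]
    exact_mod_cast sub_ne_zero.mpr hne
  rw [slope_def_module, ← dotProduct_sub, ← sub_mulVec, resolv_sub h hs, smul_mulVec,
    dotProduct_smul, ← Complex.coe_smul, smul_smul]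
  push_cast
  rw [inv_mul_cancel₀ hne', one_smul]

/-- The derivative of τR is R + τRKR = R(P − τK + τK)R = RPR. -/
lemma hasDerivAt_smul_resolv_quad {K : Matrix (Idx m) (Idx m) ℂ} {τ : ℝ}
    (h : (pencil K τ).det ≠ 0) (u : Sp m) :
    HasDerivAt (fun s : ℝ => u ⬝ᵥ ((s : ℂ) • resolv K s) *ᵥ u)
      (u ⬝ᵥ (resolv K τ * swapMat m * resolv K τ) *ᵥ u) τ := by
  have h1 := (HasDerivAt.ofReal_comp (hasDerivAt_id τ)).mul (hasDerivAt_resolv_quad h u)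
  have e : resolv K τ * swapMat m * resolv K τ =
      resolv K τ + (τ : ℂ) • (resolv K τ * K * resolv K τ) := by
    have : swapMat m = pencil K τ + (τ : ℂ) • K := by simp [pencil]
    rw [this, Matrix.mul_add, Matrix.add_mul, resolv_mul_pencil h]
    simp
  have e2 : (fun s : ℝ => u ⬝ᵥ ((s : ℂ) • resolv K s) *ᵥ u) =
      (fun s : ℝ => ((id s : ℝ) : ℂ)) * fun s => u ⬝ᵥ resolv K s *ᵥ u := by
    funext s
    simp [smul_mulVec]
  rw [e2, e]
  refine h1.congr_deriv ?_
  simp [smul_mulVec, add_mulVec]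

/-- The determinant of `1 - τ K P`. -/
def fredholmDet (K : Matrix (Idx m) (Idx m) ℂ) (τ : ℝ) : ℂ := (pencil K τ).det * (swapMat m).det

lemma fredholmDet_zero (K : Matrix (Idx m) (Idx m) ℂ) : fredholmDet K 0 = 1 := by
  simp [fredholmDet, pencil, ← det_mul, swapMat_mul_self]

lemma hasDerivAt_det_one_sub (A : Matrix (Idx m) (Idx m) ℂ) (τ : ℝ) :
    HasDerivAt (fun s : ℝ => (1 - ((s - τ : ℝ) : ℂ) • A).det) (-A.trace) τ := by
  have hf : HasDerivAt (fun r : ℂ => (1 + r • (-A)).det) (-A.trace) 0 := by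
    have h1 : (fun r : ℂ => (1 + r • (-A)).det) = fun r => 1 + (-A).trace * r + Polynomial.eval r
        (1 + (Polynomial.X : Polynomial ℂ) • (-A).map ⇑Polynomial.C).det.divX.divX * r ^ 2 :=
      funext fun r => det_one_add_smul r (-A)
    rw [h1]
    have h2 := ((((hasDerivAt_id (0 : ℂ)).const_mul (-A).trace).const_add 1)).add
      ((Polynomial.hasDerivAt (1 + (Polynomial.X : Polynomial ℂ) •
        (-A).map ⇑Polynomial.C).det.divX.divX 0).mul (hasDerivAt_pow 2 (0 : ℂ)))
    refine h2.congr_deriv ?_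
    simp
  have hg : HasDerivAt (fun s : ℝ => ((s - τ : ℝ) : ℂ)) 1 τ := by
    have := ((hasDerivAt_id τ).sub_const τ).ofReal_comp
    simpa using this
  have hf' : HasDerivAt (fun r : ℂ => (1 + r • (-A)).det) (-A.trace) ((τ - τ : ℝ) : ℂ) := by
    simpa using hf
  have := hf'.comp τ hg
  simpa [Function.comp_def, sub_eq_add_neg] using this

/-- Factoring the pencil at s through the pencil at τ leaves det(1 − (s − τ)KR(τ)), so only the
derivative of a determinant at the identity is needed. -/
lemma hasDerivAt_fredholmDet {K : Matrix (Idx m) (Idx m) ℂ} {τ : ℝ}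
    (h : (pencil K τ).det ≠ 0) :
    HasDerivAt (fredholmDet K) (-(K * resolv K τ).trace * fredholmDet K τ) τ := by
  have e : fredholmDet K = fun s => (1 - ((s - τ : ℝ) : ℂ) • (K * resolv K τ)).det *
      fredholmDet K τ := by
    funext s
    rw [fredholmDet, fredholmDet, ← mul_assoc]
    congr 1
    rw [← det_mul]
    congr 1
    rw [sub_mul, Matrix.one_mul, Matrix.smul_mul, Matrix.mul_assoc, resolv_mul_pencil h]
    simp [pencil]
    module
  have h1 := (hasDerivAt_det_one_sub (K * resolv K τ) τ).mul_const (fredholmDet K τ)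
  rw [← e] at h1
  exact h1

/-- The regular expression parameters: the pencil `P - τ K` is invertible for `|τ| ≤ 1`. -/
def IsRegular (K : Matrix (Idx m) (Idx m) ℂ) : Prop :=
  ∀ τ ∈ Set.Icc (-1 : ℝ) 1, (pencil K τ).det ≠ 0

lemma IsRegular.fredholmDet_ne_zero {K : Matrix (Idx m) (Idx m) ℂ} (hK : IsRegular K) {τ : ℝ}
    (hτ : τ ∈ Set.Icc (-1 : ℝ) 1) : fredholmDet K τ ≠ 0 :=
  mul_ne_zero (hK τ hτ) det_swapMat_ne_zero

/-- The branch of `det (1 - τ K P) ^ (-1/2)` with value `1` at `τ = 0`. -/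
def invSqrtDet (K : Matrix (Idx m) (Idx m) ℂ) (τ : ℝ) : ℂ :=
  cexp (1 / 2 * ∫ s in (0 : ℝ)..τ, (K * resolv K s).trace)

lemma invSqrtDet_zero (K : Matrix (Idx m) (Idx m) ℂ) : invSqrtDet K 0 = 1 := by
  simp [invSqrtDet]

lemma invSqrtDet_ne_zero (K : Matrix (Idx m) (Idx m) ℂ) (τ : ℝ) : invSqrtDet K τ ≠ 0 :=
  Complex.exp_ne_zero _

/-- The derivative is two-sided even at τ = ±1, because invertibility of the pencil persists in a
neighbourhood; this later gives continuity at the limiting parameters. -/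
lemma IsRegular.hasDerivAt_invSqrtDet {K : Matrix (Idx m) (Idx m) ℂ} (hK : IsRegular K) {τ : ℝ}
    (hτ : τ ∈ Set.Icc (-1 : ℝ) 1) :
    HasDerivAt (invSqrtDet K) (1 / 2 * (K * resolv K τ).trace * invSqrtDet K τ) τ := by
  have hc : ContinuousOn (fun s => (K * resolv K s).trace) {τ | (pencil K τ).det ≠ 0} := by
    intro s hs
    have h2 : Continuous fun A : Matrix (Idx m) (Idx m) ℂ => (K * A).trace := by fun_prop
    exact (h2.continuousAt.comp (continuousAt_resolv_right hs)).continuousWithinAt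
  have hU := isOpen_det_pencil K
  have h0 : Set.uIcc 0 τ ⊆ {τ | (pencil K τ).det ≠ 0} := by
    intro s hs
    refine hK s ?_
    have h0 : (0 : ℝ) ∈ Set.Icc (-1 : ℝ) 1 := by norm_num
    exact Set.uIcc_subset_Icc h0 hτ hs
  have h1 := intervalIntegral.integral_hasDerivAt_right (hc.mono h0).intervalIntegrable
    (hc.stronglyMeasurableAtFilter hU τ (hK τ hτ)) (hc.continuousAt (hU.mem_nhds (hK τ hτ)))
  refine (h1.const_mul (1 / 2 : ℂ)).cexp.congr_deriv ?_
  rw [invSqrtDet]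
  ring

/-- The logarithmic derivatives cancel, so the product is constant on the interval and equals its
value at 0. -/
lemma IsRegular.invSqrtDet_sq {K : Matrix (Idx m) (Idx m) ℂ} (hK : IsRegular K) {τ : ℝ}
    (hτ : τ ∈ Set.Icc (-1 : ℝ) 1) : invSqrtDet K τ ^ 2 * fredholmDet K τ = 1 := by
  have hd : ∀ s ∈ Set.Icc (-1 : ℝ) 1, HasDerivWithinAt
      (fun s => invSqrtDet K s ^ 2 * fredholmDet K s) 0 (Set.Icc (-1 : ℝ) 1) s := by
    intro s hs
    refine (((hK.hasDerivAt_invSqrtDet hs).fun_pow 2).fun_mul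
      (hasDerivAt_fredholmDet (hK s hs))).hasDerivWithinAt.congr_deriv ?_
    simp
    ring
  have h := (convex_Icc (-1 : ℝ) 1).norm_image_sub_le_of_norm_hasDerivWithin_le hd
    (C := 0) (by simp) (x := 0) (y := τ) (by norm_num) hτ
  rw [zero_mul, norm_le_zero_iff, sub_eq_zero] at h
  rw [h, invSqrtDet_zero, fredholmDet_zero]
  norm_num

/-! ### Real analyticity of the determinant branch. -/

section Analytic

variable {E : Type*} [NormedAddCommGroup E] [NormedSpace ℝ E] {n : Type*} [Fintype n]
  [DecidableEq n]

lemma analyticAt_det {A : E → Matrix n n ℂ} {x : E}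
    (hA : ∀ i j, AnalyticAt ℝ (fun y => A y i j) x) : AnalyticAt ℝ (fun y => (A y).det) x := by
  simp only [Matrix.det_apply]
  refine Finset.analyticAt_fun_sum _ fun σ _ => ?_
  have h := Finset.analyticAt_fun_prod (𝕜 := ℝ) (f := fun i y => A y (σ i) i) Finset.univ
    (fun i _ => hA (σ i) i)
  simp only [Units.smul_def, zsmul_eq_mul]
  exact analyticAt_const.mul h

lemma analyticAt_inv_apply {A : E → Matrix n n ℂ} {x : E}
    (hA : ∀ i j, AnalyticAt ℝ (fun y => A y i j) x) (hx : (A x).det ≠ 0) (i j : n) :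
    AnalyticAt ℝ (fun y => (A y)⁻¹ i j) x := by
  simp only [Matrix.inv_def, Ring.inverse_eq_inv', Matrix.smul_apply, smul_eq_mul, adjugate_apply]
  refine ((analyticAt_det hA).inv hx).mul (analyticAt_det fun k l => ?_)
  by_cases h : k = j
  · subst h
    simpa using analyticAt_const
  · simpa [updateRow_ne h] using hA k l

end Analytic

lemma analyticAt_pencil_apply (K : Matrix (Idx m) (Idx m) ℂ) (τ : ℝ) (i j : Idx m) :
    AnalyticAt ℝ (fun s => pencil K s i j) τ := by
  have h : AnalyticAt ℝ (fun s : ℝ => (s : ℂ)) τ := Complex.ofRealCLM.analyticAt τ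
  simp only [pencil, Matrix.sub_apply, Matrix.smul_apply, smul_eq_mul]
  exact analyticAt_const.sub (h.mul analyticAt_const)

/-- Near τ the branch is compared with ψ(τ)·exp(½ log(D(τ)/D(s))), where ψ is the branch and D the
determinant. The latter is visibly analytic, has the same square and the same value at s = τ, so the
two agree on a connected ball. -/
lemma IsRegular.analyticAt_invSqrtDet {K : Matrix (Idx m) (Idx m) ℂ} (hK : IsRegular K) {τ : ℝ}
    (hτ : τ ∈ Set.Ioo (-1 : ℝ) 1) : AnalyticAt ℝ (invSqrtDet K) τ := by
  have hτ' := Set.Ioo_subset_Icc_self hτ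
  set D := fredholmDet K
  have hD : ∀ s, AnalyticAt ℝ D s := fun s =>
    (analyticAt_det (analyticAt_pencil_apply K s)).mul analyticAt_const
  have hDτ : D τ ≠ 0 := hK.fredholmDet_ne_zero hτ'
  have h1 : AnalyticAt ℝ (fun s => D τ / D s) τ := analyticAt_const.div (hD τ) hDτ
  have hslit : ∀ᶠ s in 𝓝 τ, D τ / D s ∈ slitPlane := by
    refine h1.continuousAt.eventually_mem (isOpen_slitPlane.mem_nhds ?_)
    rw [div_self hDτ]
    exact one_mem_slitPlane
  obtain ⟨ε, hε, hball⟩ := Metric.eventually_nhds_iff_ball.mp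
    (hslit.and (isOpen_Ioo.eventually_mem hτ))
  have hgan : ∀ s ∈ Metric.ball τ ε,
      AnalyticAt ℝ (fun s => invSqrtDet K τ * cexp (1 / 2 * Complex.log (D τ / D s))) s := by
    intro s hs
    have h2 : AnalyticAt ℝ (fun s => D τ / D s) s :=
      analyticAt_const.div (hD s)
        (hK.fredholmDet_ne_zero (Set.Ioo_subset_Icc_self (hball s hs).2))
    have h3 : AnalyticAt ℝ (fun s => Complex.log (D τ / D s)) s :=
      AnalyticAt.fun_comp (g := Complex.log) (f := fun s => D τ / D s)
        ((analyticAt_clog (hball s hs).1).restrictScalars (𝕜 := ℝ)) h2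
    have h4 : AnalyticAt ℝ (fun s => cexp (1 / 2 * Complex.log (D τ / D s))) s :=
      AnalyticAt.fun_comp (g := cexp) (analyticAt_cexp.restrictScalars (𝕜 := ℝ))
        (analyticAt_const.mul h3)
    exact analyticAt_const.mul h4
  refine (hgan τ (Metric.mem_ball_self hε)).congr ?_
  filter_upwards [Metric.ball_mem_nhds τ hε] with s hs
  refine (convex_ball τ ε).isPreconnected.eq_of_sq_eq (y := τ)
    (fun s hs => (hgan s hs).continuousAt.continuousWithinAt)
    (fun s hs => (hK.hasDerivAt_invSqrtDet
      (Set.Ioo_subset_Icc_self (hball s hs).2)).continuousAt.continuousWithinAt)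
    ?_ (fun {s} _ => invSqrtDet_ne_zero K s) (Metric.mem_ball_self hε) ?_ hs
  · intro s hs
    have hs' := Set.Ioo_subset_Icc_self (hball s hs).2
    have hDs : D s ≠ 0 := hK.fredholmDet_ne_zero hs'
    have e1 := hK.invSqrtDet_sq hτ'
    have e2 := hK.invSqrtDet_sq hs'
    simp only [Pi.pow_apply, mul_pow, ← Complex.exp_nat_mul]
    rw [show ((2 : ℕ) : ℂ) * (1 / 2 * Complex.log (D τ / D s)) = Complex.log (D τ / D s) by
      push_cast; ring, Complex.exp_log (div_ne_zero hDτ hDs)]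
    change invSqrtDet K τ ^ 2 * D τ = 1 at e1
    change invSqrtDet K s ^ 2 * D s = 1 at e2
    rw [← mul_div_assoc, e1, div_eq_iff hDs, e2]
  · simp [div_self hDτ]

/-! ### The explicit star-exponential solves the evolution equation. -/

lemma tanh_mem_Ioo (t : ℝ) : Real.tanh t ∈ Set.Ioo (-1 : ℝ) 1 :=
  ⟨Real.neg_one_lt_tanh t, Real.tanh_lt_one t⟩

lemma tanh_mem_Icc (t : ℝ) : Real.tanh t ∈ Set.Icc (-1 : ℝ) 1 :=
  Set.Ioo_subset_Icc_self (tanh_mem_Ioo t)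

lemma hasDerivAt_tanh_half (t : ℝ) :
    HasDerivAt (fun t => Real.tanh (t / 2)) (1 / 2 * (1 - Real.tanh (t / 2) ^ 2)) t := by
  have h0 : HasDerivAt (fun t : ℝ => t / 2) (1 / 2) t := (hasDerivAt_id t).div_const 2
  have hc := (Real.cosh_pos (t / 2)).ne'
  have h := h0.sinh.fun_div h0.cosh hc
  simp only [Real.tanh_eq_sinh_div_cosh]
  refine h.congr_deriv ?_
  field_simp

lemma analyticAt_tanh_half (t : ℝ) : AnalyticAt ℝ (fun t => Real.tanh (t / 2)) t := by
  simp only [Real.tanh_eq_sinh_div_cosh]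
  have h0 : AnalyticAt ℝ (fun t : ℝ => t / 2) t := by fun_prop
  have h1 : AnalyticAt ℝ (fun t : ℝ => Real.sinh (t / 2)) t :=
    AnalyticAt.fun_comp (g := Real.sinh) Real.analyticAt_sinh h0
  have h2 : AnalyticAt ℝ (fun t : ℝ => Real.cosh (t / 2)) t :=
    AnalyticAt.fun_comp (g := Real.cosh) Real.analyticAt_cosh h0
  exact h1.div h2 (Real.cosh_pos _).ne'

/-- The Gaussian part of the star-exponential at `τ = tanh (t / 2)`. -/
def gaussianFamily (ħ : ℝ) (K : Matrix (Idx m) (Idx m) ℂ) (τ : ℝ) (u : Sp m) : ℂ :=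
  invSqrtDet K τ * cexp (1 / (I * ħ) * (u ⬝ᵥ ((τ : ℂ) • resolv K τ) *ᵥ u))

/-- The explicit star-exponential of the Hamiltonian. -/
def starExpH (ħ : ℝ) (K : Matrix (Idx m) (Idx m) ℂ) (t : ℝ) (u : Sp m) : ℂ :=
  (((Real.cosh (t / 2)) ^ m)⁻¹ : ℝ) * gaussianFamily ħ K (Real.tanh (t / 2)) u

lemma IsRegular.analyticAt_starExpH (ħ : ℝ) {K : Matrix (Idx m) (Idx m) ℂ} (hK : IsRegular K)
    (p : ℝ × Sp m) : AnalyticAt ℝ (fun p : ℝ × Sp m => starExpH ħ K p.1 p.2) p := by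
  have hfst : AnalyticAt ℝ (fun p : ℝ × Sp m => p.1) p := analyticAt_fst
  have hcoord : ∀ i, AnalyticAt ℝ (fun p : ℝ × Sp m => p.2 i) p := fun i =>
    ((ContinuousLinearMap.proj (R := ℝ) (φ := fun _ : Idx m => ℂ) i).comp
      (ContinuousLinearMap.snd ℝ ℝ (Sp m))).analyticAt p
  have hτ : AnalyticAt ℝ (fun p : ℝ × Sp m => Real.tanh (p.1 / 2)) p :=
    AnalyticAt.fun_comp (g := fun t => Real.tanh (t / 2)) (analyticAt_tanh_half p.1) hfst
  have hτc : AnalyticAt ℝ (fun p : ℝ × Sp m => (Real.tanh (p.1 / 2) : ℂ)) p :=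
    AnalyticAt.fun_comp (g := fun t : ℝ => (t : ℂ)) (Complex.ofRealCLM.analyticAt _) hτ
  have hR : ∀ i j, AnalyticAt ℝ (fun p : ℝ × Sp m => resolv K (Real.tanh (p.1 / 2)) i j) p := by
    intro i j
    exact AnalyticAt.fun_comp (g := fun s => resolv K s i j)
      (analyticAt_inv_apply (analyticAt_pencil_apply K _) (hK _ (tanh_mem_Icc _)) i j) hτ
  have hψ : AnalyticAt ℝ (fun p : ℝ × Sp m => invSqrtDet K (Real.tanh (p.1 / 2))) p :=
    AnalyticAt.fun_comp (g := invSqrtDet K) (hK.analyticAt_invSqrtDet (tanh_mem_Ioo _)) hτ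
  have hq : AnalyticAt ℝ (fun p : ℝ × Sp m => 1 / (I * ħ) *
      (p.2 ⬝ᵥ ((Real.tanh (p.1 / 2) : ℂ) • resolv K (Real.tanh (p.1 / 2))) *ᵥ p.2)) p := by
    simp only [dotProduct, mulVec, Matrix.smul_apply, smul_eq_mul]
    refine analyticAt_const.mul (Finset.analyticAt_fun_sum _ fun i _ => (hcoord i).mul
      (Finset.analyticAt_fun_sum _ fun j _ => (hτc.mul (hR i j)).mul (hcoord j)))
  have hexp := AnalyticAt.fun_comp (g := cexp) (analyticAt_cexp.restrictScalars (𝕜 := ℝ)) hq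
  have hcosh : AnalyticAt ℝ (fun p : ℝ × Sp m => (((Real.cosh (p.1 / 2)) ^ m)⁻¹ : ℝ)) p := by
    have h0 : AnalyticAt ℝ (fun p : ℝ × Sp m => p.1 / 2) p := hfst.div_const
    have h1 : AnalyticAt ℝ (fun p : ℝ × Sp m => Real.cosh (p.1 / 2)) p :=
      AnalyticAt.fun_comp (g := Real.cosh) Real.analyticAt_cosh h0
    exact (h1.pow m).inv (pow_ne_zero _ (Real.cosh_pos _).ne')
  have hcc : AnalyticAt ℝ (fun p : ℝ × Sp m => ((((Real.cosh (p.1 / 2)) ^ m)⁻¹ : ℝ) : ℂ)) p :=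
    AnalyticAt.fun_comp (g := fun t : ℝ => (t : ℂ)) (Complex.ofRealCLM.analyticAt _) hcosh
  exact hcc.mul (hψ.mul hexp)

lemma differentiable_starExpH (ħ : ℝ) (K : Matrix (Idx m) (Idx m) ℂ) (t : ℝ) :
    Differentiable ℂ (starExpH ħ K t) := by
  unfold starExpH gaussianFamily
  simp only [dotProduct, mulVec]
  fun_prop

lemma starExpH_zero (ħ : ℝ) (K : Matrix (Idx m) (Idx m) ℂ) (u : Sp m) : starExpH ħ K 0 u = 1 := by
  simp [starExpH, gaussianFamily, invSqrtDet_zero]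

lemma IsRegular.hasDerivAt_gaussianFamily (ħ : ℝ) {K : Matrix (Idx m) (Idx m) ℂ}
    (hK : IsRegular K) {τ : ℝ} (hτ : τ ∈ Set.Icc (-1 : ℝ) 1) (u : Sp m) :
    HasDerivAt (fun τ => gaussianFamily ħ K τ u) (gaussianFamily ħ K τ u *
      (1 / 2 * (K * resolv K τ).trace +
        1 / (I * ħ) * (u ⬝ᵥ (resolv K τ * swapMat m * resolv K τ) *ᵥ u))) τ := by
  refine ((hK.hasDerivAt_invSqrtDet hτ).mul
    (((hasDerivAt_smul_resolv_quad (hK τ hτ) u).const_mul (1 / (I * (ħ : ℂ)))).cexp)).congr_deriv ?_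
  rw [gaussianFamily]
  ring

/-- Both sides are the same Gaussian times a scalar. The time change has derivative ½(1 − τ²),
matching the common factor of the resolvent identities, while the remaining trace term −mτ/2 is the
logarithmic derivative of cosh(t/2)⁻ᵐ. -/
lemma IsRegular.hasDerivAt_starExpH {ħ : ℝ} (hħ : ħ ≠ 0) {K : Matrix (Idx m) (Idx m) ℂ}
    (hs : K.IsSymm) (hK : IsRegular K) (t : ℝ) (u : Sp m) :
    HasDerivAt (fun s => starExpH ħ K s u)
      (starMul ħ K (hamiltonian ħ K) (starExpH ħ K t) u) t := by
  have hc : (ħ : ℂ) ≠ 0 := by exact_mod_cast hħ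
  set τ := Real.tanh (t / 2) with hτdef
  have hτ : τ ∈ Set.Icc (-1 : ℝ) 1 := tanh_mem_Icc _
  have hR := resolv_isSymm hs τ
  have hXR := pencil_mul_resolv (hK τ hτ)
  have hQ : ((τ : ℂ) • resolv K τ).IsSymm := hR.smul _
  have e1 : starExpH ħ K t = fun u => ((((Real.cosh (t / 2)) ^ m)⁻¹ : ℝ) * invSqrtDet K τ) *
      cexp (1 / (I * ħ) * (u ⬝ᵥ ((τ : ℂ) • resolv K τ) *ᵥ u)) := by
    funext u
    rw [starExpH, gaussianFamily, mul_assoc]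
  have e2 : ((((Real.cosh (t / 2)) ^ m)⁻¹ : ℝ) * invSqrtDet K τ) *
      cexp (1 / (I * ħ) * (u ⬝ᵥ ((τ : ℂ) • resolv K τ) *ᵥ u)) = starExpH ħ K t u := by
    rw [e1]
  rw [e1, starMul_hamiltonian_gaussian hħ hs hQ, e2,
    dotProduct_resolvent_identity hR hXR, trace_resolvent_identity hs hR hXR]
  have hcosh : HasDerivAt (fun t : ℝ => ((((Real.cosh (t / 2)) ^ m)⁻¹ : ℝ) : ℂ))
      (((((Real.cosh (t / 2)) ^ m)⁻¹ : ℝ) : ℂ) * (-(m / 2 * τ))) t := by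
    have h0 : HasDerivAt (fun t : ℝ => t / 2) (1 / 2) t := (hasDerivAt_id t).div_const 2
    have hp := Real.cosh_pos (t / 2)
    have h1 := ((h0.cosh.fun_pow m).fun_inv (pow_ne_zero m hp.ne')).ofReal_comp
    refine h1.congr_deriv ?_
    have e : -(m * Real.cosh (t / 2) ^ (m - 1) * (Real.sinh (t / 2) * (1 / 2))) /
        (Real.cosh (t / 2) ^ m) ^ 2 = (Real.cosh (t / 2) ^ m)⁻¹ * (-(m / 2 * τ)) := by
      rw [hτdef, Real.tanh_eq_sinh_div_cosh]
      -- The power rule involves the truncated exponent m − 1, so m = 0 is separated.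
      rcases m with _ | k
      · simp
      · simp only [Nat.add_sub_cancel, pow_succ (Real.cosh (t / 2)) k]
        field_simp
    rw [e]
    push_cast
    ring
  have hg := HasDerivAt.scomp t (h := fun t => Real.tanh (t / 2))
    (hK.hasDerivAt_gaussianFamily ħ hτ u) (hasDerivAt_tanh_half t)
  have h := hcosh.mul hg
  refine h.congr_deriv ?_
  simp only [starExpH, ← hτdef, Function.comp_apply, Complex.real_smul]
  push_cast
  field_simp
  ring

theorem IsRegular.isStarExp {ħ : ℝ} (hħ : ħ ≠ 0) {K : Matrix (Idx m) (Idx m) ℂ}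
    (hs : K.IsSymm) (hK : IsRegular K) : IsStarExp ħ K (starExpH ħ K) where
  analytic p _ := hK.analyticAt_starExpH ħ p
  entire := differentiable_starExpH ħ K
  init := starExpH_zero ħ K
  evolution := hK.hasDerivAt_starExpH hħ hs

/-! ### Uniqueness of the star-exponential. -/

section Cauchy

variable {E : Type*} [NormedAddCommGroup E] [NormedSpace ℝ E]

lemma hasDerivAt_slice {F : ℝ × E → ℂ} {t : ℝ} {u : E} (hF : DifferentiableAt ℝ F (t, u)) :
    HasDerivAt (fun s => F (s, u)) (fderiv ℝ F (t, u) (1, 0)) t := by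
  have h1 : HasDerivAt (fun s : ℝ => (s, u)) ((1 : ℝ), (0 : E)) t :=
    (hasDerivAt_id t).prodMk (hasDerivAt_const t u)
  exact hF.hasFDerivAt.comp_hasDerivAt t h1

lemma fderiv_slice_eq_zero {F : ℝ × E → ℂ} {t : ℝ} (hF : Differentiable ℝ F)
    (h0 : ∀ u, F (t, u) = 0) (u v : E) : fderiv ℝ F (t, u) (0, v) = 0 := by
  have h1 : HasFDerivAt (fun u : E => (t, u)) (ContinuousLinearMap.inr ℝ ℝ E) u :=
    hasFDerivAt_prodMk_right t u
  have h2 := (hF (t, u)).hasFDerivAt.comp u h1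
  have h3 : F ∘ (fun u : E => (t, u)) = fun _ => 0 := funext h0
  rw [h3] at h2
  have h4 := h2.unique (hasFDerivAt_const 0 u)
  simpa using congrArg (fun L => L v) h4

lemma analyticOnNhd_fderiv_apply {F : E → ℂ} (hF : AnalyticOnNhd ℝ F Set.univ) (v : E) :
    AnalyticOnNhd ℝ (fun q => fderiv ℝ F q v) Set.univ := fun q hq =>
  ((ContinuousLinearMap.apply ℝ ℂ v).analyticAt _).comp (hF.fderiv q hq)

lemma fderiv_fderiv_apply_comm {F : E → ℂ} (hF : AnalyticOnNhd ℝ F Set.univ) (v w p : E) :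
    fderiv ℝ (fun q => fderiv ℝ F q v) p w = fderiv ℝ (fun q => fderiv ℝ F q w) p v := by
  have hd : DifferentiableAt ℝ (fderiv ℝ F) p := (hF.fderiv p (Set.mem_univ p)).differentiableAt
  have hs : IsSymmSndFDerivAt ℝ F p :=
    (hF p (Set.mem_univ p)).contDiffAt.isSymmSndFDerivAt (n := 2) (by simp)
  have h : ∀ v w, fderiv ℝ (fun q => fderiv ℝ F q v) p w = fderiv ℝ (fderiv ℝ F) p w v := by
    intro v w
    have := hd.hasFDerivAt.clm_apply (hasFDerivAt_const v p)
    rw [this.fderiv]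
    simp
  rw [h, h, hs.eq]

variable {ι : Type*} [Fintype ι]

/-- A second-order linear evolution equation with time-independent coefficients. -/
structure IsAnalyticSolution (a : E → ℂ) (b : ι → E → ℂ) (c : ι → ι → E → ℂ) (v : ι → E)
    (h : ℝ × E → ℂ) : Prop where
  analytic : AnalyticOnNhd ℝ h Set.univ
  init : ∀ u, h (0, u) = 0
  evolution : ∀ p, fderiv ℝ h p (1, 0) = a p.2 * h p + ∑ j, b j p.2 * fderiv ℝ h p (0, v j) +
    ∑ j, ∑ k, c j k p.2 * fderiv ℝ (fun q => fderiv ℝ h q (0, v k)) p (0, v j)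

namespace IsAnalyticSolution

variable {a : E → ℂ} {b : ι → E → ℂ} {c : ι → ι → E → ℂ} {v : ι → E} {h : ℝ × E → ℂ}

/-- The coefficients are independent of time, so the equation may be differentiated in t and the
partial derivatives interchanged. The initial value is zero because the equation expresses the time
derivative through spatial derivatives of a slice that vanishes identically. -/
lemma timeDeriv (H : IsAnalyticSolution a b c v h) :
    IsAnalyticSolution a b c v (fun q => fderiv ℝ h q (1, 0)) where
  analytic := analyticOnNhd_fderiv_apply H.analytic _
  init u := by
    have hd : Differentiable ℝ h := fun p => (H.analytic p (Set.mem_univ p)).differentiableAt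
    have hd' : ∀ k, Differentiable ℝ (fun q => fderiv ℝ h q (0, v k)) := fun k p =>
      (analyticOnNhd_fderiv_apply H.analytic _ p (Set.mem_univ p)).differentiableAt
    have h1 : ∀ u w, fderiv ℝ h (0, u) (0, w) = 0 := fun u w =>
      fderiv_slice_eq_zero hd H.init u w
    have h2 : ∀ k u w, fderiv ℝ (fun q => fderiv ℝ h q (0, v k)) (0, u) (0, w) = 0 :=
      fun k u w => fderiv_slice_eq_zero (hd' k) (fun u => h1 u _) u w
    rw [H.evolution]
    simp [h1, h2, H.init]
  evolution p := by
    obtain ⟨t, u⟩ := p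
    have hsl : ∀ {F : ℝ × E → ℂ}, AnalyticOnNhd ℝ F Set.univ →
        HasDerivAt (fun s => F (s, u)) (fderiv ℝ F (t, u) (1, 0)) t := fun hF =>
      hasDerivAt_slice (hF _ (Set.mem_univ _)).differentiableAt
    have h1 := hsl (analyticOnNhd_fderiv_apply H.analytic (1, 0))
    have h2 := (((hsl H.analytic).const_mul (a u)).fun_add (HasDerivAt.fun_sum (u := .univ)
        fun j _ => (hsl (analyticOnNhd_fderiv_apply H.analytic (0, v j))).const_mul
          (b j u))).fun_add (HasDerivAt.fun_sum (u := .univ) fun j _ =>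
        HasDerivAt.fun_sum (u := .univ) fun k _ =>
          (hsl (analyticOnNhd_fderiv_apply (analyticOnNhd_fderiv_apply H.analytic (0, v k))
            (0, v j))).const_mul (c j k u))
    rw [show (fun s => fderiv ℝ h (s, u) (1, 0)) = _ from funext fun s => H.evolution (s, u)] at h1
    rw [h1.unique h2]
    have e1 : ∀ w : ℝ × E, (fun q => fderiv ℝ (fun q => fderiv ℝ h q w) q (1, 0)) =
        fun q => fderiv ℝ (fun q => fderiv ℝ h q (1, 0)) q w := fun w => funext fun q =>
      fderiv_fderiv_apply_comm H.analytic _ _ q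
    congr 1
    · congr 1
      exact Finset.sum_congr rfl fun j _ => by rw [fderiv_fderiv_apply_comm H.analytic]
    · refine Finset.sum_congr rfl fun j _ => Finset.sum_congr rfl fun k _ => ?_
      rw [fderiv_fderiv_apply_comm (analyticOnNhd_fderiv_apply H.analytic (0, v k)), e1]

lemma iteratedDeriv_eq_zero (H : IsAnalyticSolution a b c v h) (n : ℕ) (u : E) :
    iteratedDeriv n (fun t => h (t, u)) 0 = 0 := by
  -- The solution itself must vary: the step applies the hypothesis to the time derivative.
  induction n generalizing h with
  | zero => simp [H.init]
  | succ n ih =>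
    rw [iteratedDeriv_succ']
    have e : deriv (fun t => h (t, u)) = fun t => fderiv ℝ h (t, u) (1, 0) := funext fun t =>
      (hasDerivAt_slice (H.analytic _ (Set.mem_univ _)).differentiableAt).deriv
    rw [e]
    exact ih H.timeDeriv

theorem eq_zero (H : IsAnalyticSolution a b c v h) (t : ℝ) (u : E) : h (t, u) = 0 := by
  have hg : AnalyticOnNhd ℝ (fun t => h (t, u)) Set.univ := fun t _ =>
    AnalyticAt.fun_comp (g := h) (H.analytic (t, u) (Set.mem_univ _))
      (analyticAt_id.prod analyticAt_const)
  have hs : analyticOrderAt (fun t => h (t, u)) 0 = ⊤ := by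
    refine ENat.eq_top_iff_forall_ge.mpr fun n => ?_
    exact (natCast_le_analyticOrderAt_iff_iteratedDeriv_eq_zero (hg 0 (Set.mem_univ _))).mpr
      fun i _ => H.iteratedDeriv_eq_zero i u
  have he := analyticOrderAt_eq_top.mp hs
  exact congrFun (hg.eq_of_eventuallyEq analyticOnNhd_const he) t

end IsAnalyticSolution

end Cauchy

lemma fderiv_eq_fderiv_joint {F : ℝ × Sp m → ℂ} {t : ℝ} {u : Sp m}
    (hF : DifferentiableAt ℝ F (t, u)) (he : DifferentiableAt ℂ (fun u => F (t, u)) u) (w : Sp m) :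
    fderiv ℂ (fun u => F (t, u)) u w = fderiv ℝ F (t, u) (0, w) := by
  have h1 : HasFDerivAt (fun u : Sp m => (t, u)) (ContinuousLinearMap.inr ℝ ℝ (Sp m)) u :=
    hasFDerivAt_prodMk_right t u
  have h2 := hF.hasFDerivAt.comp u h1
  have h3 := (he.hasFDerivAt.restrictScalars ℝ).unique h2
  simpa using congrArg (fun L => L w) h3

/-- The real second derivative is symmetric and complex linear in one slot, hence complex linear in
the other. This gives holomorphy of the partial derivatives using only the real analyticity already
at hand. -/
lemma differentiable_fderiv_apply {f : Sp m → ℂ} (hR : AnalyticOnNhd ℝ f Set.univ)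
    (hf : Differentiable ℂ f) (w : Sp m) : Differentiable ℂ (fun u => fderiv ℂ f u w) := by
  have e : ∀ u w, fderiv ℂ f u w = fderiv ℝ f u w := fun u w => by
    rw [(hf u).fderiv_restrictScalars ℝ]
    rfl
  have eI : ∀ w, (fun u => fderiv ℝ f u (I • w)) = fun u => I * fderiv ℝ f u w := fun w => by
    funext u
    simp [← e]
  simp only [e]
  intro u
  have hd : ∀ w, DifferentiableAt ℝ (fun u => fderiv ℝ f u w) u := fun w =>
    (analyticOnNhd_fderiv_apply hR w u (Set.mem_univ u)).differentiableAt
  rw [differentiableAt_iff_restrictScalars ℝ (hd w)]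
  set L := fderiv ℝ (fun u => fderiv ℝ f u w) u with hL
  have hLI : ∀ v, L (I • v) = I * L v := by
    intro v
    rw [hL, fderiv_fderiv_apply_comm hR, eI, fderiv_const_mul (hd v),
      fderiv_fderiv_apply_comm hR w v]
    simp
  refine ⟨LinearMap.toContinuousLinearMap
    { toFun := L
      map_add' := L.map_add
      map_smul' := fun z v => ?_ }, rfl⟩
  have hz : z • v = z.re • v + z.im • (I • v) := by
    conv_lhs => rw [← Complex.re_add_im z]
    rw [add_smul, mul_smul, Complex.coe_smul, Complex.coe_smul]
  rw [hz, L.map_add, L.map_smul, L.map_smul, hLI]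
  conv_rhs => rw [← Complex.re_add_im z]
  simp only [Complex.real_smul, smul_eq_mul, RingHom.id_apply]
  ring

lemma differentiable_fderiv {f : Sp m → ℂ} (hR : AnalyticOnNhd ℝ f Set.univ)
    (hf : Differentiable ℂ f) : Differentiable ℂ (fderiv ℂ f) := by
  have e : fderiv ℂ f = fun u => ∑ i, fderiv ℂ f u (Pi.single i 1) •
      ContinuousLinearMap.proj (R := ℂ) (φ := fun _ : Idx m => ℂ) i := by
    funext u
    refine ContinuousLinearMap.ext fun w => ?_
    conv_lhs => rw [pi_eq_sum_univ' w, map_sum]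
    simp [_root_.sum_apply, mul_comm]
  rw [e]
  exact Differentiable.fun_sum fun i _ => (differentiable_fderiv_apply hR hf _).smul_const _

lemma fderiv_fderiv_apply {f : Sp m → ℂ} (hR : AnalyticOnNhd ℝ f Set.univ)
    (hf : Differentiable ℂ f) (u w w' : Sp m) :
    fderiv ℂ (fderiv ℂ f) u w w' = fderiv ℂ (fun u => fderiv ℂ f u w') u w := by
  rw [((differentiable_fderiv hR hf u).hasFDerivAt.clm_apply (hasFDerivAt_const w' u)).fderiv]
  simp

lemma IsStarExp.analytic_slice {ħ : ℝ} {K : Matrix (Idx m) (Idx m) ℂ} {f : ℝ → Sp m → ℂ}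
    (hf : IsStarExp ħ K f) (t : ℝ) : AnalyticOnNhd ℝ (f t) Set.univ := fun u _ =>
  AnalyticAt.fun_comp (g := fun p : ℝ × Sp m => f p.1 p.2) (hf.analytic (t, u) (Set.mem_univ _))
    (analyticAt_const.prod analyticAt_id)

/-- The difference of two families satisfies a linear equation with zero initial data. The work is
to translate complex derivatives of each slice into real derivatives of the joint function on time
and space, where the Cauchy argument applies. -/
theorem IsStarExp.unique {ħ : ℝ} (hħ : ħ ≠ 0) {K : Matrix (Idx m) (Idx m) ℂ} (hs : K.IsSymm)
    {f g : ℝ → Sp m → ℂ} (hf : IsStarExp ħ K f) (hg : IsStarExp ħ K g) : g = f := by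
  have H : IsAnalyticSolution (hamiltonian ħ K)
      (fun j u => 1 / 2 * ∑ i, (K + Matrix.J (Fin m) ℂ) i j * (swapMat m *ᵥ u) i)
      (fun j k _ => I * ħ / 8 *
        ((K + Matrix.J (Fin m) ℂ)ᵀ * swapMat m * (K + Matrix.J (Fin m) ℂ)) j k)
      (fun j => (Pi.single j 1 : Sp m)) (fun p => g p.1 p.2 - f p.1 p.2) := by
    have han : AnalyticOnNhd ℝ (fun p : ℝ × Sp m => g p.1 p.2 - f p.1 p.2) Set.univ :=
      hg.analytic.sub hf.analytic
    refine ⟨han, fun u => by simp [hf.init, hg.init], ?_⟩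
    rintro ⟨t, u⟩
    have hdiff : ∀ t, Differentiable ℂ (fun u => g t u - f t u) := fun t =>
      (hg.entire t).sub (hf.entire t)
    have h1 : ∀ t u w, fderiv ℂ (fun u => g t u - f t u) u w =
        fderiv ℝ (fun p : ℝ × Sp m => g p.1 p.2 - f p.1 p.2) (t, u) (0, w) := fun t u w =>
      fderiv_eq_fderiv_joint (F := fun p : ℝ × Sp m => g p.1 p.2 - f p.1 p.2)
        (han (t, u) (Set.mem_univ _)).differentiableAt (hdiff t u) w
    have hRd : ∀ t, AnalyticOnNhd ℝ (fun u => g t u - f t u) Set.univ := fun t =>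
      (hg.analytic_slice t).sub (hf.analytic_slice t)
    have hdiff' : ∀ w, Differentiable ℂ (fun u => fderiv ℂ (fun u => g t u - f t u) u w) :=
      differentiable_fderiv_apply (hRd t) (hdiff t)
    have h2 : ∀ w w', fderiv ℂ (fderiv ℂ (fun u => g t u - f t u)) u w w' =
        fderiv ℝ (fun q => fderiv ℝ (fun p : ℝ × Sp m => g p.1 p.2 - f p.1 p.2) q (0, w'))
          (t, u) (0, w) := by
      intro w w'
      have hd := hdiff' w' u
      simp only [h1] at hd
      rw [fderiv_fderiv_apply (hRd t) (hdiff t)]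
      simp only [h1]
      exact fderiv_eq_fderiv_joint (F := fun q => fderiv ℝ (fun p : ℝ × Sp m =>
        g p.1 p.2 - f p.1 p.2) q (0, w'))
        (analyticOnNhd_fderiv_apply han _ (t, u) (Set.mem_univ _)).differentiableAt hd w
    have h3 := hasDerivAt_slice (han (t, u) (Set.mem_univ _)).differentiableAt
    have h4 := (hg.evolution t u).sub (hf.evolution t u)
    rw [h3.unique h4, starMul_hamiltonian hħ hs, starMul_hamiltonian hħ hs]
    simp only [← h2]
    simp only [← h1]
    have e1 : fderiv ℂ (fun u => g t u - f t u) = fun u => fderiv ℂ (g t) u - fderiv ℂ (f t) u :=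
      funext fun u => fderiv_fun_sub (hg.entire t u) (hf.entire t u)
    have e2 : fderiv ℂ (fun u => fderiv ℂ (g t) u - fderiv ℂ (f t) u) u =
        fderiv ℂ (fderiv ℂ (g t)) u - fderiv ℂ (fderiv ℂ (f t)) u :=
      fderiv_fun_sub (differentiable_fderiv (hg.analytic_slice t) (hg.entire t) u)
        (differentiable_fderiv (hf.analytic_slice t) (hf.entire t) u)
    simp only [e1, e2, _root_.sub_apply, mul_sub, Finset.sum_sub_distrib]
    ring
  funext t u
  exact sub_eq_zero.mp (H.eq_zero t u)

/-! ### Limits as t → ±∞ and the explicit vacuums. -/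

lemma IsRegular.continuousAt_gaussianFamily (ħ : ℝ) {K : Matrix (Idx m) (Idx m) ℂ}
    (hK : IsRegular K) {τ : ℝ} (hτ : τ ∈ Set.Icc (-1 : ℝ) 1) (u : Sp m) :
    ContinuousAt (fun p : ℝ × Sp m => gaussianFamily ħ K p.1 p.2) (τ, u) := by
  have h1 : ContinuousAt (fun p : ℝ × Sp m => invSqrtDet K p.1) (τ, u) :=
    ContinuousAt.comp (f := fun p : ℝ × Sp m => p.1) (x := (τ, u))
      (hK.hasDerivAt_invSqrtDet hτ).continuousAt continuousAt_fst
  have h2 : ContinuousAt (fun p : ℝ × Sp m => resolv K p.1) (τ, u) :=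
    ContinuousAt.comp (f := fun p : ℝ × Sp m => p.1) (x := (τ, u))
      (continuousAt_resolv_right (hK τ hτ)) continuousAt_fst
  have h3 : Continuous fun q : (ℝ × Sp m) × Matrix (Idx m) (Idx m) ℂ =>
      1 / (I * (ħ : ℂ)) * (q.1.2 ⬝ᵥ ((q.1.1 : ℂ) • q.2) *ᵥ q.1.2) := by
    have hsm : Continuous fun q : (ℝ × Sp m) × Matrix (Idx m) (Idx m) ℂ => (q.1.1 : ℂ) • q.2 :=
      (Complex.continuous_ofReal.comp (continuous_fst.comp continuous_fst)).smul continuous_snd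
    have h2 : Continuous fun q : (ℝ × Sp m) × Matrix (Idx m) (Idx m) ℂ => q.1.2 :=
      continuous_snd.comp continuous_fst
    exact continuous_const.mul (h2.dotProduct (hsm.matrix_mulVec h2))
  have h4 : ContinuousAt (fun p : ℝ × Sp m =>
      1 / (I * (ħ : ℂ)) * (p.2 ⬝ᵥ ((p.1 : ℂ) • resolv K p.1) *ᵥ p.2)) (τ, u) :=
    ContinuousAt.comp (f := fun p : ℝ × Sp m => (p, resolv K p.1)) (x := (τ, u))
      h3.continuousAt (continuousAt_id.prodMk h2)
  exact h1.mul h4.cexp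

/-- Joint continuity at the limiting parameter makes both the family and its limit close to the same
value near each point, which is local uniformity. -/
lemma tendstoLocallyUniformly_of_continuousAt {X : Type*} [TopologicalSpace X] {g : ℝ → X → ℂ}
    {τ : ℝ} (hg : ∀ u, ContinuousAt (fun p : ℝ × X => g p.1 p.2) (τ, u)) {l : Filter ℝ}
    {F : ℝ → X → ℂ} {a T : ℝ → ℝ} {a₀ : ℝ} (ha : Tendsto a l (𝓝 a₀)) (hT : Tendsto T l (𝓝 τ))
    (hF : ∀ t u, F t u = a t * g (T t) u) :
    TendstoLocallyUniformly F (fun u => a₀ * g τ u) l := by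
  rw [tendstoLocallyUniformly_iff_filter]
  intro u
  have hg' : Tendsto (fun p : ℝ × X => g p.1 p.2) (𝓝 (τ, u)) (𝓝 (g τ u)) := hg u
  rw [tendstoUniformlyOnFilter_iff_tendsto]
  have h1 : Tendsto (fun q : ℝ × X => (T q.1, q.2)) (l ×ˢ 𝓝 u) (𝓝 (τ, u)) := by
    rw [nhds_prod_eq]
    exact (hT.comp tendsto_fst).prodMk tendsto_snd
  have h2 : Tendsto (fun q : ℝ × X => F q.1 q.2) (l ×ˢ 𝓝 u) (𝓝 (a₀ * g τ u)) := by
    simp only [hF]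
    exact ((Complex.continuous_ofReal.tendsto a₀).comp (ha.comp tendsto_fst)).mul (hg'.comp h1)
  have h3 : Tendsto (fun q : ℝ × X => (τ, q.2)) (l ×ˢ 𝓝 u) (𝓝 (τ, u)) := by
    rw [nhds_prod_eq]
    exact tendsto_const_nhds.prodMk tendsto_snd
  have h4 : Tendsto (fun q : ℝ × X => (a₀ : ℂ) * g τ q.2) (l ×ˢ 𝓝 u) (𝓝 (a₀ * g τ u)) :=
    tendsto_const_nhds.mul (hg'.comp h3)
  exact (h4.prodMk_nhds h2).mono_right (nhds_le_uniformity _)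

lemma tendsto_tanh_half_atTop : Tendsto (fun t => Real.tanh (t / 2)) atTop (𝓝 1) := by
  have h0 : Tendsto (fun t : ℝ => Real.exp (-t)) atTop (𝓝 0) :=
    Real.tendsto_exp_neg_atTop_nhds_zero
  have h1 : Tendsto (fun t : ℝ => (1 - Real.exp (-t)) / (1 + Real.exp (-t))) atTop
      (𝓝 ((1 - 0) / (1 + 0))) := (tendsto_const_nhds.sub h0).div (tendsto_const_nhds.add h0)
    (by norm_num)
  have h2 : (fun t => Real.tanh (t / 2)) =
      fun t : ℝ => (1 - Real.exp (-t)) / (1 + Real.exp (-t)) := by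
    funext t
    have e : Real.exp (-t) = Real.exp (-(t / 2)) ^ 2 := by
      rw [← Real.exp_nat_mul]; congr 1; push_cast; ring
    rw [Real.tanh_eq_sinh_div_cosh, Real.sinh_eq, Real.cosh_eq, e, Real.exp_neg]
    have := Real.exp_pos (t / 2)
    field_simp
  rw [h2]
  simpa using h1

lemma tendsto_tanh_half_atBot : Tendsto (fun t => Real.tanh (t / 2)) atBot (𝓝 (-1)) := by
  have h := (tendsto_tanh_half_atTop.comp tendsto_neg_atBot_atTop).neg
  simpa [Function.comp_def, neg_div] using h

lemma tendsto_exp_mul_inv_cosh_atTop (m : ℕ) :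
    Tendsto (fun t : ℝ => Real.exp ((m : ℝ) / 2 * t) * (Real.cosh (t / 2) ^ m)⁻¹) atTop
      (𝓝 (2 ^ m)) := by
  have h0 : Tendsto (fun t : ℝ => Real.exp (-t)) atTop (𝓝 0) :=
    Real.tendsto_exp_neg_atTop_nhds_zero
  have h1 : Tendsto (fun t : ℝ => (2 / (1 + Real.exp (-t))) ^ m) atTop (𝓝 ((2 / (1 + 0)) ^ m)) :=
    (tendsto_const_nhds.div (tendsto_const_nhds.add h0) (by norm_num)).pow m
  have h2 : (fun t : ℝ => Real.exp ((m : ℝ) / 2 * t) * (Real.cosh (t / 2) ^ m)⁻¹) =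
      fun t : ℝ => (2 / (1 + Real.exp (-t))) ^ m := by
    funext t
    have e : Real.exp (-t) = Real.exp (-(t / 2)) ^ 2 := by
      rw [← Real.exp_nat_mul]; congr 1; push_cast; ring
    have e2 : Real.exp ((m : ℝ) / 2 * t) = Real.exp (t / 2) ^ m := by
      rw [← Real.exp_nat_mul]; congr 1; ring
    rw [e2, ← inv_pow, ← mul_pow, Real.cosh_eq, e, Real.exp_neg]
    have := Real.exp_pos (t / 2)
    congr 1
    field_simp
  rw [h2]
  simpa using h1

lemma tendsto_exp_mul_inv_cosh_atBot (m : ℕ) :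
    Tendsto (fun t : ℝ => Real.exp (-((m : ℝ) / 2 * t)) * (Real.cosh (t / 2) ^ m)⁻¹) atBot
      (𝓝 (2 ^ m)) := by
  have h := (tendsto_exp_mul_inv_cosh_atTop m).comp tendsto_neg_atBot_atTop
  simpa [Function.comp_def, neg_div] using h

theorem IsRegular.isVacuum {ħ : ℝ} (hħ : ħ ≠ 0) {K : Matrix (Idx m) (Idx m) ℂ} (hs : K.IsSymm)
    (hK : IsRegular K) : IsVacuum ħ K (fun u => (2 ^ m : ℝ) * gaussianFamily ħ K (-1) u) := by
  refine ⟨starExpH ħ K, hK.isStarExp hħ hs, fun g hg => (hK.isStarExp hħ hs).unique hħ hs hg,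
    tendstoLocallyUniformly_of_continuousAt
      (hK.continuousAt_gaussianFamily ħ (by norm_num)) (tendsto_exp_mul_inv_cosh_atBot m)
      tendsto_tanh_half_atBot fun t u => ?_⟩
  rw [starExpH]
  push_cast
  ring

theorem IsRegular.isBarVacuum {ħ : ℝ} (hħ : ħ ≠ 0) {K : Matrix (Idx m) (Idx m) ℂ} (hs : K.IsSymm)
    (hK : IsRegular K) : IsBarVacuum ħ K (fun u => (2 ^ m : ℝ) * gaussianFamily ħ K 1 u) := by
  refine ⟨starExpH ħ K, hK.isStarExp hħ hs, fun g hg => (hK.isStarExp hħ hs).unique hħ hs hg,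
    tendstoLocallyUniformly_of_continuousAt
      (hK.continuousAt_gaussianFamily ħ (by norm_num)) (tendsto_exp_mul_inv_cosh_atTop m)
      tendsto_tanh_half_atTop fun t u => ?_⟩
  rw [starExpH]
  push_cast
  ring

/-! ### Regular parameters are open and dense. -/

lemma isOpen_isRegular : IsOpen {K : Matrix (Idx m) (Idx m) ℂ | IsRegular K} := by
  have h : IsOpen {p : ℝ × Matrix (Idx m) (Idx m) ℂ | (pencil p.2 p.1).det ≠ 0} :=
    isOpen_ne_fun (continuous_pencil.comp continuous_swap).matrix_det continuous_const
  rw [isOpen_iff_mem_nhds]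
  intro K hK
  obtain ⟨U, V, hU, hV, hIU, hKV, hUV⟩ := generalized_tube_lemma
    (isCompact_Icc (a := (-1 : ℝ)) (b := 1)) (isCompact_singleton (x := K)) h
    (by
      rintro ⟨τ, K'⟩ ⟨hτ, hK'⟩
      obtain rfl : K' = K := hK'
      exact hK τ hτ)
  exact Filter.mem_of_superset (hV.mem_nhds (hKV rfl)) fun K' hK' τ hτ =>
    hUV (Set.mk_mem_prod (hIU hτ) hK')

/-- If the pencil of K + isP degenerates at some τ ≠ 0, then 1/τ − is is an eigenvalue of KP. Its
imaginary part is −s, which only finitely many s allow; τ = 0 is never degenerate. -/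
lemma exists_isRegular_add_smul (K : Matrix (Idx m) (Idx m) ℂ) :
    ∀ᶠ s : ℝ in 𝓝[>] 0, IsRegular (K + (s * I : ℂ) • swapMat m) := by
  set p := (K * swapMat m).charpoly with hp
  have hfin : {s : ℝ | ∃ z ∈ p.roots, z.im = -s}.Finite := by
    have : {s : ℝ | ∃ z ∈ p.roots, z.im = -s} ⊆ (fun z : ℂ => -z.im) '' {z | z ∈ p.roots.toFinset} := by
      rintro s ⟨z, hz, h⟩
      exact ⟨z, by simpa using hz, by simp [h]⟩
    exact ((Finset.finite_toSet _).image _).subset this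
  have hev : ∀ᶠ s : ℝ in 𝓝[>] 0, s ∉ {s : ℝ | 0 < s ∧ ∃ z ∈ p.roots, z.im = -s} := by
    have hf : {s : ℝ | 0 < s ∧ ∃ z ∈ p.roots, z.im = -s}.Finite := hfin.subset fun s hs => hs.2
    -- The condition 0 < s in the exceptional set keeps 0 outside it even if KP has real
    -- eigenvalues, so its complement is a neighbourhood of 0.
    exact nhdsWithin_le_nhds (hf.isClosed.isOpen_compl.mem_nhds (by simp))
  filter_upwards [hev, self_mem_nhdsWithin] with s hs hpos
  intro τ hτ hdet
  have hpos : 0 < s := hpos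
  have h1 : pencil (K + (s * I : ℂ) • swapMat m) τ * swapMat m =
      (1 - τ * s * I : ℂ) • 1 - (τ : ℂ) • (K * swapMat m) := by
    rw [pencil, Matrix.sub_mul, swapMat_mul_self, Matrix.smul_mul, Matrix.add_mul, Matrix.smul_mul,
      swapMat_mul_self]
    module
  have h2 : ((1 - τ * s * I : ℂ) • (1 : Matrix (Idx m) (Idx m) ℂ) -
      (τ : ℂ) • (K * swapMat m)).det = 0 := by
    rw [← h1, det_mul, hdet, zero_mul]
  by_cases h0 : τ = 0
  · subst h0
    simp at h2
  have h0' : (τ : ℂ) ≠ 0 := by exact_mod_cast h0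
  have h3 : (1 - τ * s * I : ℂ) • (1 : Matrix (Idx m) (Idx m) ℂ) - (τ : ℂ) • (K * swapMat m) =
      (τ : ℂ) • (scalar (Idx m) (1 / τ - s * I : ℂ) - K * swapMat m) := by
    rw [smul_sub]
    congr 1
    rw [scalar_apply, ← smul_one_eq_diagonal, smul_smul]
    congr 1
    field_simp
  rw [h3, det_smul, mul_eq_zero, or_iff_right (pow_ne_zero _ h0'), ← eval_charpoly] at h2
  refine hs ⟨hpos, (1 / τ - s * I : ℂ), ?_, ?_⟩
  · rw [Polynomial.mem_roots (charpoly_monic _).ne_zero]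
    exact h2
  · have : (1 / τ - s * I : ℂ) = ((1 / τ : ℝ) : ℂ) - s * I := by push_cast; rfl
    rw [this, Complex.sub_im, Complex.ofReal_im]
    simp

lemma dense_isRegular :
    Dense {K : {K : Matrix (Idx m) (Idx m) ℂ // K.IsSymm} | IsRegular K.1} := by
  rintro ⟨K, hK⟩
  have hsym : ∀ s : ℝ, (K + (s * I : ℂ) • swapMat m).IsSymm := fun s =>
    hK.add (swapMat_isSymm.smul _)
  have hc : Continuous fun s : ℝ => (⟨K + (s * I : ℂ) • swapMat m, hsym s⟩ :
      {K : Matrix (Idx m) (Idx m) ℂ // K.IsSymm}) := by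
    refine Continuous.subtype_mk ?_ _
    fun_prop
  have ht : Tendsto (fun s : ℝ => (⟨K + (s * I : ℂ) • swapMat m, hsym s⟩ :
      {K : Matrix (Idx m) (Idx m) ℂ // K.IsSymm})) (𝓝[>] 0) (𝓝 ⟨K, hK⟩) := by
    have := (hc.tendsto 0).mono_left (nhdsWithin_le_nhds (s := Set.Ioi 0))
    simpa using this
  exact mem_closure_of_tendsto ht (exists_isRegular_add_smul K)

theorem exists_open_dense_vacuum {ħ : ℝ} (hħ : ħ ≠ 0) :
    ∃ G : Set {K : Matrix (Idx m) (Idx m) ℂ // K.IsSymm}, IsOpen G ∧ Dense G ∧ ∀ K ∈ G,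
      (∃ ϖ, IsVacuum ħ K.1 ϖ) ∧ (∃ ϖ, IsBarVacuum ħ K.1 ϖ) :=
  ⟨{K | IsRegular K.1}, isOpen_isRegular.preimage continuous_subtype_val, dense_isRegular,
    fun K hK => ⟨⟨_, hK.isVacuum hħ K.2⟩, ⟨_, hK.isBarVacuum hħ K.2⟩⟩⟩

/-! ### Complex Gaussian integrals. -/

section Gaussian

variable {ι : Type*} [Fintype ι]

/-- The complex vector underlying a real vector. -/
def castVec (x : ι → ℝ) : ι → ℂ := fun i => (x i : ℂ)

/-- The Gaussian integral `∫ exp (-⟨x M, x⟩ + ⟨w, x⟩) dx` over real vectors. -/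
def gaussInt (M : Matrix ι ι ℂ) (w : ι → ℂ) : ℂ :=
  ∫ x : ι → ℝ, cexp (-(castVec x ⬝ᵥ M *ᵥ castVec x) + w ⬝ᵥ castVec x)

/-- The real part of the quadratic form of `M` is at least `c` times the square norm. -/
def ReBddBelow (c : ℝ) (M : Matrix ι ι ℂ) : Prop :=
  ∀ x : ι → ℝ, c * ∑ i, x i ^ 2 ≤ (castVec x ⬝ᵥ M *ᵥ castVec x).re

lemma norm_gaussian_le {c : ℝ} {M : Matrix ι ι ℂ} (h : ReBddBelow c M) (x : ι → ℝ) :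
    ‖cexp (-(castVec x ⬝ᵥ M *ᵥ castVec x))‖ ≤ Real.exp (-(c * ∑ i, x i ^ 2)) := by
  rw [Complex.norm_exp]
  exact Real.exp_le_exp.mpr (by simpa using h x)

lemma integrable_exp_neg_mul_sum_sq {c : ℝ} (hc : 0 < c) :
    Integrable fun x : ι → ℝ => Real.exp (-(c * ∑ i, x i ^ 2)) := by
  have h : (fun x : ι → ℝ => Real.exp (-(c * ∑ i, x i ^ 2))) =
      fun x => ∏ i, Real.exp (-c * x i ^ 2) := by
    funext x
    rw [← Real.exp_sum, Finset.mul_sum, ← Finset.sum_neg_distrib]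
    simp
  rw [h]
  exact Integrable.fintype_prod_dep (fun _ => integrable_exp_neg_mul_sq hc)

/-- Dominated convergence; the uniform constant c provides one integrable majorant for the whole
family. -/
lemma continuousOn_gaussInt {N : ℝ → Matrix ι ι ℂ} (hN : Continuous N) {S : Set ℝ} {c : ℝ}
    (hc : 0 < c) (h : ∀ r ∈ S, ReBddBelow c (N r)) :
    ContinuousOn (fun r => gaussInt (N r) 0) S := by
  unfold gaussInt
  simp only [zero_dotProduct, add_zero]
  refine continuousOn_of_dominated (X := ℝ)
    (F := fun r (x : ι → ℝ) => cexp (-(castVec x ⬝ᵥ N r *ᵥ castVec x))) (bound := fun x => Real.exp (-(c * ∑ i, x i ^ 2)))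
    (fun r _ => ?_) (fun r hr => Eventually.of_forall fun x => norm_gaussian_le (h r hr) x)
    (integrable_exp_neg_mul_sum_sq hc) (Eventually.of_forall fun x => ?_)
  · have h1 : Continuous fun x : ι → ℝ => -(castVec x ⬝ᵥ N r *ᵥ castVec x) := by
      simp only [castVec, dotProduct, mulVec]
      fun_prop
    exact h1.cexp.aestronglyMeasurable
  · have h1 : Continuous fun r => -(castVec x ⬝ᵥ N r *ᵥ castVec x) := by
      have hNe : ∀ i j, Continuous fun r => N r i j := fun i j => hN.matrix_elem i j
      simp only [castVec, dotProduct, mulVec]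
      fun_prop
    exact h1.cexp.continuousOn

variable [DecidableEq ι]

/-- Write A = CᵀC using square roots of its eigenvalues, diagonalise C⁻ᵀBC⁻¹ by an orthogonal W, and
take T = WᵀC. -/
lemma exists_simultaneous_diagonal {A B : Matrix ι ι ℝ} (hA : A.PosDef) (hB : B.IsHermitian) :
    ∃ (T : Matrix ι ι ℝ) (d : ι → ℝ), T.det ≠ 0 ∧ A = Tᵀ * T ∧ B = Tᵀ * diagonal d * T := by
  obtain ⟨C, hC, hAC⟩ : ∃ C : Matrix ι ι ℝ, C.det ≠ 0 ∧ A = Cᵀ * C := by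
    have hs := hA.isHermitian.spectral_theorem
    set U : Matrix ι ι ℝ := hA.isHermitian.eigenvectorUnitary.val with hU
    rw [Unitary.conjStarAlgAut_apply] at hs
    refine ⟨diagonal (fun i => √(hA.isHermitian.eigenvalues i)) * Uᵀ, ?_, ?_⟩
    · rw [det_mul, det_diagonal, det_transpose]
      refine mul_ne_zero (Finset.prod_ne_zero_iff.mpr fun i _ =>
        (Real.sqrt_pos.mpr (hA.eigenvalues_pos i)).ne') ?_
      have h1 := congrArg Matrix.det
        (Unitary.coe_mul_star_self hA.isHermitian.eigenvectorUnitary)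
      rw [det_mul, det_one] at h1
      exact left_ne_zero_of_mul_eq_one h1
    · conv_lhs => rw [hs]
      have hd : diagonal (RCLike.ofReal ∘ hA.isHermitian.eigenvalues : ι → ℝ) =
          diagonal (fun i => √(hA.isHermitian.eigenvalues i)) *
            diagonal (fun i => √(hA.isHermitian.eigenvalues i)) := by
        rw [diagonal_mul_diagonal]
        congr 1
        funext i
        exact (Real.mul_self_sqrt (hA.eigenvalues_pos i).le).symm
      rw [transpose_mul, transpose_transpose, diagonal_transpose, hd, star_eq_conjTranspose,
        conjTranspose_eq_transpose_of_trivial]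
      simp only [Matrix.mul_assoc, hU]
  have hN : ((C⁻¹)ᵀ * B * C⁻¹).IsHermitian := by
    have hB' : Bᵀ = B := by rw [← conjTranspose_eq_transpose_of_trivial]; exact hB
    rw [Matrix.IsHermitian, conjTranspose_eq_transpose_of_trivial, transpose_mul, transpose_mul,
      transpose_transpose, hB', Matrix.mul_assoc]
  have hs := hN.spectral_theorem
  rw [Unitary.conjStarAlgAut_apply, star_eq_conjTranspose,
    conjTranspose_eq_transpose_of_trivial] at hs
  set W : Matrix ι ι ℝ := hN.eigenvectorUnitary.val with hW
  have hWW : W * Wᵀ = 1 := by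
    have : W * star W = 1 := Unitary.coe_mul_star_self hN.eigenvectorUnitary
    rwa [star_eq_conjTranspose, conjTranspose_eq_transpose_of_trivial] at this
  refine ⟨Wᵀ * C, hN.eigenvalues, ?_, ?_, ?_⟩
  · rw [det_mul, det_transpose]
    have := congrArg Matrix.det hWW
    rw [det_mul, det_one] at this
    exact mul_ne_zero (left_ne_zero_of_mul_eq_one this) hC
  · rw [transpose_mul, transpose_transpose, Matrix.mul_assoc, ← Matrix.mul_assoc W, hWW,
      Matrix.one_mul, hAC]
  · have hCi : C⁻¹ * C = 1 := nonsing_inv_mul _ hC.isUnit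
    have hCt : Cᵀ * (C⁻¹)ᵀ = 1 := by rw [← transpose_mul, hCi, transpose_one]
    have hd : diagonal (RCLike.ofReal ∘ hN.eigenvalues : ι → ℝ) = diagonal hN.eigenvalues := rfl
    calc B = Cᵀ * ((C⁻¹)ᵀ * B * C⁻¹) * C := by
          rw [Matrix.mul_assoc _ _ C, Matrix.mul_assoc _ _ C, hCi, Matrix.mul_one,
            ← Matrix.mul_assoc, hCt, Matrix.one_mul]
      _ = Cᵀ * (W * diagonal hN.eigenvalues * Wᵀ) * C := by
          conv_lhs => rw [hs, hd]
      _ = _ := by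
          rw [transpose_mul, transpose_transpose]
          simp only [Matrix.mul_assoc]

lemma ReBddBelow.exists_diagonal {c : ℝ} (hc : 0 < c) {M : Matrix ι ι ℂ} (hM : M.IsSymm)
    (h : ReBddBelow c M) : ∃ (T : Matrix ι ι ℝ) (d : ι → ℝ), T.det ≠ 0 ∧
      M = (T.map (fun r => (r : ℂ)))ᵀ * diagonal (fun i => 1 + I * (d i : ℂ)) *
        T.map (fun r => (r : ℂ)) := by
  set A : Matrix ι ι ℝ := M.map Complex.re with hAdef
  set B : Matrix ι ι ℝ := M.map Complex.im with hBdef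
  have hAh : A.IsHermitian := by
    ext i j
    simp [hAdef, hM.apply i j]
  have hBh : B.IsHermitian := by
    ext i j
    simp [hBdef, hM.apply i j]
  have hre : ∀ x : ι → ℝ, (castVec x ⬝ᵥ M *ᵥ castVec x).re = x ⬝ᵥ A *ᵥ x := by
    intro x
    simp [castVec, dotProduct, mulVec, hAdef]
  have hA : A.PosDef := by
    refine posDef_iff_dotProduct_mulVec.mpr ⟨hAh, fun {x} hx => ?_⟩
    have h1 := h x
    rw [hre] at h1
    refine lt_of_lt_of_le ?_ h1
    obtain ⟨i, hi⟩ := Function.ne_iff.mp hx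
    have : 0 < ∑ i, x i ^ 2 := Finset.sum_pos' (fun i _ => sq_nonneg _)
      ⟨i, Finset.mem_univ i, by positivity [show x i ≠ 0 from hi]⟩
    positivity
  obtain ⟨T, d, hT, hA', hB'⟩ := exists_simultaneous_diagonal hA hBh
  refine ⟨T, d, hT, ?_⟩
  -- Real and imaginary parts of M are diagonalised together, the real part to the identity, so M =
  -- Tᵀ(1 + iD)T with T real and the integral splits into one-dimensional ones.
  have hsplit : diagonal (fun i => 1 + I * (d i : ℂ)) =
      1 + I • (diagonal d).map (fun r => (r : ℂ)) := by
    ext i j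
    by_cases hij : i = j
    · subst hij; simp
    · simp [hij]
  have hMs : M = A.map (fun r => (r : ℂ)) + I • B.map (fun r => (r : ℂ)) := by
    ext i j
    simp [hAdef, hBdef, mul_comm I]
  have hmm : ∀ X Y : Matrix ι ι ℝ, (X * Y).map (fun r => (r : ℂ)) =
      X.map (fun r => (r : ℂ)) * Y.map (fun r => (r : ℂ)) := fun X Y =>
    Matrix.map_mul (f := Complex.ofRealHom)
  rw [hMs, hsplit, hA', hB', hmm, hmm, hmm, ← transpose_map, Matrix.mul_add, Matrix.add_mul]
  simp

/-- Change of variables in a Gaussian integral. -/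
lemma ReBddBelow.gaussian {c : ℝ} (hc : 0 < c) {M : Matrix ι ι ℂ} (hM : M.IsSymm)
    (h : ReBddBelow c M) : M.det ≠ 0 ∧ (∀ w : ι → ℂ, Integrable fun x : ι → ℝ =>
        cexp (-(castVec x ⬝ᵥ M *ᵥ castVec x) + w ⬝ᵥ castVec x)) ∧
      (∀ w, gaussInt M w = gaussInt M 0 * cexp (1 / 4 * (w ⬝ᵥ M⁻¹ *ᵥ w))) ∧
      gaussInt M 0 ^ 2 * M.det = Real.pi ^ Fintype.card ι := by
  obtain ⟨T, d, hT, hMT⟩ := h.exists_diagonal hc hM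
  set Tc : Matrix ι ι ℂ := T.map (fun r => (r : ℂ)) with hTc
  set e : ι → ℂ := fun i => 1 + I * (d i : ℂ) with he
  have hee : ∀ i, e i ≠ 0 := fun i hi => by
    have := congrArg Complex.re hi
    simp [he] at this
  have hdetTc : Tc.det = (T.det : ℂ) := (RingHom.map_det Complex.ofRealHom T).symm
  have hdetTc0 : Tc.det ≠ 0 := by rw [hdetTc]; exact_mod_cast hT
  have hdet : M.det = T.det ^ 2 * ∏ i, e i := by
    rw [hMT, det_mul, det_mul, det_transpose, det_diagonal, hdetTc]
    ring
  have hdet0 : M.det ≠ 0 := by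
    rw [hdet]
    exact mul_ne_zero (pow_ne_zero 2 (by exact_mod_cast hT))
      (Finset.prod_ne_zero_iff.mpr fun i _ => hee i)
  have hcast : ∀ x : ι → ℝ, castVec (T *ᵥ x) = Tc *ᵥ castVec x := by
    intro x
    funext i
    simp [castVec, mulVec, dotProduct, hTc]
  have hTi : Tc⁻¹ * Tc = 1 := nonsing_inv_mul _ hdetTc0.isUnit
  -- the integrand in the coordinates `y = T x`
  set f : (ι → ℂ) → (ι → ℝ) → ℂ := fun w' y =>
    ∏ i, cexp (-(e i) * (y i : ℂ) ^ 2 + w' i * (y i : ℂ) + 0) with hf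
  have hfx : ∀ w : ι → ℂ, (fun x : ι → ℝ =>
      cexp (-(castVec x ⬝ᵥ M *ᵥ castVec x) + w ⬝ᵥ castVec x)) =
      fun x => f ((Tc⁻¹)ᵀ *ᵥ w) (toLin' T x) := by
    intro w
    funext x
    simp only [hf]
    rw [← Complex.exp_sum]
    congr 1
    have h1 : castVec x ⬝ᵥ M *ᵥ castVec x = ∑ i, e i * (castVec (T *ᵥ x) i) ^ 2 := by
      rw [hcast, hMT, ← mulVec_mulVec, ← mulVec_mulVec, dotProduct_mulVec, vecMul_transpose]
      simp only [dotProduct, mulVec_diagonal]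
      exact Finset.sum_congr rfl fun i _ => by ring
    have h2 : w ⬝ᵥ castVec x = ∑ i, ((Tc⁻¹)ᵀ *ᵥ w) i * castVec (T *ᵥ x) i := by
      change _ = ((Tc⁻¹)ᵀ *ᵥ w) ⬝ᵥ castVec (T *ᵥ x)
      rw [hcast, mulVec_transpose, ← dotProduct_mulVec, mulVec_mulVec, hTi, one_mulVec]
    rw [h1, h2, ← Finset.sum_neg_distrib, ← Finset.sum_add_distrib]
    refine Finset.sum_congr rfl fun i _ => ?_
    simp [castVec]
  have hmap := Real.map_matrix_volume_pi_eq_smul_volume_pi hT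
  have hemb : MeasurableEmbedding (toLin' T) :=
    (LinearMap.isClosedEmbedding_of_injective (f := toLin' T) (LinearMap.ker_eq_bot.mpr
      fun a b hab => mulVec_injective_of_isUnit ((isUnit_iff_isUnit_det T).mpr hT.isUnit)
        (by simpa using hab))).measurableEmbedding
  have hre : ∀ i, (-(e i)).re < 0 := fun i => by simp [he]
  have hfint : ∀ w', Integrable (f w') := fun w' =>
    Integrable.fintype_prod_dep (fun i => integrable_cexp_quadratic' (hre i) (w' i) 0)
  have hfval : ∀ w', ∫ y, f w' y = (∏ i, ((Real.pi : ℂ) / e i) ^ (1 / 2 : ℂ)) *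
      cexp (1 / 4 * ∑ i, w' i ^ 2 / e i) := by
    intro w'
    simp only [hf]
    rw [integral_fintype_prod_volume_eq_prod
      (fun i (y : ℝ) => cexp (-(e i) * (y : ℂ) ^ 2 + w' i * (y : ℂ) + 0))]
    simp only [integral_cexp_quadratic (hre _)]
    rw [Finset.prod_mul_distrib, ← Complex.exp_sum, Finset.mul_sum]
    congr 1
    · simp
    · congr 1
      refine Finset.sum_congr rfl fun i _ => ?_
      have := hee i
      field_simp
      ring
  have hval : ∀ w, gaussInt M w = (|T.det⁻¹| : ℝ) * ((∏ i, ((Real.pi : ℂ) / e i) ^ (1 / 2 : ℂ)) *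
      cexp (1 / 4 * ∑ i, ((Tc⁻¹)ᵀ *ᵥ w) i ^ 2 / e i)) := by
    intro w
    rw [gaussInt, hfx, ← hemb.integral_map, hmap, integral_smul_measure, hfval,
      ENNReal.toReal_ofReal (abs_nonneg _), Complex.real_smul]
  refine ⟨hdet0, fun w => ?_, fun w => ?_, ?_⟩
  · rw [hfx]
    change Integrable (f ((Tc⁻¹)ᵀ *ᵥ w) ∘ toLin' T)
    rw [← hemb.integrable_map_iff]
    rw [hmap]
    exact (hfint _).smul_measure ENNReal.ofReal_ne_top
  · rw [hval, hval]
    have h1 : w ⬝ᵥ M⁻¹ *ᵥ w = ∑ i, ((Tc⁻¹)ᵀ *ᵥ w) i ^ 2 / e i := by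
      have hD : (diagonal e)⁻¹ = diagonal (fun i => (e i)⁻¹) := by
        refine inv_eq_right_inv ?_
        rw [diagonal_mul_diagonal, ← diagonal_one]
        congr 1
        funext i
        exact mul_inv_cancel₀ (hee i)
      rw [hMT, Matrix.mul_inv_rev, Matrix.mul_inv_rev, hD, ← mulVec_mulVec, dotProduct_mulVec,
        ← mulVec_transpose, ← transpose_nonsing_inv, ← mulVec_mulVec]
      simp only [dotProduct, mulVec_diagonal]
      exact Finset.sum_congr rfl fun i _ => by ring
    rw [h1]
    simp
    ring
  · rw [hval, hdet]
    simp only [mulVec_zero, Pi.zero_apply]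
    -- Squaring removes the principal roots of the individual factors; the sign of the integral is
    -- recovered later by continuity.
    have h1 : (∏ i, ((Real.pi : ℂ) / e i) ^ (1 / 2 : ℂ)) ^ 2 * ∏ i, e i =
        Real.pi ^ Fintype.card ι := by
      rw [← Finset.prod_pow, ← Finset.prod_mul_distrib, ← Finset.card_univ, ← Finset.prod_const]
      refine Finset.prod_congr rfl fun i _ => ?_
      rw [← Complex.cpow_nat_mul]
      have := hee i
      norm_num
      field_simp
    have h2 : ((|T.det⁻¹| : ℝ) : ℂ) ^ 2 * (T.det : ℂ) ^ 2 = 1 := by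
      norm_cast
      rw [sq_abs, ← mul_pow, inv_mul_cancel₀ hT, one_pow]
    calc _ = ((|T.det⁻¹| : ℝ) : ℂ) ^ 2 * (T.det : ℂ) ^ 2 *
          ((∏ i, ((Real.pi : ℂ) / e i) ^ (1 / 2 : ℂ)) ^ 2 * ∏ i, e i) := by
            simp
            ring
      _ = _ := by rw [h1, h2, one_mul]

end Gaussian

/-! ### Volume elements and split frames of a real form. -/

lemma stdVolume_eq {U : Submodule ℝ (Sp m)} {k : ℕ} (e : Module.Basis (Fin k) ℝ U) {ε : ℂ}
    (hε : ‖ε‖ = 1) (he : ∀ i j, (e i : Sp m) ⬝ᵥ (e j : Sp m) = if i = j then ε else 0) :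
    stdVolume U = Measure.map (fun x : Fin k → ℝ => ((∑ i, x i • e i : U) : Sp m)) volume := by
  unfold stdVolume
  have hk : Module.finrank ℝ U = k := by
    rw [Module.finrank_eq_card_basis e, Fintype.card_fin]
  -- The basis is made arbitrary so that its index type can be rewritten from the rank to k. The
  -- change-of-basis matrix A then contributes |det A| through the Gram determinant and |det A|⁻¹
  -- through the pushforward.
  generalize Module.finBasis ℝ U = B
  revert B
  rw [hk]
  intro B
  set A : Matrix (Fin k) (Fin k) ℝ := e.toMatrix B with hA
  -- `A i j` is the `i`-th coordinate of `B j`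
  have hB : ∀ j, (B j : Sp m) = ∑ i, (A i j : ℂ) • (e i : Sp m) := by
    intro j
    conv_lhs => rw [← e.sum_repr (B j)]
    rw [Submodule.coe_sum]
    exact Finset.sum_congr rfl fun i _ => by
      rw [Submodule.coe_smul, Complex.coe_smul, hA, Module.Basis.toMatrix_apply]
  have hdet : A.det ≠ 0 := by
    have h1 : A * B.toMatrix e = 1 := e.toMatrix_mul_toMatrix_flip B
    have h2 := congrArg Matrix.det h1
    rw [det_mul, det_one] at h2
    exact left_ne_zero_of_mul_eq_one h2
  have hgram : (Matrix.of fun i j => (B i : Sp m) ⬝ᵥ (B j : Sp m)) =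
      ε • ((A.map (fun r => (r : ℂ)))ᵀ * A.map (fun r => (r : ℂ))) := by
    ext i j
    simp only [of_apply, Matrix.smul_apply, Matrix.mul_apply, transpose_apply, map_apply,
      smul_eq_mul]
    rw [hB, hB, sum_dotProduct]
    simp only [dotProduct_sum, smul_dotProduct, dotProduct_smul, he, smul_eq_mul]
    simp [Finset.mul_sum]
    exact Finset.sum_congr rfl fun l _ => by ring
  have hdetmap : (A.map (fun r => (r : ℂ))).det = (A.det : ℂ) :=
    (RingHom.map_det Complex.ofRealHom A).symm
  have hsqrt : Real.sqrt ‖(Matrix.of fun i j => (B i : Sp m) ⬝ᵥ (B j : Sp m)).det‖ = |A.det| := by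
    rw [hgram, det_smul, det_mul, det_transpose, hdetmap]
    rw [norm_mul, norm_pow, hε, one_pow, one_mul, norm_mul, Complex.norm_real, Real.norm_eq_abs,
      Real.sqrt_mul_self (abs_nonneg _)]
  rw [hsqrt]
  have hfun : (fun c : Fin k → ℝ => ((∑ i, c i • B i : U) : Sp m)) =
      (fun x : Fin k → ℝ => ((∑ i, x i • e i : U) : Sp m)) ∘ (toLin' A) := by
    funext c
    simp only [Submodule.coe_sum, Submodule.coe_smul, Function.comp_apply, toLin'_apply, mulVec,
      dotProduct, Finset.sum_smul, hB, Finset.smul_sum]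
    rw [Finset.sum_comm]
    refine Finset.sum_congr rfl fun i _ => Finset.sum_congr rfl fun j _ => ?_
    rw [Complex.coe_smul, smul_smul, mul_comm]
  have hmeas : Measurable (fun x : Fin k → ℝ => ((∑ i, x i • e i : U) : Sp m)) := by
    simp only [Submodule.coe_sum, Submodule.coe_smul]
    fun_prop
  have hmeas' : Measurable (toLin' A) := (LinearMap.continuous_of_finiteDimensional _).measurable
  rw [hfun, ← Measure.map_map hmeas hmeas', Real.map_matrix_volume_pi_eq_smul_volume_pi hdet,
    Measure.map_smul, smul_smul, ← ENNReal.ofReal_mul (abs_nonneg _), ← abs_mul,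
    mul_inv_cancel₀ hdet]
  simp

variable {V : Submodule ℝ (Sp m)}

/-- A frame of `V` made of vectors `(O_i, 0)` and `(0, O_i)`. -/
structure IsSplitFrame (V : Submodule ℝ (Sp m)) (ε : ℂ) (O : Matrix (Fin m) (Fin m) ℂ) : Prop where
  sign : ε = 1 ∨ ε = -1
  gram : O * Oᵀ = ε • 1
  mem_left : ∀ x : Fin m → ℝ, Sum.elim (castVec x ᵥ* O) 0 ∈ V
  mem_right : ∀ x : Fin m → ℝ, Sum.elim (0 : Fin m → ℂ) (castVec x ᵥ* O) ∈ V
  volume_left : stdVolume (V ⊓ coordU m) =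
    Measure.map (fun x : Fin m → ℝ => (Sum.elim (castVec x ᵥ* O) 0 : Sp m)) volume
  volume_right : stdVolume (V ⊓ coordV m) =
    Measure.map (fun x : Fin m → ℝ => (Sum.elim (0 : Fin m → ℂ) (castVec x ᵥ* O) : Sp m)) volume

lemma dotProduct_frame {ε : ℂ} {b : Idx m → Sp m}
    (hb : ∀ i j, b i ⬝ᵥ b j = if i = j then ε else 0) (c d : Idx m → ℝ) :
    (∑ i, c i • b i) ⬝ᵥ (∑ i, d i • b i) = ε * ((∑ i, c i * d i : ℝ) : ℂ) := by
  rw [sum_dotProduct]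
  simp only [dotProduct_sum, smul_dotProduct, dotProduct_smul, hb]
  push_cast
  rw [Finset.mul_sum]
  refine Finset.sum_congr rfl fun i _ => ?_
  simp
  ring

lemma vecMul_J (x : Sp m) : Matrix.vecMul x (Matrix.J (Fin m) ℂ) =
    Sum.elim (fun k => x (Sum.inr k)) (fun k => -x (Sum.inl k)) := by
  rw [Matrix.J, vecMul_fromBlocks]
  simp [Function.comp_def, vecMul_neg]
  rfl

lemma sum_smul_elim (O : Matrix (Fin m) (Fin m) ℂ) (x : Fin m → ℝ) :
    ∑ i, x i • (Sum.elim (O i) 0 : Sp m) = Sum.elim (castVec x ᵥ* O) 0 := by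
  funext k
  rcases k with k | k <;> simp [vecMul, dotProduct, castVec]

lemma sum_smul_elim' (O : Matrix (Fin m) (Fin m) ℂ) (x : Fin m → ℝ) :
    ∑ i, x i • (Sum.elim (0 : Fin m → ℂ) (O i) : Sp m) = Sum.elim (0 : Fin m → ℂ) (castVec x ᵥ* O) := by
  funext k
  rcases k with k | k <;> simp [vecMul, dotProduct, castVec]

/-- On V the form ε⟨·,·⟩ is real and positive definite, so the left half has a frame orthonormal up
to ε. Since J exchanges the halves, each has dimension m, and −J carries this frame to one of the
right half with the same matrix O. -/
theorem IsRealForm.exists_splitFrame (hV : IsRealForm V) : ∃ ε O, IsSplitFrame V ε O := by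
  obtain ⟨ε, b, hε, hb, hspan⟩ := hV.frame
  have hε2 : ε * ε = 1 := by rcases hε with rfl | rfl <;> norm_num
  have hεn : ‖ε‖ = 1 := by rcases hε with rfl | rfl <;> simp
  have hcoef : ∀ x ∈ V, ∃ c : Idx m → ℝ, ∑ i, c i • b i = x := by
    intro x hx
    rw [← hspan] at hx
    exact Submodule.mem_span_range_iff_exists_fun ℝ |>.mp hx
  have hreal : ∀ x ∈ V, ∀ y ∈ V, x ⬝ᵥ y = ε * ((ε * (x ⬝ᵥ y)).re : ℂ) := by
    intro x hx y hy
    obtain ⟨c, rfl⟩ := hcoef x hx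
    obtain ⟨d, rfl⟩ := hcoef y hy
    rw [dotProduct_frame hb, ← mul_assoc, hε2, one_mul, Complex.ofReal_re]
  have hpos : ∀ x ∈ V, x ≠ 0 → 0 < (ε * (x ⬝ᵥ x)).re := by
    intro x hx h0
    obtain ⟨c, rfl⟩ := hcoef x hx
    rw [dotProduct_frame hb, ← mul_assoc, hε2, one_mul, Complex.ofReal_re]
    have hc : ∃ i, c i ≠ 0 := by
      by_contra! hc
      exact h0 (by simp [hc])
    obtain ⟨i, hi⟩ := hc
    exact Finset.sum_pos' (fun i _ => mul_self_nonneg _)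
      ⟨i, Finset.mem_univ i, mul_self_pos.mpr hi⟩
  -- the two halves are exchanged by `J`
  have hJmem : ∀ x ∈ V, Matrix.vecMul x (Matrix.J (Fin m) ℂ) ∈ V := fun x hx =>
    (Set.ext_iff.mp hV.map_J _).mp ⟨x, hx, rfl⟩
  let Jl : Sp m →ₗ[ℝ] Sp m := (Matrix.vecMulLinear (Matrix.J (Fin m) ℂ)).restrictScalars ℝ
  have hJl : ∀ x, Jl x = Matrix.vecMul x (Matrix.J (Fin m) ℂ) := fun x => rfl
  have hJJ : ∀ x, Jl (Jl x) = -x := by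
    intro x
    rw [hJl, hJl, vecMul_vecMul, J_squared, vecMul_neg, vecMul_one]
  have hUV : ∀ x ∈ V ⊓ coordU m, Jl x ∈ V ⊓ coordV m := by
    rintro x ⟨hx, hx'⟩
    refine ⟨hJmem x hx, fun k => ?_⟩
    rw [hJl, vecMul_J]
    exact hx' k
  have hVU : ∀ x ∈ V ⊓ coordV m, Jl x ∈ V ⊓ coordU m := by
    rintro x ⟨hx, hx'⟩
    refine ⟨hJmem x hx, fun k => ?_⟩
    rw [hJl, vecMul_J]
    simpa using hx' k
  let Je : (V ⊓ coordU m : Submodule ℝ (Sp m)) ≃ₗ[ℝ] (V ⊓ coordV m : Submodule ℝ (Sp m)) :=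
    -- The sign is chosen so that (O_i, 0) goes to (0, O_i); the inverse is J because J² = −1.
    LinearEquiv.ofLinearMap (-(Jl.restrict hUV)) (Jl.restrict hVU)
      (by ext1 x; apply Subtype.ext; simp [hJJ])
      (by ext1 x; apply Subtype.ext; simp [hJJ])
  have hJe : ∀ x, ((Je x : (V ⊓ coordV m : Submodule ℝ (Sp m))) : Sp m) = -Jl x := fun x => rfl
  have hli : LinearIndependent ℝ b := by
    rw [Fintype.linearIndependent_iff]
    intro c hc i
    have h1 := dotProduct_frame hb c (Pi.single i 1)
    rw [hc, zero_dotProduct] at h1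
    have hε0 : ε ≠ 0 := fun h => by simp [h] at hε2
    have h2 := (mul_eq_zero.mp h1.symm).resolve_left hε0
    simpa [Pi.single_apply] using h2
  have hfinV : Module.finrank ℝ V = m + m := by
    rw [← hspan, finrank_span_eq_card hli]
    simp
  have hinf : (V ⊓ coordU m) ⊓ (V ⊓ coordV m) = ⊥ := by
    rw [eq_bot_iff]
    rintro x ⟨⟨_, h1⟩, ⟨_, h2⟩⟩
    rw [Submodule.mem_bot]
    funext k
    rcases k with k | k
    · exact h2 k
    · exact h1 k
  have hfin : Module.finrank ℝ (V ⊓ coordU m : Submodule ℝ (Sp m)) = m := by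
    have h1 := Submodule.finrank_sup_add_finrank_inf_eq (V ⊓ coordU m) (V ⊓ coordV m)
    rw [hinf, ← hV.split, hfinV, finrank_bot, ← Je.finrank_eq] at h1
    omega
  -- an orthonormal basis of the left half
  let B : LinearMap.BilinForm ℝ (V ⊓ coordU m : Submodule ℝ (Sp m)) :=
    LinearMap.mk₂ ℝ (fun x y => (ε * ((x : Sp m) ⬝ᵥ (y : Sp m))).re)
      (by intro x y z; simp [add_dotProduct, mul_add])
      (by intro c x y; simp [smul_dotProduct]; ring)
      (by intro x y z; simp [dotProduct_add, mul_add])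
      (by intro c x y; simp [dotProduct_smul]; ring)
  have hBapp : ∀ x y, B x y = (ε * ((x : Sp m) ⬝ᵥ (y : Sp m))).re := fun x y => rfl
  have hBsymm : LinearMap.IsSymm B := ⟨fun x y => by
    simp only [hBapp, RingHom.id_apply]
    rw [dotProduct_comm]⟩
  have : Invertible (2 : ℝ) := invertibleOfNonzero two_ne_zero
  obtain ⟨v, hv⟩ := LinearMap.BilinForm.exists_orthogonal_basis hBsymm
  have hBpos : ∀ i, 0 < B (v i) (v i) := fun i =>
    hpos _ (v i).2.1 (fun h => v.ne_zero i (Subtype.ext h))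
  let e₀ := v.isUnitSMul (w := fun i => (√(B (v i) (v i)))⁻¹)
    (fun i => (inv_ne_zero (Real.sqrt_pos.mpr (hBpos i)).ne').isUnit)
  have he₀ : ∀ i j, B (e₀ i) (e₀ j) = if i = j then 1 else 0 := by
    intro i j
    simp only [e₀, Module.Basis.isUnitSMul_apply, map_smul, LinearMap.smul_apply, smul_eq_mul]
    by_cases hij : i = j
    · subst hij
      have h1 := Real.mul_self_sqrt (hBpos i).le
      have h2 := (Real.sqrt_pos.mpr (hBpos i)).ne'
      rw [if_pos rfl]
      nth_rewrite 3 [← h1]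
      field_simp
    · rw [if_neg hij, hv hij]
      simp
  let e := e₀.reindex (finCongr hfin)
  have he : ∀ i j, (e i : Sp m) ⬝ᵥ (e j : Sp m) = if i = j then ε else 0 := by
    intro i j
    rw [hreal _ (e i).2.1 _ (e j).2.1, ← hBapp]
    simp only [e, Module.Basis.reindex_apply, he₀]
    by_cases hij : i = j <;> simp [hij]
  let O : Matrix (Fin m) (Fin m) ℂ := Matrix.of fun i k => (e i : Sp m) (Sum.inl k)
  have heO : ∀ i, (e i : Sp m) = Sum.elim (O i) 0 := by
    intro i
    funext k
    rcases k with k | k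
    · rfl
    · exact (e i).2.2 k
  have heO' : ∀ i, ((e.map Je i : (V ⊓ coordV m : Submodule ℝ (Sp m))) : Sp m) =
      Sum.elim (0 : Fin m → ℂ) (O i) := by
    intro i
    rw [Module.Basis.map_apply, hJe, hJl, vecMul_J, heO]
    funext k
    rcases k with k | k <;> simp
  have hsum : ∀ x : Fin m → ℝ, ((∑ i, x i • e i : (V ⊓ coordU m : Submodule ℝ (Sp m))) : Sp m) =
      Sum.elim (castVec x ᵥ* O) 0 := by
    intro x
    simp only [Submodule.coe_sum, Submodule.coe_smul, heO, sum_smul_elim]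
  have hsum' : ∀ x : Fin m → ℝ,
      ((∑ i, x i • e.map Je i : (V ⊓ coordV m : Submodule ℝ (Sp m))) : Sp m) =
      Sum.elim (0 : Fin m → ℂ) (castVec x ᵥ* O) := by
    intro x
    simp only [Submodule.coe_sum, Submodule.coe_smul, heO', sum_smul_elim']
  have hOgram : ∀ i j, O i ⬝ᵥ O j = if i = j then ε else 0 := by
    intro i j
    rw [← he, heO, heO]
    simp [dotProduct, Fintype.sum_sum_type]
  refine ⟨ε, O, hε, ?_, fun x => ?_, fun x => ?_, ?_, ?_⟩
  · ext i j
    rw [Matrix.mul_apply']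
    simpa [Matrix.one_apply] using hOgram i j
  · rw [← hsum]
    exact (∑ i, x i • e i : (V ⊓ coordU m : Submodule ℝ (Sp m))).2.1
  · rw [← hsum']
    exact (∑ i, x i • e.map Je i : (V ⊓ coordV m : Submodule ℝ (Sp m))).2.1
  · rw [stdVolume_eq e hεn he]
    simp only [hsum]
  · rw [stdVolume_eq (e.map Je) hεn]
    · simp only [hsum']
    · intro i j
      rw [heO', heO', ← hOgram]
      simp [dotProduct, Fintype.sum_sum_type]

/-! ### Positivity in a frame, and the sign of the Gaussian prefactor. -/

lemma det_swapMat : (swapMat m).det = (-1) ^ m := by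
  have h1 : swapMat m * fromBlocks 1 0 1 1 = fromBlocks 1 1 1 0 := by
    simp [swapMat, fromBlocks_multiply]
  have h2 := congrArg Matrix.det h1
  rw [det_mul, det_fromBlocks_zero₁₂, det_fromBlocks_one₁₁] at h2
  simpa [det_neg] using h2

/-- The block-diagonal matrix `diag (O, O)`. -/
def frameMat (O : Matrix (Fin m) (Fin m) ℂ) : Matrix (Idx m) (Idx m) ℂ := fromBlocks O 0 0 O

section Frame

variable {ε : ℂ} {O : Matrix (Fin m) (Fin m) ℂ}

lemma frameMat_mul_transpose (hO : O * Oᵀ = ε • 1) :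
    frameMat O * (frameMat O)ᵀ = ε • 1 := by
  rw [frameMat, fromBlocks_transpose, fromBlocks_multiply, ← fromBlocks_one, fromBlocks_smul]
  simp [hO]

lemma frameMat_swap_transpose (hO : O * Oᵀ = ε • 1) :
    frameMat O * swapMat m * (frameMat O)ᵀ = ε • swapMat m := by
  rw [frameMat, swapMat, fromBlocks_transpose, fromBlocks_multiply, fromBlocks_multiply,
    fromBlocks_smul]
  simp [hO]

lemma det_frameMat_sq (hε : ε = 1 ∨ ε = -1) (hO : O * Oᵀ = ε • 1) : (frameMat O).det ^ 2 = 1 := by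
  have h := congrArg Matrix.det (frameMat_mul_transpose hO)
  rw [det_mul, det_transpose, det_smul, det_one, mul_one] at h
  rw [pow_two, h]
  have h2 : ε ^ 2 = 1 := by rcases hε with rfl | rfl <;> norm_num
  simp [← two_mul, pow_mul, h2]

lemma castVec_vecMul_frameMat (z : Idx m → ℝ) :
    castVec z ᵥ* frameMat O = Sum.elim (castVec (fun i => z (Sum.inl i)) ᵥ* O)
      (castVec (fun i => z (Sum.inr i)) ᵥ* O) := by
  rw [frameMat, vecMul_fromBlocks]
  simp [Function.comp_def]
  rfl

lemma castVec_dotProduct_self {ι : Type*} [Fintype ι] (z : ι → ℝ) :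
    castVec z ⬝ᵥ castVec z = ((∑ i, z i ^ 2 : ℝ) : ℂ) := by
  simp [castVec, dotProduct, pow_two]

lemma castVec_dotProduct_frame (K : Matrix (Idx m) (Idx m) ℂ) (z : Idx m → ℝ) :
    castVec z ⬝ᵥ (frameMat O * K * (frameMat O)ᵀ) *ᵥ castVec z =
      (castVec z ᵥ* frameMat O) ⬝ᵥ K *ᵥ (castVec z ᵥ* frameMat O) := by
  rw [Matrix.mul_assoc, ← mulVec_mulVec, ← mulVec_mulVec, mulVec_transpose, dotProduct_mulVec]

/-- The positivity condition of a `V`-class in the coordinates of a split frame. -/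
def IsFramePos (O : Matrix (Fin m) (Fin m) ℂ) (c : ℝ) (K : Matrix (Idx m) (Idx m) ℂ) : Prop :=
  ReBddBelow c (frameMat O * (I • K) * (frameMat O)ᵀ)

lemma castVec_dotProduct_swapMat_im (z : Idx m → ℝ) :
    (castVec z ⬝ᵥ swapMat m *ᵥ castVec z).im = 0 := by
  rw [dotProduct_swapMat]
  simp [castVec]

/-- In the frame, P becomes εP, a real matrix. A real multiple of P added to K therefore changes the
form of iK by a purely imaginary amount. -/
lemma IsFramePos.add_swap (hε : ε = 1 ∨ ε = -1) (hO : O * Oᵀ = ε • 1) {c : ℝ}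
    {K : Matrix (Idx m) (Idx m) ℂ} (h : IsFramePos O c K) (s : ℝ) :
    IsFramePos O c (K + (s : ℂ) • swapMat m) := by
  intro z
  refine (h z).trans (le_of_eq ?_)
  have e : frameMat O * (I • (K + (s : ℂ) • swapMat m)) * (frameMat O)ᵀ =
      frameMat O * (I • K) * (frameMat O)ᵀ + (I * s * ε) • swapMat m := by
    rw [mul_smul (I * (s : ℂ)) ε (swapMat m), ← frameMat_swap_transpose hO]
    simp only [smul_add, Matrix.mul_add, Matrix.add_mul, Matrix.mul_smul, Matrix.smul_mul, smul_smul]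
  rw [e, add_mulVec, dotProduct_add, smul_mulVec, dotProduct_smul, Complex.add_re]
  have him := castVec_dotProduct_swapMat_im z
  rcases hε with rfl | rfl <;> simp [him]

lemma frame_conj_isSymm {K : Matrix (Idx m) (Idx m) ℂ} (hK : K.IsSymm) :
    (frameMat O * (I • K) * (frameMat O)ᵀ).IsSymm := by
  rw [Matrix.IsSymm, transpose_mul, transpose_mul, transpose_transpose, transpose_smul, hK.eq,
    Matrix.mul_assoc]

lemma IsFramePos.det_ne_zero (hε : ε = 1 ∨ ε = -1) (hO : O * Oᵀ = ε • 1) {c : ℝ} (hc : 0 < c)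
    {K : Matrix (Idx m) (Idx m) ℂ} (hK : K.IsSymm) (h : IsFramePos O c K) (s : ℝ) :
    (K + (s : ℂ) • swapMat m).det ≠ 0 := by
  have h1 := ((h.add_swap hε hO s).gaussian hc
    (frame_conj_isSymm (hK.add (swapMat_isSymm.smul _)))).1
  intro h0
  rw [det_mul, det_mul, det_smul, h0] at h1
  simp at h1

/-- For τ ≠ 0 the pencil is −τ(K − τ⁻¹P), and K plus any real multiple of P is nondegenerate by
positivity. The argument works for every real τ. -/
lemma IsFramePos.isRegular (hε : ε = 1 ∨ ε = -1) (hO : O * Oᵀ = ε • 1) {c : ℝ} (hc : 0 < c)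
    {K : Matrix (Idx m) (Idx m) ℂ} (hK : K.IsSymm) (h : IsFramePos O c K) : IsRegular K := by
  intro τ _
  by_cases h0 : τ = 0
  · subst h0
    simpa [pencil] using det_swapMat_ne_zero
  · have h0' : (τ : ℂ) ≠ 0 := by exact_mod_cast h0
    have e : pencil K τ = (-τ : ℂ) • (K + ((-τ⁻¹ : ℝ) : ℂ) • swapMat m) := by
      rw [pencil, smul_add, smul_smul]
      push_cast
      rw [neg_mul_neg, mul_inv_cancel₀ h0']
      module
    rw [e, det_smul]
    exact mul_ne_zero (pow_ne_zero _ (neg_ne_zero.mpr h0')) (h.det_ne_zero hε hO hc hK _)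

/-- The matrix of the Gaussian integral over the frame. -/
def gaussMat (ħ : ℝ) (O : Matrix (Fin m) (Fin m) ℂ) (K : Matrix (Idx m) (Idx m) ℂ) (s : ℝ) :
    Matrix (Idx m) (Idx m) ℂ :=
  (1 / (4 * ħ) : ℂ) • (frameMat O * (I • (K + (s : ℂ) • swapMat m)) * (frameMat O)ᵀ)

lemma reBddBelow_gaussMat {ħ : ℝ} (hħ : 0 < ħ) (hε : ε = 1 ∨ ε = -1) (hO : O * Oᵀ = ε • 1) {c : ℝ}
    {K : Matrix (Idx m) (Idx m) ℂ} (h : IsFramePos O c K) (s : ℝ) :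
    ReBddBelow (c / (4 * ħ)) (gaussMat ħ O K s) := by
  intro z
  have h1 := h.add_swap hε hO s z
  have e : (1 / (4 * ħ) : ℂ) = ((1 / (4 * ħ) : ℝ) : ℂ) := by push_cast; rfl
  rw [gaussMat, smul_mulVec, dotProduct_smul, e, smul_eq_mul, Complex.re_ofReal_mul]
  calc c / (4 * ħ) * ∑ i, z i ^ 2 = 1 / (4 * ħ) * (c * ∑ i, z i ^ 2) := by ring
    _ ≤ _ := mul_le_mul_of_nonneg_left h1 (by positivity)

lemma gaussMat_isSymm (ħ : ℝ) {K : Matrix (Idx m) (Idx m) ℂ} (hK : K.IsSymm) (s : ℝ) :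
    (gaussMat ħ O K s).IsSymm :=
  (frame_conj_isSymm (hK.add (swapMat_isSymm.smul _))).smul _

lemma det_gaussMat (ħ : ℝ) (hε : ε = 1 ∨ ε = -1) (hO : O * Oᵀ = ε • 1)
    (K : Matrix (Idx m) (Idx m) ℂ) (s : ℝ) :
    (gaussMat ħ O K s).det =
      (1 / (4 * ħ) : ℂ) ^ (2 * m) * ((-1) ^ m * (K + (s : ℂ) • swapMat m).det) := by
  have hcard : Fintype.card (Idx m) = 2 * m := by simp; ring
  rw [gaussMat, det_smul, det_mul, det_mul, det_transpose, det_smul, hcard, pow_mul I, I_sq]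
  have h := det_frameMat_sq hε hO
  linear_combination (1 / (4 * ħ) : ℂ) ^ (2 * m) * ((-1) ^ m * (K + (s : ℂ) • swapMat m).det) * h

/-- The normalized value at the origin of the Gaussian integral over the frame. -/
def frameConst (ħ : ℝ) (O : Matrix (Fin m) (Fin m) ℂ) (K : Matrix (Idx m) (Idx m) ℂ) (s : ℝ) : ℂ :=
  (1 / (2 * Real.pi * ħ) : ℂ) ^ m * gaussInt (gaussMat ħ O K s) 0

lemma frameConst_sq {ħ : ℝ} (hħ : 0 < ħ) (hε : ε = 1 ∨ ε = -1) (hO : O * Oᵀ = ε • 1) {c : ℝ}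
    (hc : 0 < c) {K : Matrix (Idx m) (Idx m) ℂ} (hK : K.IsSymm) (h : IsFramePos O c K) (s : ℝ) :
    frameConst ħ O K s ^ 2 * ((-1) ^ m * (K + (s : ℂ) • swapMat m).det) = (2 ^ m) ^ 2 := by
  have h1 := ((reBddBelow_gaussMat hħ hε hO h s).gaussian (by positivity)
    (gaussMat_isSymm ħ hK s)).2.2.2
  have hcard : Fintype.card (Idx m) = 2 * m := by simp; ring
  rw [det_gaussMat ħ hε hO, hcard] at h1
  have hħ' : (ħ : ℂ) ≠ 0 := by exact_mod_cast hħ.ne'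
  have hπ : (Real.pi : ℂ) ≠ 0 := by exact_mod_cast Real.pi_ne_zero
  set D := (-1) ^ m * (K + (s : ℂ) • swapMat m).det
  have h2 : gaussInt (gaussMat ħ O K s) 0 ^ 2 * D = (Real.pi * (4 * ħ)) ^ (2 * m) := by
    rw [mul_pow (Real.pi : ℂ), ← h1]
    have : (1 / (4 * ħ) : ℂ) ^ (2 * m) * (4 * ħ) ^ (2 * m) = 1 := by
      rw [← mul_pow, one_div, inv_mul_cancel₀ (by simpa using hħ'), one_pow]
    linear_combination (-(gaussInt (gaussMat ħ O K s) 0 ^ 2 * D)) * this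
  rw [frameConst, mul_pow, mul_assoc, h2, ← pow_mul, mul_comm m 2, ← mul_pow, mul_comm 2 m, pow_mul]
  congr 2
  field_simp
  norm_num

/-- The straight path from `K` to `-iε`. -/
def pathK (ε : ℂ) (K : Matrix (Idx m) (Idx m) ℂ) (r : ℝ) : Matrix (Idx m) (Idx m) ℂ :=
  ((1 - r : ℝ) : ℂ) • K + ((r : ℂ) * (-(ε * I))) • 1

/-- The endpoint −iε becomes the identity in the frame after multiplication by i, since ε² = 1;
positivity is preserved by convex combinations with the smaller constant. -/
lemma isFramePos_pathK (hε : ε = 1 ∨ ε = -1) (hO : O * Oᵀ = ε • 1) {c : ℝ}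
    {K : Matrix (Idx m) (Idx m) ℂ} (h : IsFramePos O c K) {r : ℝ} (hr : r ∈ Set.Icc (0 : ℝ) 1) :
    IsFramePos O (min c 1) (pathK ε K r) := by
  intro z
  have hε2 : ε * ε = 1 := by rcases hε with rfl | rfl <;> norm_num
  have e : frameMat O * (I • pathK ε K r) * (frameMat O)ᵀ =
      ((1 - r : ℝ) : ℂ) • (frameMat O * (I • K) * (frameMat O)ᵀ) + (r : ℂ) • 1 := by
    have h1 : frameMat O * (((r : ℂ) * ε) • 1) * (frameMat O)ᵀ = (r : ℂ) • 1 := by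
      rw [Matrix.mul_smul, Matrix.mul_one, Matrix.smul_mul, frameMat_mul_transpose hO, smul_smul,
        mul_assoc, hε2, mul_one]
    have h2 : I • pathK ε K r = ((1 - r : ℝ) : ℂ) • (I • K) + ((r : ℂ) * ε) • 1 := by
      rw [pathK, smul_add, smul_smul, smul_smul, smul_smul]
      congr 2
      · ring
      · linear_combination (-(r : ℂ) * ε) * I_sq
    rw [h2, Matrix.mul_add, Matrix.add_mul, h1]
    simp
  rw [e, add_mulVec, dotProduct_add, smul_mulVec, dotProduct_smul, smul_mulVec, one_mulVec,
    dotProduct_smul, castVec_dotProduct_self, Complex.add_re, smul_eq_mul, smul_eq_mul,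
    Complex.re_ofReal_mul, ← Complex.ofReal_mul, Complex.ofReal_re]
  have h1 := h z
  have hS : 0 ≤ ∑ i, z i ^ 2 := Finset.sum_nonneg fun i _ => sq_nonneg _
  have h2 : min c 1 * ∑ i, z i ^ 2 ≤ (castVec z ⬝ᵥ
      (frameMat O * (I • K) * (frameMat O)ᵀ) *ᵥ castVec z).re :=
    (mul_le_mul_of_nonneg_right (min_le_left _ _) hS).trans h1
  have h3 : min c 1 * ∑ i, z i ^ 2 ≤ ∑ i, z i ^ 2 :=
    (mul_le_mul_of_nonneg_right (min_le_right _ _) hS).trans (by rw [one_mul])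
  have h4 := mul_le_mul_of_nonneg_left h2 (sub_nonneg.mpr hr.2)
  have h5 := mul_le_mul_of_nonneg_left h3 hr.1
  linarith

lemma continuous_pathK (ε : ℂ) (K : Matrix (Idx m) (Idx m) ℂ) : Continuous (pathK ε K) := by
  unfold pathK
  fun_prop

lemma pathK_isSymm {K : Matrix (Idx m) (Idx m) ℂ} (hK : K.IsSymm) (r : ℝ) :
    (pathK ε K r).IsSymm := (hK.smul _).add (isSymm_one.smul _)

lemma continuousOn_invSqrtDet {N : ℝ → Matrix (Idx m) (Idx m) ℂ} (hN : Continuous N)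
    (hreg : ∀ r ∈ Set.Icc (0 : ℝ) 1, IsRegular (N r)) {τ : ℝ} (hτ : τ ∈ Set.Icc (-1 : ℝ) 1) :
    ContinuousOn (fun r => invSqrtDet (N r) τ) (Set.Icc 0 1) := by
  -- Clamping r and s to the intervals where the resolvent exists makes the integrand globally
  -- continuous, as the parametric integral theorem requires.
  let p : ℝ → ℝ := fun r => Set.projIcc (0 : ℝ) 1 zero_le_one r
  let q : ℝ → ℝ := fun s => Set.projIcc (-1 : ℝ) 1 (by norm_num) s
  have hp : Continuous p := continuous_subtype_val.comp continuous_projIcc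
  have hq : Continuous q := continuous_subtype_val.comp continuous_projIcc
  have hF : Continuous (Function.uncurry fun r s => (N (p r) * resolv (N (p r)) (q s)).trace) := by
    rw [continuous_iff_continuousAt]
    rintro ⟨r, s⟩
    have h1 : ContinuousAt (fun x : ℝ × ℝ => (N (p x.1), q x.2)) (r, s) := by fun_prop
    have h2 := continuousAt_resolv
      (hreg (p r) (Set.projIcc (0 : ℝ) 1 zero_le_one r).2 (q s) (Subtype.coe_prop _))
    have h3 : ContinuousAt (fun x : ℝ × ℝ => resolv (N (p x.1)) (q x.2)) (r, s) :=
      ContinuousAt.comp (f := fun x : ℝ × ℝ => (N (p x.1), q x.2)) (x := (r, s)) h2 h1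
    have h4 : Continuous fun A : Matrix (Idx m) (Idx m) ℂ × Matrix (Idx m) (Idx m) ℂ =>
        (A.1 * A.2).trace := (continuous_fst.matrix_mul continuous_snd).matrix_trace
    exact ContinuousAt.comp (g := fun A : Matrix (Idx m) (Idx m) ℂ × Matrix (Idx m) (Idx m) ℂ =>
      (A.1 * A.2).trace) (f := fun x : ℝ × ℝ => (N (p x.1), resolv (N (p x.1)) (q x.2)))
      (x := (r, s)) h4.continuousAt (h1.fst.prodMk h3)
  have hI := intervalIntegral.continuous_parametric_intervalIntegral_of_continuous' hF 0 τ
    (μ := volume)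
  refine ContinuousOn.congr (f := fun r => cexp (1 / 2 * ∫ s in (0 : ℝ)..τ,
    (N (p r) * resolv (N (p r)) (q s)).trace)) (continuous_const.mul hI).cexp.continuousOn ?_
  intro r hr
  have hpr : p r = r := by simp [p, Set.projIcc_of_mem _ hr]
  simp only [invSqrtDet, hpr]
  congr 2
  refine intervalIntegral.integral_congr fun s hs => ?_
  have hs' : s ∈ Set.Icc (-1 : ℝ) 1 := Set.uIcc_subset_Icc (by norm_num) hτ hs
  have hqs : q s = s := by simp [q, Set.projIcc_of_mem _ hs']
  simp only [hqs]

/-- Conjugation by J sends P to −P. -/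
lemma det_one_add_smul_swapMat_neg (a : ℂ) :
    (1 + a • swapMat m).det = (1 - a • swapMat m).det := by
  have h : (1 + a • swapMat m) * Matrix.J (Fin m) ℂ = Matrix.J (Fin m) ℂ * (1 - a • swapMat m) := by
    rw [Matrix.add_mul, Matrix.mul_sub, Matrix.smul_mul, swapMat_mul_J, Matrix.mul_smul]
    simp [sub_eq_add_neg]
  have h1 := congrArg Matrix.det h
  rw [det_mul, det_mul, mul_comm] at h1
  have hJ : (Matrix.J (Fin m) ℂ).det ≠ 0 := left_ne_zero_of_mul_eq_one (J_det_mul_J_det (Fin m) ℂ)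
  exact mul_left_cancel₀ hJ h1

lemma frameConst_pathK_one_zero {ħ : ℝ} (hħ : 0 < ħ) (hε : ε = 1 ∨ ε = -1) (hO : O * Oᵀ = ε • 1)
    (K : Matrix (Idx m) (Idx m) ℂ) : frameConst ħ O (pathK ε K 1) 0 = 2 ^ m := by
  have hε2 : ε * ε = 1 := by rcases hε with rfl | rfl <;> norm_num
  have e : gaussMat ħ O (pathK ε K 1) 0 = ((1 / (4 * ħ) : ℝ) : ℂ) • 1 := by
    rw [gaussMat, pathK]
    simp only [sub_self, Complex.ofReal_zero, zero_smul, zero_add, Complex.ofReal_one, one_mul,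
      add_zero, smul_smul]
    rw [Matrix.mul_smul, Matrix.mul_one, Matrix.smul_mul, frameMat_mul_transpose hO, smul_smul]
    rw [smul_smul]
    congr 1
    push_cast
    linear_combination (-(1 / (4 * (ħ : ℂ)) * (ε * ε))) * I_sq + 1 / (4 * (ħ : ℂ)) * hε2
  have h1 : gaussInt (((1 / (4 * ħ) : ℝ) : ℂ) • (1 : Matrix (Idx m) (Idx m) ℂ)) 0 =
      (4 * Real.pi * ħ) ^ m := by
    have h2 : ∀ x : Idx m → ℝ, cexp (-(castVec x ⬝ᵥ (((1 / (4 * ħ) : ℝ) : ℂ) • 1) *ᵥ castVec x) +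
        0 ⬝ᵥ castVec x) = ((∏ i, Real.exp (-(1 / (4 * ħ)) * x i ^ 2) : ℝ) : ℂ) := by
      intro x
      rw [smul_mulVec, one_mulVec, dotProduct_smul, castVec_dotProduct_self, ← Real.exp_sum,
        ← Finset.mul_sum]
      simp
    simp only [gaussInt, h2]
    rw [integral_complex_ofReal, integral_fintype_prod_volume_eq_prod
      (fun (_ : Idx m) (y : ℝ) => Real.exp (-(1 / (4 * ħ)) * y ^ 2))]
    simp only [integral_gaussian, Finset.prod_const, Finset.card_univ]
    have hcard : Fintype.card (Idx m) = 2 * m := by simp; ring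
    rw [hcard, pow_mul, Real.sq_sqrt (by positivity)]
    push_cast
    congr 1
    have hħ' : (ħ : ℂ) ≠ 0 := by exact_mod_cast hħ.ne'
    field_simp
  have hħ' : (ħ : ℂ) ≠ 0 := by exact_mod_cast hħ.ne'
  have hπ : (Real.pi : ℂ) ≠ 0 := by exact_mod_cast Real.pi_ne_zero
  rw [frameConst, e, h1, ← mul_pow]
  congr 1
  field_simp
  norm_num

lemma continuousOn_frameConst {ħ : ℝ} (hħ : 0 < ħ) (hε : ε = 1 ∨ ε = -1) (hO : O * Oᵀ = ε • 1)
    {N : ℝ → Matrix (Idx m) (Idx m) ℂ} {σ : ℝ → ℝ} (hN : Continuous N) (hσ : Continuous σ) {c : ℝ}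
    (hc : 0 < c) (h : ∀ r ∈ Set.Icc (0 : ℝ) 1, IsFramePos O c (N r)) :
    ContinuousOn (fun r => frameConst ħ O (N r) (σ r)) (Set.Icc 0 1) := by
  have hM : Continuous fun r => gaussMat ħ O (N r) (σ r) := by
    have h1 : Continuous fun r => N r + ((σ r : ℝ) : ℂ) • swapMat m :=
      hN.add ((Complex.continuous_ofReal.comp hσ).smul continuous_const)
    exact ((continuous_const.matrix_mul (h1.const_smul I)).matrix_mul
      continuous_const).const_smul (1 / (4 * ħ) : ℂ)
  exact continuousOn_const.mul (continuousOn_gaussInt hM (c := c / (4 * ħ)) (by positivity)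
    fun r hr => reBddBelow_gaussMat hħ hε hO (h r hr) (σ r))

lemma fredholmDet_eq (K : Matrix (Idx m) (Idx m) ℂ) {s : ℝ} (hs : s ^ 2 = 1) :
    fredholmDet K (-s) = (-1) ^ m * (K + (s : ℂ) • swapMat m).det := by
  have hs' : (s : ℂ) * s = 1 := by rw [← pow_two]; exact_mod_cast hs
  have hcard : Fintype.card (Idx m) = 2 * m := by simp; ring
  have e : pencil K (-s) = (s : ℂ) • (K + (s : ℂ) • swapMat m) := by
    rw [pencil, smul_add, smul_smul, hs', one_smul]
    push_cast
    module
  rw [fredholmDet, e, det_smul, hcard, pow_mul, pow_two, hs', one_pow, one_mul, det_swapMat,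
    mul_comm]

/-- Second homotopy: at K = −iε the coefficient of P is scaled by θ from 0 to 1. At intermediate θ
the determinants on the two sides involve opposite signs of P and agree by
`det_one_add_smul_swapMat_neg`, so the squares agree all along; at θ = 0 both sides are 2ᵐ. -/
lemma frameConst_pathK_one {ħ : ℝ} (hħ : 0 < ħ) (hε : ε = 1 ∨ ε = -1) (hO : O * Oᵀ = ε • 1) {c : ℝ}
    (hc : 0 < c) {K : Matrix (Idx m) (Idx m) ℂ} (hK : K.IsSymm) (h : IsFramePos O c K) {s : ℝ}
    (hs : s ^ 2 = 1) :
    frameConst ħ O (pathK ε K 1) s = 2 ^ m * invSqrtDet (pathK ε K 1) (-s) := by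
  have hε2 : ε * ε = 1 := by rcases hε with rfl | rfl <;> norm_num
  have hs1 : s = 1 ∨ s = -1 := mul_self_eq_one_iff.mp (by rw [← pow_two, hs])
  have h1 := isFramePos_pathK hε hO h (r := 1) (by norm_num)
  have hc1 : 0 < min c 1 := lt_min hc one_pos
  have hsym := pathK_isSymm (ε := ε) hK 1
  have hreg := h1.isRegular hε hO hc1 hsym
  have hmem : ∀ θ ∈ Set.Icc (0 : ℝ) 1, -(s * θ) ∈ Set.Icc (-1 : ℝ) 1 := by
    rintro θ ⟨h0, h1⟩
    rcases hs1 with rfl | rfl <;> constructor <;> linarith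
  have hK1 : pathK ε K 1 = (-(ε * I)) • 1 := by simp [pathK]
  have hcard : Fintype.card (Idx m) = 2 * m := by simp; ring
  have hd1 : ∀ θ : ℝ, (-1) ^ m * (pathK ε K 1 + ((s * θ : ℝ) : ℂ) • swapMat m).det =
      (1 + (I * ε * (s * θ : ℝ)) • swapMat m).det := by
    intro θ
    have e : pathK ε K 1 + ((s * θ : ℝ) : ℂ) • swapMat m =
        (-(ε * I)) • (1 + (I * ε * (s * θ : ℝ)) • swapMat m) := by
      rw [hK1, smul_add, smul_smul]
      congr 2
      linear_combination ((s * θ : ℝ) : ℂ) * (ε * ε * I_sq - hε2)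
    have e2 : (-(ε * I)) ^ 2 = -1 := by linear_combination ε * ε * I_sq - hε2
    rw [e, det_smul, hcard, pow_mul, e2, ← mul_assoc, ← mul_pow]
    norm_num
  have hd2 : ∀ θ : ℝ, fredholmDet (pathK ε K 1) (-(s * θ)) =
      (1 - (I * ε * (s * θ : ℝ)) • swapMat m).det := by
    intro θ
    rw [fredholmDet, ← det_mul]
    congr 1
    rw [pencil, hK1, Matrix.sub_mul, swapMat_mul_self, smul_smul, Matrix.smul_mul, Matrix.one_mul]
    congr 2
    push_cast
    ring
  have key := (isPreconnected_Icc (a := (0 : ℝ)) (b := 1)).eq_of_sq_eq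
    (f := fun θ => frameConst ħ O (pathK ε K 1) (s * θ))
    (g := fun θ => 2 ^ m * invSqrtDet (pathK ε K 1) (-(s * θ)))
    (continuousOn_frameConst hħ hε hO continuous_const (by fun_prop) hc1 fun r _ => h1)
    (continuousOn_const.mul fun θ hθ => (ContinuousAt.comp (f := fun θ : ℝ => -(s * θ)) (x := θ)
      (hreg.hasDerivAt_invSqrtDet (hmem θ hθ)).continuousAt (by fun_prop)).continuousWithinAt)
    ?_ (fun {θ} _ => mul_ne_zero (pow_ne_zero m two_ne_zero) (invSqrtDet_ne_zero _ _)) (y := 0)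
    (by norm_num) ?_ (show (1 : ℝ) ∈ Set.Icc (0 : ℝ) 1 by norm_num)
  · simpa using key
  · intro θ hθ
    have e1 := frameConst_sq hħ hε hO hc1 hsym h1 (s * θ)
    have e2 := hreg.invSqrtDet_sq (hmem θ hθ)
    have hne := hreg.fredholmDet_ne_zero (hmem θ hθ)
    rw [hd1, det_one_add_smul_swapMat_neg, ← hd2] at e1
    simp only [Pi.pow_apply, mul_pow]
    refine mul_right_cancel₀ hne ?_
    rw [e1, mul_assoc, e2, mul_one]
  · simp [frameConst_pathK_one_zero hħ hε hO, invSqrtDet_zero]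

/-- First homotopy: along the path from K to −iε both sides are continuous with equal squares, and
the right side never vanishes, so agreement at the endpoint propagates back to K. -/
theorem frameConst_eq {ħ : ℝ} (hħ : 0 < ħ) (hε : ε = 1 ∨ ε = -1) (hO : O * Oᵀ = ε • 1) {c : ℝ}
    (hc : 0 < c) {K : Matrix (Idx m) (Idx m) ℂ} (hK : K.IsSymm) (h : IsFramePos O c K) {s : ℝ}
    (hs : s ^ 2 = 1) : frameConst ħ O K s = 2 ^ m * invSqrtDet K (-s) := by
  have hc1 : 0 < min c 1 := lt_min hc one_pos
  have hpos : ∀ r ∈ Set.Icc (0 : ℝ) 1, IsFramePos O (min c 1) (pathK ε K r) := fun r hr =>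
    isFramePos_pathK hε hO h hr
  have hreg : ∀ r ∈ Set.Icc (0 : ℝ) 1, IsRegular (pathK ε K r) := fun r hr =>
    (hpos r hr).isRegular hε hO hc1 (pathK_isSymm hK r)
  have hmem : -s ∈ Set.Icc (-1 : ℝ) 1 := by
    have hs1 : s = 1 ∨ s = -1 := mul_self_eq_one_iff.mp (by rw [← pow_two, hs])
    rcases hs1 with rfl | rfl <;> norm_num
  have key := (isPreconnected_Icc (a := (0 : ℝ)) (b := 1)).eq_of_sq_eq
    (f := fun r => frameConst ħ O (pathK ε K r) s)
    (g := fun r => 2 ^ m * invSqrtDet (pathK ε K r) (-s))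
    (continuousOn_frameConst hħ hε hO (continuous_pathK ε K) continuous_const hc1 hpos)
    (continuousOn_const.mul (continuousOn_invSqrtDet (continuous_pathK ε K) hreg hmem))
    ?_ (fun {θ} _ => mul_ne_zero (pow_ne_zero m two_ne_zero) (invSqrtDet_ne_zero _ _)) (y := 1)
    (by norm_num) (frameConst_pathK_one hħ hε hO hc hK h hs)
    (show (0 : ℝ) ∈ Set.Icc (0 : ℝ) 1 by norm_num)
  · simpa [pathK] using key
  · intro r hr
    have e1 := frameConst_sq hħ hε hO hc1 (pathK_isSymm hK r) (hpos r hr) s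
    have e2 := (hreg r hr).invSqrtDet_sq hmem
    have hne := (hreg r hr).fredholmDet_ne_zero hmem
    rw [← fredholmDet_eq _ hs] at e1
    simp only [Pi.pow_apply, mul_pow]
    refine mul_right_cancel₀ hne ?_
    rw [e1, mul_assoc, e2, mul_one]

end Frame

/-! ### From the `V`-class to frame coordinates, and products of exponentials as Gaussians. -/

lemma IsRealForm.dotProduct_im {V : Submodule ℝ (Sp m)} (hV : IsRealForm V) {x y : Sp m}
    (hx : x ∈ V) (hy : y ∈ V) : (x ⬝ᵥ y).im = 0 := by
  obtain ⟨ε, b, hε, hb, hspan⟩ := hV.frame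
  rw [← hspan] at hx hy
  obtain ⟨c, rfl⟩ := Submodule.mem_span_range_iff_exists_fun ℝ |>.mp hx
  obtain ⟨d, rfl⟩ := Submodule.mem_span_range_iff_exists_fun ℝ |>.mp hy
  rw [dotProduct_frame hb, Complex.im_mul_ofReal]
  rcases hε with rfl | rfl <;> simp

section SplitFrame

variable {V : Submodule ℝ (Sp m)} {ε : ℂ} {O : Matrix (Fin m) (Fin m) ℂ}

lemma IsSplitFrame.mem (hO : IsSplitFrame V ε O) (z : Idx m → ℝ) :
    castVec z ᵥ* frameMat O ∈ V := by
  have h := V.add_mem (hO.mem_left fun i => z (Sum.inl i)) (hO.mem_right fun i => z (Sum.inr i))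
  rw [castVec_vecMul_frameMat]
  convert h using 1
  funext k
  rcases k with k | k <;> simp

lemma IsSplitFrame.isFramePos (hO : IsSplitFrame V ε O) (hV : IsRealForm V) {ħ : ℝ} (hħ : 0 < ħ)
    {K : Matrix (Idx m) (Idx m) ℂ} (hK : K ∈ VClass ħ V) : ∃ c, 0 < c ∧ IsFramePos O c K := by
  obtain ⟨_, c, hc, h⟩ := hK
  refine ⟨ħ * c, by positivity, fun z => ?_⟩
  rw [castVec_dotProduct_frame]
  have hξV := hO.mem z
  -- The bilinear square of ξ has modulus the square norm of z and is at most the Hermitian square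
  -- norm of ξ.
  have hnorm : ∑ i, z i ^ 2 ≤ ∑ i, ‖(castVec z ᵥ* frameMat O) i‖ ^ 2 := by
    have h1 := castVec_dotProduct_frame (O := O) 1 z
    rw [Matrix.mul_one, frameMat_mul_transpose hO.gram, one_mulVec, smul_mulVec, one_mulVec,
      dotProduct_smul, castVec_dotProduct_self] at h1
    have hS : 0 ≤ ∑ i, z i ^ 2 := Finset.sum_nonneg fun i _ => sq_nonneg _
    have hεn : ‖ε‖ = 1 := by rcases hO.sign with h | h <;> simp [h]
    have h2 := congrArg norm h1
    rw [norm_smul, hεn, one_mul, Complex.norm_real, Real.norm_of_nonneg hS] at h2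
    rw [h2, dotProduct]
    refine (norm_sum_le _ _).trans (le_of_eq (Finset.sum_congr rfl fun i _ => ?_))
    rw [norm_mul, pow_two]
  generalize castVec z ᵥ* frameMat O = ξ at *
  obtain ⟨⟨v, w⟩, hvw, _⟩ := hV.add_I (ξ ᵥ* (I • K))
  have h1 := h ξ hξV v v.2 w w.2 hvw
  -- The bilinear form is real on V, so the component along iV contributes only to the imaginary
  -- part.
  have h2 : (ξ ⬝ᵥ (I • K) *ᵥ ξ).re = ((v : Sp m) ⬝ᵥ ξ).re := by
    rw [dotProduct_mulVec, hvw, add_dotProduct, smul_dotProduct, Complex.add_re, smul_eq_mul,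
      Complex.I_mul_re, hV.dotProduct_im w.2 hξV, neg_zero, add_zero]
  rw [h2]
  calc ħ * c * ∑ i, z i ^ 2 ≤ ħ * (c * ∑ i, ‖ξ i‖ ^ 2) := by
        rw [mul_assoc]
        gcongr
    _ ≤ ħ * (1 / ħ * ((v : Sp m) ⬝ᵥ ξ).re) := by gcongr
    _ = _ := by field_simp

lemma measurableEmbedding_of_gram (hε : ε = 1 ∨ ε = -1) (hO : O * Oᵀ = ε • 1) (f : (Fin m → ℂ) → Sp m)
    (hf : Continuous f) (hf' : Function.Injective f) :
    MeasurableEmbedding fun x : Fin m → ℝ => f (castVec x ᵥ* O) := by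
  have hcont : Continuous fun x : Fin m → ℝ => castVec x ᵥ* O := by
    refine Continuous.matrix_vecMul ?_ continuous_const
    unfold castVec
    fun_prop
  refine (hf.comp hcont).measurableEmbedding fun x y hxy => ?_
  have h1 := congrArg (fun v => v ᵥ* Oᵀ) (hf' hxy)
  simp only [vecMul_vecMul, hO, vecMul_smul, vecMul_one] at h1
  have hε0 : ε ≠ 0 := by rcases hε with rfl | rfl <;> norm_num
  have h2 := smul_right_injective _ hε0 h1
  funext i
  exact Complex.ofReal_injective (congrFun h2 i)

lemma measurableEmbedding_left (hε : ε = 1 ∨ ε = -1) (hO : O * Oᵀ = ε • 1) :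
    MeasurableEmbedding fun x : Fin m → ℝ => (Sum.elim (castVec x ᵥ* O) 0 : Sp m) :=
  measurableEmbedding_of_gram hε hO (fun v => Sum.elim v 0)
    (continuous_pi fun k => by rcases k with k | k <;> simp <;> fun_prop)
    fun v w h => funext fun k => congrFun h (Sum.inl k)

lemma measurableEmbedding_right (hε : ε = 1 ∨ ε = -1) (hO : O * Oᵀ = ε • 1) :
    MeasurableEmbedding fun x : Fin m → ℝ => (Sum.elim (0 : Fin m → ℂ) (castVec x ᵥ* O) : Sp m) :=
  measurableEmbedding_of_gram hε hO (fun v => Sum.elim 0 v)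
    (continuous_pi fun k => by rcases k with k | k <;> simp <;> fun_prop)
    fun v w h => funext fun k => congrFun h (Sum.inr k)

lemma frame_exponent {ħ : ℝ} (hħ : ħ ≠ 0) (K : Matrix (Idx m) (Idx m) ℂ) (s : ℝ) (z : Idx m → ℝ)
    (u : Sp m) :
    1 / (4 * I * (ħ : ℂ)) * ((castVec z ᵥ* frameMat O) ⬝ᵥ
        (K + (s : ℂ) • swapMat m) *ᵥ (castVec z ᵥ* frameMat O)) +
      1 / (I * (ħ : ℂ)) * ((castVec z ᵥ* frameMat O) ⬝ᵥ u) =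
    -(castVec z ⬝ᵥ gaussMat ħ O K s *ᵥ castVec z) +
      ((1 / (I * (ħ : ℂ))) • (frameMat O *ᵥ u)) ⬝ᵥ castVec z := by
  have hħ' : (ħ : ℂ) ≠ 0 := by exact_mod_cast hħ
  rw [gaussMat, smul_mulVec, dotProduct_smul, castVec_dotProduct_frame, smul_mulVec,
    dotProduct_smul, smul_dotProduct, dotProduct_comm (frameMat O *ᵥ u),
    dotProduct_mulVec (castVec z) (frameMat O), smul_eq_mul, smul_eq_mul, smul_eq_mul]
  congr 1
  field_simp
  rw [I_sq]
  ring

lemma starExpLin_frame {ħ : ℝ} (hħ : ħ ≠ 0) (K : Matrix (Idx m) (Idx m) ℂ) (z : Idx m → ℝ)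
    (u : Sp m) :
    starExpLin ħ K (castVec z ᵥ* frameMat O) u =
      cexp (-(castVec z ⬝ᵥ gaussMat ħ O K 0 *ᵥ castVec z) +
        ((1 / (I * (ħ : ℂ))) • (frameMat O *ᵥ u)) ⬝ᵥ castVec z) := by
  rw [← frame_exponent hħ, starExpLin, dotProduct_mulVec]
  simp

/-- The cross term in K completes the square at a + b, and the hypothesis absorbs the J term as a
shift of K by sP. For vectors from opposite halves it holds with s = 1 or s = −1 according to their
order. -/
lemma starMul_starExpLin_add {ħ : ℝ} (hħ : ħ ≠ 0) {K : Matrix (Idx m) (Idx m) ℂ} (hK : K.IsSymm)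
    {s : ℝ} {a b : Sp m}
    (hab : 2 * (a ⬝ᵥ Matrix.J (Fin m) ℂ *ᵥ b) = s * ((a + b) ⬝ᵥ swapMat m *ᵥ (a + b))) (u : Sp m) :
    starMul ħ K (starExpLin ħ K a) (starExpLin ħ K b) u =
      cexp (1 / (4 * I * (ħ : ℂ)) * ((a + b) ⬝ᵥ (K + (s : ℂ) • swapMat m) *ᵥ (a + b)) +
        1 / (I * (ħ : ℂ)) * ((a + b) ⬝ᵥ u)) := by
  have hħ' : (ħ : ℂ) ≠ 0 := by exact_mod_cast hħ
  have hba : b ⬝ᵥ K *ᵥ a = a ⬝ᵥ K *ᵥ b := by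
    rw [dotProduct_mulVec, ← mulVec_transpose, hK.eq, dotProduct_comm]
  rw [starMul_starExpLin hħ, starExpLin, starExpLin, ← Complex.exp_add, ← Complex.exp_add,
    add_mulVec K (_ • _), dotProduct_add (a + b), smul_mulVec, dotProduct_smul, smul_eq_mul, ← hab,
    add_mulVec, dotProduct_add a, mulVec_add, dotProduct_add, add_dotProduct, add_dotProduct,
    add_dotProduct, hba, ← dotProduct_mulVec, ← dotProduct_mulVec]
  congr 1
  field_simp
  ring

lemma starMul_frame_right_left {ħ : ℝ} (hħ : ħ ≠ 0) {K : Matrix (Idx m) (Idx m) ℂ} (hK : K.IsSymm)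
    (x y : Fin m → ℝ) (u : Sp m) :
    starMul ħ K (starExpLin ħ K (Sum.elim 0 (castVec y ᵥ* O)))
        (starExpLin ħ K (Sum.elim (castVec x ᵥ* O) 0)) u =
      cexp (-(castVec (Sum.elim x y) ⬝ᵥ gaussMat ħ O K 1 *ᵥ castVec (Sum.elim x y)) +
        ((1 / (I * (ħ : ℂ))) • (frameMat O *ᵥ u)) ⬝ᵥ castVec (Sum.elim x y)) := by
  have hsum : (Sum.elim (0 : Fin m → ℂ) (castVec y ᵥ* O) + Sum.elim (castVec x ᵥ* O) 0 : Sp m) =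
      castVec (Sum.elim x y) ᵥ* frameMat O := by
    rw [castVec_vecMul_frameMat]
    funext k
    rcases k with k | k <;> simp
  rw [starMul_starExpLin_add hħ hK (s := 1), hsum, frame_exponent hħ]
  rw [dotProduct_swapMat, dotProduct_mulVec, vecMul_J]
  simp [dotProduct, mul_comm]

lemma starMul_frame_left_right {ħ : ℝ} (hħ : ħ ≠ 0) {K : Matrix (Idx m) (Idx m) ℂ} (hK : K.IsSymm)
    (x y : Fin m → ℝ) (u : Sp m) :
    starMul ħ K (starExpLin ħ K (Sum.elim (castVec x ᵥ* O) 0))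
        (starExpLin ħ K (Sum.elim 0 (castVec y ᵥ* O))) u =
      cexp (-(castVec (Sum.elim x y) ⬝ᵥ gaussMat ħ O K (-1) *ᵥ castVec (Sum.elim x y)) +
        ((1 / (I * (ħ : ℂ))) • (frameMat O *ᵥ u)) ⬝ᵥ castVec (Sum.elim x y)) := by
  have hsum : (Sum.elim (castVec x ᵥ* O) 0 + Sum.elim (0 : Fin m → ℂ) (castVec y ᵥ* O) : Sp m) =
      castVec (Sum.elim x y) ᵥ* frameMat O := by
    rw [castVec_vecMul_frameMat]
    funext k
    rcases k with k | k <;> simp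
  rw [starMul_starExpLin_add hħ hK (s := -1), hsum, frame_exponent hħ]
  rw [dotProduct_swapMat, dotProduct_mulVec, vecMul_J]
  simp [dotProduct]

/-- The value of the Gaussian integral over the frame is a member of the Gaussian family. -/
lemma gaussInt_frame {ħ : ℝ} (hħ : 0 < ħ) (hε : ε = 1 ∨ ε = -1) (hO : O * Oᵀ = ε • 1) {c : ℝ}
    (hc : 0 < c) {K : Matrix (Idx m) (Idx m) ℂ} (hK : K.IsSymm) (h : IsFramePos O c K) {s : ℝ}
    (hs : s ^ 2 = 1) (u : Sp m) :
    (1 / (2 * Real.pi * ħ) : ℂ) ^ m *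
        gaussInt (gaussMat ħ O K s) ((1 / (I * (ħ : ℂ))) • (frameMat O *ᵥ u)) =
      2 ^ m * gaussianFamily ħ K (-s) u := by
  have hħ' : (ħ : ℂ) ≠ 0 := by exact_mod_cast hħ.ne'
  have hε2 : ε * ε = 1 := by rcases hε with rfl | rfl <;> norm_num
  have hs' : (s : ℂ) * s = 1 := by rw [← pow_two]; exact_mod_cast hs
  obtain ⟨hdet, -, hg, -⟩ := (reBddBelow_gaussMat hħ hε hO h s).gaussian (by positivity)
    (gaussMat_isSymm ħ hK s)
  have hA := h.det_ne_zero hε hO hc hK s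
  rw [hg, ← mul_assoc, ← frameConst, frameConst_eq hħ hε hO hc hK h hs, gaussianFamily, mul_assoc]
  congr 3
  -- Since s = ±1, the pencil at −s is s(K + sP); this links the flow's exponent at its limiting
  -- time with the inverse produced by the Gaussian integral.
  have hresolv : ((-s : ℝ) : ℂ) • resolv K (-s) = -(K + (s : ℂ) • swapMat m)⁻¹ := by
    have e : pencil K (-s) = (s : ℂ) • (K + (s : ℂ) • swapMat m) := by
      rw [pencil, smul_add, smul_smul, hs', one_smul]
      push_cast
      module
    have e2 : resolv K (-s) = (s : ℂ) • (K + (s : ℂ) • swapMat m)⁻¹ := by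
      rw [resolv, e]
      refine Matrix.inv_eq_right_inv ?_
      rw [Matrix.smul_mul, Matrix.mul_smul, smul_smul, hs', one_smul,
        Matrix.mul_nonsing_inv _ hA.isUnit]
    rw [e2, smul_smul]
    push_cast
    rw [neg_mul, hs', neg_one_smul]
  rw [hresolv]
  set A := K + (s : ℂ) • swapMat m
  have hFF : (frameMat O)ᵀ * (ε • frameMat O) = 1 := by
    refine mul_eq_one_comm.mp ?_
    rw [Matrix.smul_mul, frameMat_mul_transpose hO, smul_smul, hε2, one_smul]
  have hX : (gaussMat ħ O K s)⁻¹ *ᵥ ((1 / (I * (ħ : ℂ))) • (frameMat O *ᵥ u)) =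
      (-4 : ℂ) • ((ε • frameMat O) *ᵥ (A⁻¹ *ᵥ u)) := by
    have e : (1 / (I * (ħ : ℂ))) • (frameMat O *ᵥ u) =
        gaussMat ħ O K s *ᵥ ((-4 : ℂ) • ((ε • frameMat O) *ᵥ (A⁻¹ *ᵥ u))) := by
      have e1 : gaussMat ħ O K s * (ε • frameMat O) * A⁻¹ = (1 / (4 * ħ) * I : ℂ) • frameMat O := by
        have e2 : gaussMat ħ O K s = (1 / (4 * ħ) * I : ℂ) • (frameMat O * A * (frameMat O)ᵀ) := by
          rw [gaussMat, Matrix.mul_smul, Matrix.smul_mul, smul_smul]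
        rw [e2, Matrix.smul_mul, Matrix.smul_mul, Matrix.mul_assoc (frameMat O * A), hFF,
          Matrix.mul_one, Matrix.mul_assoc, Matrix.mul_nonsing_inv _ hA.isUnit, Matrix.mul_one]
      rw [mulVec_smul, mulVec_mulVec, mulVec_mulVec, e1, smul_mulVec, smul_smul]
      congr 1
      field_simp
      rw [I_sq, neg_neg]
    rw [e, mulVec_mulVec, Matrix.nonsing_inv_mul _ hdet.isUnit, one_mulVec]
  rw [hX, dotProduct_smul, smul_dotProduct, ← vecMul_transpose, ← dotProduct_mulVec, mulVec_mulVec,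
    hFF, one_mulVec, neg_mulVec, dotProduct_neg]
  simp only [smul_eq_mul]
  ring

end SplitFrame

/-! ### Absolute convergence and evaluation of the delta-function integrals. -/

section Measures

variable {V : Submodule ℝ (Sp m)} {ε : ℂ} {O : Matrix (Fin m) (Fin m) ℂ}

lemma reBddBelow_toBlocks₁₁ {c : ℝ} {M : Matrix (Idx m) (Idx m) ℂ} (h : ReBddBelow c M) :
    ReBddBelow c M.toBlocks₁₁ := by
  intro x
  have h1 := h (Sum.elim x 0)
  simpa [castVec, dotProduct, mulVec, toBlocks₁₁, Fintype.sum_sum_type] using h1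

lemma reBddBelow_toBlocks₂₂ {c : ℝ} {M : Matrix (Idx m) (Idx m) ℂ} (h : ReBddBelow c M) :
    ReBddBelow c M.toBlocks₂₂ := by
  intro x
  have h1 := h (Sum.elim 0 x)
  simpa [castVec, dotProduct, mulVec, toBlocks₂₂, Fintype.sum_sum_type] using h1

lemma integrable_gaussian_left {c : ℝ} (hc : 0 < c) {M : Matrix (Idx m) (Idx m) ℂ} (hM : M.IsSymm)
    (h : ReBddBelow c M) (w : Sp m) : Integrable fun x : Fin m → ℝ =>
      cexp (-(castVec (Sum.elim x (0 : Fin m → ℝ)) ⬝ᵥ M *ᵥ castVec (Sum.elim x 0)) +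
        w ⬝ᵥ castVec (Sum.elim x 0)) := by
  have hM' : M.toBlocks₁₁.IsSymm := by
    ext i j
    exact hM.apply _ _
  have h1 := ((reBddBelow_toBlocks₁₁ h).gaussian hc hM').2.1 fun k => w (Sum.inl k)
  refine h1.congr (Eventually.of_forall fun x => ?_)
  simp [castVec, dotProduct, mulVec, toBlocks₁₁, Fintype.sum_sum_type]

lemma integrable_gaussian_right {c : ℝ} (hc : 0 < c) {M : Matrix (Idx m) (Idx m) ℂ} (hM : M.IsSymm)
    (h : ReBddBelow c M) (w : Sp m) : Integrable fun y : Fin m → ℝ =>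
      cexp (-(castVec (Sum.elim (0 : Fin m → ℝ) y) ⬝ᵥ M *ᵥ castVec (Sum.elim 0 y)) +
        w ⬝ᵥ castVec (Sum.elim 0 y)) := by
  have hM' : M.toBlocks₂₂.IsSymm := by
    ext i j
    exact hM.apply _ _
  have h1 := ((reBddBelow_toBlocks₂₂ h).gaussian hc hM').2.1 fun k => w (Sum.inr k)
  refine h1.congr (Eventually.of_forall fun x => ?_)
  simp [castVec, dotProduct, mulVec, toBlocks₂₂, Fintype.sum_sum_type]

lemma IsSplitFrame.integrable_deltaU (hO : IsSplitFrame V ε O) {ħ : ℝ} (hħ : 0 < ħ) {c : ℝ}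
    (hc : 0 < c) {K : Matrix (Idx m) (Idx m) ℂ} (hK : K.IsSymm) (h : IsFramePos O c K) (u : Sp m) :
    Integrable (fun ξ => starExpLin ħ K ξ u) (deltaU ħ V) := by
  rw [deltaU, dbar, hO.volume_left]
  refine Integrable.smul_measure ?_ ENNReal.ofReal_ne_top
  rw [(measurableEmbedding_left hO.sign hO.gram).integrable_map_iff]
  refine (integrable_gaussian_left (by positivity) (gaussMat_isSymm ħ hK 0)
    (reBddBelow_gaussMat hħ hO.sign hO.gram h 0)
    ((1 / (I * (ħ : ℂ))) • (frameMat O *ᵥ u))).congr (Eventually.of_forall fun x => ?_)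
  simp only [Function.comp_apply]
  rw [← starExpLin_frame hħ.ne', castVec_vecMul_frameMat]
  congr 1
  funext k
  rcases k with k | k <;> simp [castVec, vecMul, dotProduct]

lemma IsSplitFrame.integrable_deltaV (hO : IsSplitFrame V ε O) {ħ : ℝ} (hħ : 0 < ħ) {c : ℝ}
    (hc : 0 < c) {K : Matrix (Idx m) (Idx m) ℂ} (hK : K.IsSymm) (h : IsFramePos O c K) (u : Sp m) :
    Integrable (fun ξ => starExpLin ħ K ξ u) (deltaV ħ V) := by
  rw [deltaV, dbar, hO.volume_right]
  refine Integrable.smul_measure ?_ ENNReal.ofReal_ne_top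
  rw [(measurableEmbedding_right hO.sign hO.gram).integrable_map_iff]
  refine (integrable_gaussian_right (by positivity) (gaussMat_isSymm ħ hK 0)
    (reBddBelow_gaussMat hħ hO.sign hO.gram h 0)
    ((1 / (I * (ħ : ℂ))) • (frameMat O *ᵥ u))).congr (Eventually.of_forall fun x => ?_)
  simp only [Function.comp_apply]
  rw [← starExpLin_frame hħ.ne', castVec_vecMul_frameMat]
  congr 1
  funext k
  rcases k with k | k <;> simp [castVec, vecMul, dotProduct]

/-- Integration over a product of two scaled parametrized measures. -/
lemma integral_prod_smul_map {f g : (Fin m → ℝ) → Sp m} (hf : MeasurableEmbedding f)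
    (hg : MeasurableEmbedding g) (e : (Idx m → ℝ) ≃ᵐ (Fin m → ℝ) × (Fin m → ℝ))
    (he : MeasurePreserving e) {κ : ℝ} (hκ : 0 ≤ κ) {G : Sp m × Sp m → ℂ}
    (hG : Integrable fun z => G (f (e z).1, g (e z).2)) :
    Integrable G ((ENNReal.ofReal κ • Measure.map f volume).prod
        (ENNReal.ofReal κ • Measure.map g volume)) ∧
      ∫ ξ, ∫ η, G (ξ, η) ∂(ENNReal.ofReal κ • Measure.map g volume)
        ∂(ENNReal.ofReal κ • Measure.map f volume) =
      ((κ : ℂ) ^ 2) * ∫ z, G (f (e z).1, g (e z).2) := by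
  have hφ : MeasurableEmbedding fun z => (f (e z).1, g (e z).2) :=
    (hf.prodMap hg).comp e.measurableEmbedding
  have hmap : Measure.map (fun z => (f (e z).1, g (e z).2)) volume =
      (Measure.map f volume).prod (Measure.map g volume) := by
    rw [Measure.map_prod_map _ _ hf.measurable hg.measurable, ← Measure.volume_eq_prod, ← he.map_eq,
      Measure.map_map (hf.measurable.prodMap hg.measurable) e.measurable]
    rfl
  have hprod : (ENNReal.ofReal κ • Measure.map f volume).prod
      (ENNReal.ofReal κ • Measure.map g volume) = (ENNReal.ofReal κ * ENNReal.ofReal κ) •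
        Measure.map (fun z => (f (e z).1, g (e z).2)) volume := by
    rw [Measure.prod_smul_left, Measure.prod_smul_right, smul_smul, hmap]
  have hint : Integrable G ((ENNReal.ofReal κ • Measure.map f volume).prod
      (ENNReal.ofReal κ • Measure.map g volume)) := by
    rw [hprod]
    refine Integrable.smul_measure ?_ (ENNReal.mul_ne_top ENNReal.ofReal_ne_top ENNReal.ofReal_ne_top)
    rw [hφ.integrable_map_iff]
    exact hG
  refine ⟨hint, ?_⟩
  rw [← integral_prod G hint, hprod, integral_smul_measure, hφ.integral_map,
    ← ENNReal.ofReal_mul hκ, ENNReal.toReal_ofReal (mul_nonneg hκ hκ), Complex.real_smul]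
  push_cast
  rw [pow_two]

lemma dbar_const_sq {ħ : ℝ} (hħ : 0 < ħ) :
    (((Real.sqrt (2 * Real.pi * ħ))⁻¹ ^ m : ℝ) : ℂ) ^ 2 = (1 / (2 * Real.pi * ħ) : ℂ) ^ m := by
  have h : ((Real.sqrt (2 * Real.pi * ħ))⁻¹ ^ m) ^ 2 = (1 / (2 * Real.pi * ħ)) ^ m := by
    rw [← pow_mul, mul_comm m 2, pow_mul, inv_pow, Real.sq_sqrt (by positivity), one_div]
  rw [← Complex.ofReal_pow, h]
  push_cast
  rfl

variable {ħ : ℝ} {c : ℝ} {K : Matrix (Idx m) (Idx m) ℂ}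

theorem IsSplitFrame.deltaV_mul_deltaU (hO : IsSplitFrame V ε O) (hħ : 0 < ħ)
    (hc : 0 < c) (hK : K.IsSymm) (h : IsFramePos O c K) (u : Sp m) :
    Integrable (fun p : Sp m × Sp m => starMul ħ K (starExpLin ħ K p.1) (starExpLin ħ K p.2) u)
        ((deltaV ħ V).prod (deltaU ħ V)) ∧
      superposMul ħ K (deltaV ħ V) (deltaU ħ V) u = 2 ^ m * gaussianFamily ħ K (-1) u := by
  have hg := ((reBddBelow_gaussMat hħ hO.sign hO.gram h 1).gaussian (by positivity)
    (gaussMat_isSymm ħ hK 1)).2.1 ((1 / (I * (ħ : ℂ))) • (frameMat O *ᵥ u))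
  -- The halves are swapped because the outer integration variable runs over the right half, whereas
  -- frame coordinates list the left half first.
  let e := (MeasurableEquiv.sumPiEquivProdPi fun _ : Idx m => ℝ).trans MeasurableEquiv.prodComm
  have he : MeasurePreserving e :=
    Measure.measurePreserving_swap.comp (volume_measurePreserving_sumPiEquivProdPi fun _ => ℝ)
  have hG : ∀ z : Idx m → ℝ, starMul ħ K (starExpLin ħ K (Sum.elim 0 (castVec (e z).1 ᵥ* O)))
      (starExpLin ħ K (Sum.elim (castVec (e z).2 ᵥ* O) 0)) u =
      cexp (-(castVec z ⬝ᵥ gaussMat ħ O K 1 *ᵥ castVec z) +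
        ((1 / (I * (ħ : ℂ))) • (frameMat O *ᵥ u)) ⬝ᵥ castVec z) := by
    intro z
    rw [starMul_frame_right_left hħ.ne' hK]
    have : Sum.elim (e z).2 (e z).1 = z := Sum.elim_comp_inl_inr z
    rw [this]
  have key := integral_prod_smul_map (measurableEmbedding_right hO.sign hO.gram)
    (measurableEmbedding_left hO.sign hO.gram) e he
    (κ := (Real.sqrt (2 * Real.pi * ħ))⁻¹ ^ m) (by positivity)
    (G := fun p => starMul ħ K (starExpLin ħ K p.1) (starExpLin ħ K p.2) u)
    (hg.congr (Eventually.of_forall fun z => (hG z).symm))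
  rw [superposMul, deltaU, deltaV, dbar, dbar, hO.volume_left, hO.volume_right]
  refine ⟨key.1, key.2.trans ?_⟩
  rw [dbar_const_sq hħ, ← gaussInt_frame hħ hO.sign hO.gram hc hK h (one_pow 2)]
  simp only [hG]
  rfl

theorem IsSplitFrame.deltaU_mul_deltaV (hO : IsSplitFrame V ε O) (hħ : 0 < ħ)
    (hc : 0 < c) (hK : K.IsSymm) (h : IsFramePos O c K) (u : Sp m) :
    Integrable (fun p : Sp m × Sp m => starMul ħ K (starExpLin ħ K p.1) (starExpLin ħ K p.2) u)
        ((deltaU ħ V).prod (deltaV ħ V)) ∧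
      superposMul ħ K (deltaU ħ V) (deltaV ħ V) u = 2 ^ m * gaussianFamily ħ K 1 u := by
  have hg := ((reBddBelow_gaussMat hħ hO.sign hO.gram h (-1)).gaussian (by positivity)
    (gaussMat_isSymm ħ hK (-1))).2.1 ((1 / (I * (ħ : ℂ))) • (frameMat O *ᵥ u))
  let e := MeasurableEquiv.sumPiEquivProdPi fun _ : Idx m => ℝ
  have he : MeasurePreserving e := volume_measurePreserving_sumPiEquivProdPi fun _ => ℝ
  have hG : ∀ z : Idx m → ℝ, starMul ħ K (starExpLin ħ K (Sum.elim (castVec (e z).1 ᵥ* O) 0))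
      (starExpLin ħ K (Sum.elim 0 (castVec (e z).2 ᵥ* O))) u =
      cexp (-(castVec z ⬝ᵥ gaussMat ħ O K (-1) *ᵥ castVec z) +
        ((1 / (I * (ħ : ℂ))) • (frameMat O *ᵥ u)) ⬝ᵥ castVec z) := by
    intro z
    rw [starMul_frame_left_right hħ.ne' hK]
    have : Sum.elim (e z).1 (e z).2 = z := Sum.elim_comp_inl_inr z
    rw [this]
  have key := integral_prod_smul_map (measurableEmbedding_left hO.sign hO.gram)
    (measurableEmbedding_right hO.sign hO.gram) e he
    (κ := (Real.sqrt (2 * Real.pi * ħ))⁻¹ ^ m) (by positivity)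
    (G := fun p => starMul ħ K (starExpLin ħ K p.1) (starExpLin ħ K p.2) u)
    (hg.congr (Eventually.of_forall fun z => (hG z).symm))
  rw [superposMul, deltaU, deltaV, dbar, dbar, hO.volume_left, hO.volume_right]
  refine ⟨key.1, key.2.trans ?_⟩
  have h1 := gaussInt_frame hħ hO.sign hO.gram hc hK h (s := -1) (by norm_num) u
  rw [neg_neg] at h1
  rw [dbar_const_sq hħ, ← h1]
  simp only [hG]
  rfl

end Measures

end StarVac

end

theorem mainTheorem6 (m : ℕ) (ħ : ℝ) (hħ : 0 < ħ) :
    (∀ V : Submodule ℝ (StarVac.Sp m), StarVac.IsRealForm V → ∀ K ∈ StarVac.VClass ħ V,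
      (∀ u, MeasureTheory.Integrable
          (fun ξ => StarVac.starExpLin ħ K ξ u) (StarVac.deltaU ħ V)) ∧
      (∀ u, MeasureTheory.Integrable
          (fun ξ => StarVac.starExpLin ħ K ξ u) (StarVac.deltaV ħ V)) ∧
      (∀ u, MeasureTheory.Integrable
          (fun p : StarVac.Sp m × StarVac.Sp m => StarVac.starMul ħ K
            (StarVac.starExpLin ħ K p.1) (StarVac.starExpLin ħ K p.2) u)
          ((StarVac.deltaV ħ V).prod (StarVac.deltaU ħ V))) ∧
      StarVac.IsVacuum ħ K
        (StarVac.superposMul ħ K (StarVac.deltaV ħ V) (StarVac.deltaU ħ V)) ∧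
      (∀ u, MeasureTheory.Integrable
          (fun p : StarVac.Sp m × StarVac.Sp m => StarVac.starMul ħ K
            (StarVac.starExpLin ħ K p.1) (StarVac.starExpLin ħ K p.2) u)
          ((StarVac.deltaU ħ V).prod (StarVac.deltaV ħ V))) ∧
      StarVac.IsBarVacuum ħ K
        (StarVac.superposMul ħ K (StarVac.deltaU ħ V) (StarVac.deltaV ħ V))) ∧
    (∃ G : Set {K : Matrix (StarVac.Idx m) (StarVac.Idx m) ℂ // K.IsSymm},
      IsOpen G ∧ Dense G ∧ ∀ K ∈ G,
        (∃ ϖ, StarVac.IsVacuum ħ K.1 ϖ) ∧ (∃ ϖ, StarVac.IsBarVacuum ħ K.1 ϖ)) := by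
  refine ⟨fun V hV K hK => ?_, StarVac.exists_open_dense_vacuum hħ.ne'⟩
  obtain ⟨ε, O, hO⟩ := hV.exists_splitFrame
  obtain ⟨c, hc, hpos⟩ := hO.isFramePos hV hħ hK
  have hreg := hpos.isRegular hO.sign hO.gram hc hK.1
  have hU := hO.deltaV_mul_deltaU hħ hc hK.1 hpos
  have hB := hO.deltaU_mul_deltaV hħ hc hK.1 hpos
  refine ⟨hO.integrable_deltaU hħ hc hK.1 hpos, hO.integrable_deltaV hħ hc hK.1 hpos,
    fun u => (hU u).1, ?_, fun u => (hB u).1, ?_⟩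
  · convert hreg.isVacuum hħ.ne' hK.1 using 1
    funext u
    rw [(hU u).2]
    push_cast
    rfl
  · convert hreg.isBarVacuum hħ.ne' hK.1 using 1
    funext u
    rw [(hB u).2]
    push_cast
    rfl
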